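/- Let $V=V_0\oplus V_1$ be a finite dimensional real supervector space of dimension $(m,n)$ with a symplectic form $B$: $V_0$ and $V_1$ are orthogonal, $B|_{V_0}$ is nondegenerate and skew symmetric, and $B|_{V_1}$ is nondegenerate and symmetric. Fix an orientation of $V_1$, that is, one of the two elements $\pm\xi^1\cdots\xi^n$ of $\Lambda^n(V_1^*\otimes\mathbb C)$, where $(\xi^a)$ is dual to an orthonormal basis $(f_a)$ of $V_1\otimes\mathbb C$ with all $f_a\in V_1\cup iV_1$ (a symplectic basis). Let $d_V$ be the Liouville integral: for $\phi=\sum_I\xi^I\phi_I(x)$, $$\int_V d_V(v)\phi(v)=(2\pi)^{-m/2}\int_{\mathbb R^m}\Big(\tfrac{\partial}{\partial\xi^1}\cdots\tfrac{\partial}{\partial\xi^n}\phi\Big)\Big|_{\xi=0}\,|dx^1\cdots dx^m|,$$ where $(x,\xi)$ is dual to an oriented symplectic basis of $V$ (on $V_0$ a basis with $B(e_1,e_2)=B(e_3,e_4)=\dots=1$ and $B$ zero between different pairs). A function on $V$ is rapidly decreasing if all its coefficients $\phi_I$ are Schwartz functions. Let $\mathfrak{spo}(V)$ be the Lie superalgebra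 of endomorphisms of $V$ leaving $B$ invariant, seen also as a supermanifold; functions on it are functions on $\mathfrak{spo}(V)_0=\mathfrak{sp}(V_0)\oplus\mathfrak{so}(V_1)$ with values in $\Lambda(\mathfrak{spo}(V)_1^*)\otimes\mathbb C$. Let $\mathcal V^+$ (resp. $\mathcal V^-$) be the set of $X\in\mathfrak{spo}(V)_0$ such that $v\mapsto B(v,Xv)$ is positive (resp. negative) definite on $V_0$. A test distribution is $t=d_{(x,\zeta)}\psi$ with $\psi$ a smooth compactly supported function on $\mathfrak{spo}(V)$ and $d_{(x,\zeta)}$ the Berezin integral in linear coordinates; a generalized function on $\mathfrak{spo}(V)$ is a continuous linear form on the space of test distributions. The power $i^{(m-n)/2}$ is the principal one. Then the following hold. 1. The integral $\mathrm{Spf}_{an}(X)=\int_V d_V(v)\exp(-\frac12B(v,Xv))$, where $v$ is the generic point of $V$ and $X$ is the sum of a point of $\mathcal V^++i\,\mathfrak{spo}(V)_0$ and of the generic point of $\mathfrak{spo}(V)_1$, has a rapidly decreasing integrand. It defines a holomorphic function on $\mathcal V^++i\,\mathfrak{spo}(V)_0$ with values in $\Lambda(\mathfrak{spo}(V)_1^*)\otimes\mathbb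 C$, which is real analytic on $\mathcal V^+$ (the analytic superPfaffian). 2. For every test distribution $t$ on $\mathfrak{spo}(V)$ the function $v\mapsto\int_{\mathfrak{spo}(V)}t(X)\exp(-\frac i2B(v,Xv))$ is rapidly decreasing on $V$, and $$\int_{\mathfrak{spo}(V)}t(X)\,\mathrm{Spf}(X)=i^{\frac{m-n}2}\int_Vd_V(v)\int_{\mathfrak{spo}(V)}t(X)\exp\big(-\tfrac i2B(v,Xv)\big)$$ defines a generalized function $\mathrm{Spf}$ on the whole supermanifold $\mathfrak{spo}(V)$. 3. $\mathrm{Spf}$ is the boundary value $\lim_{Y\to0,\,Y\in\mathcal V^-}i^{\frac{m-n}2}\mathrm{Spf}_{an}(i(X+iY))$: for every test distribution $t$, $$\int_{\mathfrak{spo}(V)}t(X)\,i^{\frac{m-n}2}\mathrm{Spf}_{an}(i(X+iY))\longrightarrow\int_{\mathfrak{spo}(V)}t(X)\,\mathrm{Spf}(X)\qquad(Y\to0,\ Y\in\mathcal V^-).$$ 4. The restriction of $\mathrm{Spf}$ to $\mathcal V^+$ is the analytic superPfaffian: $\int_{\mathfrak{spo}(V)}t(X)\,\mathrm{Spf}(X)=\int_{\mathfrak{spo}(V)}t(X)\,\mathrm{Spf}_{an}(X)$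 for every test distribution $t$ supported in $\mathcal V^+$. -/

import Mathlib

open Filter Topology
open scoped TensorProduct Distributions

noncomputable section

namespace SuperPf

/-! ### Grassmann algebras, odd derivatives, Berezin integrals -/

section Grassmann

variable {E F : Type*} [AddCommGroup E] [Module ℝ E] [AddCommGroup F] [Module ℝ F]

/-- `Λ(E^* ⊗ ℂ)`, the complex valued functions on the purely odd real vector space `E`;
`E^* ⊗ ℂ` is realized as the space of real linear maps from `E` to `ℂ`. -/
abbrev Gr (E : Type*) [AddCommGroup E] [Module ℝ E] : Type _ :=
  ExteriorAlgebra ℂ (E →ₗ[ℝ] ℂ)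

/-- The complexification of a real basis of `E^*`: the dual basis of a basis `b` of `E`. -/
def dualBasis {ι : Type*} [Finite ι] (b : Module.Basis ι ℝ E) : Module.Basis ι ℂ (E →ₗ[ℝ] ℂ) :=
  letI := Fintype.ofFinite ι
  Module.Basis.ofEquivFun (b.constr ℂ).symm

/-- The monomials `ξ^I` (factors in increasing order) in the coordinates dual to `b`,
a basis of `Λ(E^* ⊗ ℂ)`. -/
def monomials {ι : Type*} [Finite ι] [LinearOrder ι] (b : Module.Basis ι ℝ E) :
    Module.Basis (Finset ι) ℂ (Gr E) :=
  (dualBasis b).ExteriorAlgebra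

/-- The constant term. -/
def body : Gr E →ₐ[ℂ] ℂ := ExteriorAlgebra.algebraMapInv

/-- Substitution along a linear map `g : E → F`: the algebra morphism `Λ(F^*) → Λ(E^*)`
which extends `φ ↦ φ ∘ g`. -/
def pull (g : E →ₗ[ℝ] F) : Gr F →ₐ[ℂ] Gr E :=
  ExteriorAlgebra.map
    { toFun := fun φ => φ ∘ₗ g
      map_add' := fun _ _ => rfl
      map_smul' := fun _ _ => rfl }

/-- Multiplication of all odd coordinates by the complex number `c`, that is `φ ↦ φ(c · )`. -/
def rescale (c : ℂ) : Gr E →ₐ[ℂ] Gr E := ExteriorAlgebra.map (c • LinearMap.id)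

/-- A vector of `E ⊗ ℂ` as a linear form on `E^* ⊗ ℂ`. -/
def evalAt (w : ℂ ⊗[ℝ] E) : Module.Dual ℂ (E →ₗ[ℝ] ℂ) where
  toFun φ := LinearMap.liftBaseChange ℂ φ w
  map_add' φ ψ :=
    LinearMap.congr_fun (map_add (LinearMap.liftBaseChangeEquiv (R := ℝ) ℂ) φ ψ) w
  map_smul' c φ :=
    LinearMap.congr_fun (map_smul (LinearMap.liftBaseChangeEquiv (R := ℝ) ℂ) c φ) w

/-- The odd (left) derivation of `Λ(E^* ⊗ ℂ)` in the direction `w`: it maps a linear form `φ`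
to `φ(w)`. For a basis `(f_a)` with dual basis `(ξ^a)`, `oddDeriv (f a)` is `∂/∂ξ^a`. -/
def oddDeriv (w : ℂ ⊗[ℝ] E) : Gr E →ₗ[ℂ] Gr E := CliffordAlgebra.contractLeft (evalAt w)

/-- `∂/∂ξ^1 ⋯ ∂/∂ξ^n` for the vectors `f_1, …, f_n`. -/
def berezin {n : ℕ} (f : Fin n → ℂ ⊗[ℝ] E) : Gr E →ₗ[ℂ] Gr E :=
  (List.ofFn fun a => (oddDeriv (f a) : Module.End ℂ (Gr E))).prod

/-- The exponential of an even element of a Grassmann algebra: the exponential of the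
body times the (finite) exponential series of the nilpotent part. -/
def gexp (a : Gr E) : Gr E :=
  Complex.exp (body a) • IsNilpotent.exp (a - algebraMap ℂ (Gr E) (body a))

/-- Coefficientwise Lebesgue integral over `ℝ^κ` of a function with values in the
finite dimensional space `Λ(E^* ⊗ ℂ)`. -/
def grIntegral [FiniteDimensional ℝ E] {κ : Type*} [Fintype κ] (g : (κ → ℝ) → Gr E) : Gr E :=
  ∑ I, (∫ x, (monomials (Module.finBasis ℝ E)).repr (g x) I) • monomials (Module.finBasis ℝ E) I

/-- A function on the supermanifold with even part `V₀` and odd part `E` is rapidly decreasing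
if all its coefficients are. -/
def RapidlyDecreasing {V₀ : Type*} [NormedAddCommGroup V₀] [NormedSpace ℝ V₀]
    (φ : V₀ → Gr E) : Prop :=
  ∀ ℓ : Module.Dual ℂ (Gr E), ∃ s : SchwartzMap V₀ ℂ, ∀ v, s v = ℓ (φ v)

end Grassmann

/-! ### Test functions and generalized functions on a supermanifold `E₀ ⊕ ℝ^{0|N}` -/

/-- Smooth compactly supported complex functions `ψ = ∑_I ζ^I ψ_I` on a supervector space with
even part `E₀` and odd coordinates `ζ^1, …, ζ^N`, given by their coefficients. -/
abbrev SuperTest (E₀ : Type*) [NormedAddCommGroup E₀] [NormedSpace ℝ E₀] (N : ℕ) : Type _ :=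
  Finset (Fin N) → 𝓓((⊤ : TopologicalSpace.Opens E₀), ℂ)

/-- Complex valued generalized functions: the continuous linear forms on the space of smooth
compactly supported distributions `d_{(x,ζ)} ψ`. -/
abbrev GeneralizedFunction (E₀ : Type*) [NormedAddCommGroup E₀] [NormedSpace ℝ E₀] (N : ℕ) :
    Type _ :=
  SuperTest E₀ N →L[ℂ] ℂ

/-! ### Symplectic oriented supervector spaces -/

variable {V₀ V₁ : Type*} [NormedAddCommGroup V₀] [NormedSpace ℝ V₀] [FiniteDimensional ℝ V₀]
  [NormedAddCommGroup V₁] [NormedSpace ℝ V₁] [FiniteDimensional ℝ V₁]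

/-- `(f_1, …, f_n)` is a symplectic basis of the quadratic space `(V₁, B₁)`: an orthonormal basis
of `V₁ ⊗ ℂ` whose members lie in `V₁` or in `i V₁`. -/
def IsOddSymplecticBasis (B₁ : LinearMap.BilinForm ℝ V₁) {n : ℕ}
    (f : Module.Basis (Fin n) ℂ (ℂ ⊗[ℝ] V₁)) : Prop :=
  (∀ a b, LinearMap.BilinForm.baseChange ℂ B₁ (f a) (f b) = if a = b then 1 else 0) ∧
  ∀ a, ∃ w : V₁, f a = (1 : ℂ) ⊗ₜ[ℝ] w ∨ f a = Complex.I ⊗ₜ[ℝ] w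

/-- The product `ξ^1 ⋯ ξ^n` of the coordinates dual to `f`. -/
def volumeElement {n : ℕ} (f : Module.Basis (Fin n) ℂ (ℂ ⊗[ℝ] V₁)) : Gr V₁ :=
  (List.ofFn fun a => ExteriorAlgebra.ι ℂ
    (((f.coord a).restrictScalars ℝ) ∘ₗ (TensorProduct.mk ℝ ℂ V₁ 1))).prod

variable (V₀ V₁) in
/-- A symplectic form and an orientation on the supervector space `V₀ ⊕ V₁`. -/
structure OrientedSymplectic where
  /-- the restriction of the form to the even part -/
  B₀ : LinearMap.BilinForm ℝ V₀
  /-- the restriction of the form to the odd part -/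
  B₁ : LinearMap.BilinForm ℝ V₁
  alt : B₀.IsAlt
  nondegenerate₀ : B₀.Nondegenerate
  symm : B₁.IsSymm
  nondegenerate₁ : B₁.Nondegenerate
  /-- the orientation, one of the two elements `± ξ^1 ⋯ ξ^n` -/
  orientation : Gr V₁
  isOrientation : ∃ (n : ℕ) (f : Module.Basis (Fin n) ℂ (ℂ ⊗[ℝ] V₁)),
    IsOddSymplecticBasis B₁ f ∧ orientation = volumeElement f

/-- An oriented symplectic basis; `dim V₀ = 2 k`, `dim V₁ = n`. -/
structure OrientedSymplectic.OrientedBasis (S : OrientedSymplectic V₀ V₁) (k n : ℕ) where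
  /-- the even part, the direct sum of the symplectic pairs `e (j, 0), e (j, 1)` -/
  e : Module.Basis (Fin k × Fin 2) ℝ V₀
  e_pair : ∀ j, S.B₀ (e (j, 0)) (e (j, 1)) = 1
  e_orth : ∀ i j a b, i ≠ j → S.B₀ (e (i, a)) (e (j, b)) = 0
  /-- the odd part -/
  f : Module.Basis (Fin n) ℂ (ℂ ⊗[ℝ] V₁)
  f_symplectic : IsOddSymplecticBasis S.B₁ f
  f_oriented : volumeElement f = S.orientation

namespace OrientedSymplectic

variable (S : OrientedSymplectic V₀ V₁)

/-- The even part `sp(V₀) ⊕ so(V₁)` of `spo(V)`. -/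
def spo₀ : Submodule ℝ ((V₀ →L[ℝ] V₀) × (V₁ →L[ℝ] V₁)) where
  carrier := {X | (∀ v w, S.B₀ (X.1 v) w + S.B₀ v (X.1 w) = 0) ∧
    ∀ v w, S.B₁ (X.2 v) w + S.B₁ v (X.2 w) = 0}
  add_mem' := by
    rintro X Y ⟨h1, h2⟩ ⟨h3, h4⟩
    refine ⟨fun v w => ?_, fun v w => ?_⟩
    · have := h1 v w; have := h3 v w; simp; linarith
    · have := h2 v w; have := h4 v w; simp; linarith
  zero_mem' := by simp
  smul_mem' := by
    rintro c X ⟨h1, h2⟩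
    refine ⟨fun v w => ?_, fun v w => ?_⟩
    · have := h1 v w; simp [← mul_add, this]
    · have := h2 v w; simp [← mul_add, this]

/-- The odd part of `spo(V)`: the odd endomorphisms `X = (X.1 : V₁ → V₀, X.2 : V₀ → V₁)` such that
`B(Xv, w) + (-1)^{p(v)} B(v, Xw) = 0` for homogeneous `v`, `w`. -/
def spo₁ : Submodule ℝ ((V₁ →ₗ[ℝ] V₀) × (V₀ →ₗ[ℝ] V₁)) where
  carrier := {X | (∀ (v : V₀) (w : V₁), S.B₁ (X.2 v) w + S.B₀ v (X.1 w) = 0) ∧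
    ∀ (v : V₁) (w : V₀), S.B₀ (X.1 v) w - S.B₁ v (X.2 w) = 0}
  add_mem' := by
    rintro X Y ⟨h1, h2⟩ ⟨h3, h4⟩
    refine ⟨fun v w => ?_, fun v w => ?_⟩
    · have := h1 v w; have := h3 v w; simp; linarith
    · have := h2 v w; have := h4 v w; simp; linarith
  zero_mem' := by simp
  smul_mem' := by
    rintro c X ⟨h1, h2⟩
    refine ⟨fun v w => ?_, fun v w => ?_⟩
    · have := h1 v w; simp [← mul_add, this]
    · have := h2 v w; simp [← mul_sub, this]

/-- The open cone `𝒱⁺` of the `X` such that `B(v, Xv)` is positive definite on `V₀`. -/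
def Vplus : Set S.spo₀ := {X | ∀ v : V₀, v ≠ 0 → 0 < S.B₀ v (X.1.1 v)}

/-- The open cone `𝒱⁻` of the `X` such that `B(v, Xv)` is negative definite on `V₀`. -/
def Vminus : Set S.spo₀ := {X | ∀ v : V₀, v ≠ 0 → S.B₀ v (X.1.1 v) < 0}

/-- The coordinates `ξ^a` (on `V₁`) as odd functions on `spo(V) × V`. -/
def xi (a : Fin (Module.finrank ℝ V₁)) : Gr (S.spo₁ × V₁) :=
  pull (LinearMap.snd ℝ S.spo₁ V₁)
    (ExteriorAlgebra.ι ℂ (dualBasis (Module.finBasis ℝ V₁) a))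

/-- The coordinates `Z^l` (on `spo(V)₁`) as odd functions on `spo(V) × V`. -/
def zeta (l : Fin (Module.finrank ℝ S.spo₁)) : Gr (S.spo₁ × V₁) :=
  pull (LinearMap.fst ℝ S.spo₁ V₁)
    (ExteriorAlgebra.ι ℂ (dualBasis (Module.finBasis ℝ S.spo₁) l))

/-- `B(v, Xv)` where `v` is the generic point of `V` (with even part `v₀`)
and `X` is an even element of `spo(V)`: by `B(v, Xv) = ∑ B(g_i, X g_j) z^j z^i`. -/
def quadEven (X : S.spo₀) (v₀ : V₀) : Gr (S.spo₁ × V₁) :=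
  algebraMap ℂ _ (S.B₀ v₀ (X.1.1 v₀) : ℂ) +
    ∑ a, ∑ b, (S.B₁ (Module.finBasis ℝ V₁ a) (X.1.2 (Module.finBasis ℝ V₁ b)) : ℂ) •
      (S.xi b * S.xi a)

/-- `B(v, Ξv)` where `v` is the generic point of `V` (with even part `v₀`)
and `Ξ = ∑ G_l Z^l` is the generic point of `spo(V)₁`:
by `B(v, Ξv) = ∑ B(g_i, G_l g_j) z^j Z^l z^i`. -/
def quadOdd (v₀ : V₀) : Gr (S.spo₁ × V₁) :=
  ∑ l, ∑ a,
    ((S.B₀ v₀ ((Module.finBasis ℝ S.spo₁ l).1.1 (Module.finBasis ℝ V₁ a)) : ℂ) •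
        (S.xi a * S.zeta l) +
      (S.B₁ (Module.finBasis ℝ V₁ a) ((Module.finBasis ℝ S.spo₁ l).1.2 v₀) : ℂ) •
        (S.zeta l * S.xi a))

/-- `B(v, (X + iY + Ξ)v)`, where `X + iY` is a point of `spo(V ⊗ ℂ)₀` and
`Ξ` is the generic point of `spo(V)₁`. -/
def quad (X Y : S.spo₀) (v₀ : V₀) : Gr (S.spo₁ × V₁) :=
  S.quadEven X v₀ + Complex.I • S.quadEven Y v₀ + S.quadOdd v₀

variable {S} {k n : ℕ}

/-- The Liouville integral `∫_V d_V(v) φ(v)`. -/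
def OrientedBasis.integral (b : S.OrientedBasis k n) (φ : V₀ → Gr V₁) : ℂ :=
  ((2 * Real.pi : ℂ) ^ k)⁻¹ *
    ∫ x : Fin k × Fin 2 → ℝ, body (berezin b.f (φ (b.e.equivFun.symm x)))

/-- The Liouville integral `∫_V d_V(v) φ(Ξ, v)` of a function which depends on the odd parameter
`Ξ` in `spo(V)₁`. -/
def OrientedBasis.integralParam (b : S.OrientedBasis k n) (φ : V₀ → Gr (S.spo₁ × V₁)) :
    Gr S.spo₁ :=
  ((2 * Real.pi : ℂ) ^ k)⁻¹ •
    grIntegral fun x : Fin k × Fin 2 → ℝ =>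
      pull (LinearMap.inl ℝ S.spo₁ V₁)
        (berezin (fun a => (LinearMap.inr ℝ S.spo₁ V₁).baseChange ℂ (b.f a))
          (φ (b.e.equivFun.symm x)))

/-- The analytic superPfaffian `Spf_an(X + iY) = ∫_V d_V(v) exp(-½ B(v, (X + iY + Ξ)v))`, a
function of `X + iY` (with `X` in `𝒱⁺` and `Y` in `spo(V)₀`) with values in `Λ(spo(V)₁^* ⊗ ℂ)`. -/
def OrientedBasis.spfAn (b : S.OrientedBasis k n) (X Y : S.spo₀) : Gr S.spo₁ :=
  b.integralParam fun v => gexp (-(1 / 2 : ℂ) • S.quad X Y v)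

variable (V₀ V₁) in
/-- `i^{(m-n)/2}` (the principal value, if `n` is odd), where `(m, n) = dim V`. -/
def phase : ℂ :=
  Complex.I ^ (((Module.finrank ℝ V₀ : ℂ) - (Module.finrank ℝ V₁ : ℂ)) / 2)

/-- `i^{(m-n)/2} Spf_an(i(X + iY))` as a function of `X + iY`, `Y` in `𝒱⁻`, with values in
`Λ(spo(V)₁^* ⊗ ℂ)`. As `X` stands for a point of the supermanifold `spo(V)`, its odd
coordinates are multiplied by `i` too; for the even ones, `i(X + iY) = -Y + iX`. -/
def OrientedBasis.spfAnRotated (b : S.OrientedBasis k n) (X Y : S.spo₀) : Gr S.spo₁ :=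
  phase V₀ V₁ • rescale Complex.I (b.spfAn (-Y) X)

variable {ι : Type*} [Fintype ι] {N : ℕ}

/-- The value at `X` of the test function with coefficients `t`, in the odd coordinates dual to
the basis `c₁` of `spo(V)₁`. -/
def testValue (c₁ : Module.Basis (Fin N) ℝ S.spo₁) (t : SuperTest S.spo₀ N) (X : S.spo₀) :
    Gr S.spo₁ :=
  ∑ I, t I X • monomials c₁ I

/-- `∫_{spo(V)} t(X) h(X)` for a function `h` on `spo(V)`, where `t = d_{(x,ζ)} ψ` and `(x, ζ)` are
the coordinates dual to the bases `c₀`, `c₁`. -/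
def pairing (c₀ : Module.Basis ι ℝ S.spo₀) (c₁ : Module.Basis (Fin N) ℝ S.spo₁)
    (t : SuperTest S.spo₀ N) (h : S.spo₀ → Gr S.spo₁) : ℂ :=
  ∫ x : ι → ℝ, body (berezin (fun l => (1 : ℂ) ⊗ₜ[ℝ] c₁ l)
    (testValue c₁ t (c₀.equivFun.symm x) * h (c₀.equivFun.symm x)))

/-- `∫_{spo(V)} t(X) h(X, v)` for a function `h` on `spo(V)` which depends on the odd parameter
in `V₁`. -/
def pairingParam (c₀ : Module.Basis ι ℝ S.spo₀) (c₁ : Module.Basis (Fin N) ℝ S.spo₁)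
    (t : SuperTest S.spo₀ N) (h : S.spo₀ → Gr (S.spo₁ × V₁)) : Gr V₁ :=
  grIntegral fun x : ι → ℝ =>
    pull (LinearMap.inr ℝ S.spo₁ V₁)
      (berezin (fun l => (LinearMap.inl ℝ S.spo₁ V₁).baseChange ℂ ((1 : ℂ) ⊗ₜ[ℝ] c₁ l))
        (pull (LinearMap.fst ℝ S.spo₁ V₁) (testValue c₁ t (c₀.equivFun.symm x)) *
          h (c₀.equivFun.symm x)))

/-- `∫_{spo(V)} t(X) exp(-(i/2) B(v, Xv))`, a function on the supermanifold `V`. -/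
def partialPairing (c₀ : Module.Basis ι ℝ S.spo₀) (c₁ : Module.Basis (Fin N) ℝ S.spo₁)
    (t : SuperTest S.spo₀ N) (v : V₀) : Gr V₁ :=
  pairingParam c₀ c₁ t fun X => gexp (-(Complex.I / 2) • S.quad X 0 v)

end OrientedSymplectic

end SuperPf

end

noncomputable section

open MeasureTheory

namespace SuperPf

/-! ### Gaussian Schwartz functions and analytic parameter integrals -/

section Analysis

open scoped Nat

/-! Everything rests on splitting `B(v, (X + iY + Ξ)v)` into a scalar, quadratic in the even part of
`v`, and a nilpotent element of degree two. The exponential series of the nilpotent part is finite,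
so each coefficient of the exponential of a multiple of the form is a scalar exponential times a
polynomial in the coordinates (`exists_dual_gexp_quad`).

Analytic side. For `X` in `𝒱⁺` the scalar exponential is a Gaussian, which gives rapid decay. The
integral over `V` is a Laplace integral whose exponent is linear in the complex coordinates of `X +
iY`; expanding the exponential under the integral gives holomorphy (`analyticAt_integral_mul_cexp`,
`analyticAt_laplace`).

Oscillatory side. Integrating a test function against `exp(-(i/2) B(v, Xv))` is a Fourier transform
evaluated at the moment map `v ↦ (B(v, X_j v))_j`. The elements `w ↦ B(u, w) u` of `sp(V₀)` and
nondegeneracy show that this map vanishes only at `0`, so it grows like `‖v‖²`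
(`exists_norm_le_moment`), and the composite with a Schwartz function is again Schwartz. This gives
the continuous linear form `Spf`.

Boundary value. Replacing `X` by `X + iY` multiplies the scalar exponential by `exp(½ B(v, Yv))`,
which is at most `1` for `Y` in `𝒱⁻`. Fubini holds for such `Y` by Gaussian decay in `v`, and
dominated convergence lets `Y` tend to `0`. The two orders of Berezin integration agree when `n` is
even; when `n` is odd both iterated integrals vanish by the symmetry `v ↦ -v`.

Restriction to `𝒱⁺`. For `X` in `𝒱⁺` and `Y` in `𝒱⁻` the integral `H(c)` of `exp(-(c/2) B(v, (X + iY
+ Ξ)v))` is analytic on the closed first quadrant without `0`. Rescaling `v` gives `H(c) =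
c^{(n-m)/2} H(1)` for `c > 0`, hence also at `c = i`. The factor `i^{(m-n)/2}` is exactly what
cancels, so the rotated function equals `Spf_an(X + iY)` (`spfAnRotated_eq`), and `Y` can tend to
`0` inside `𝒱⁻`. -/

theorem exists_one_add_pow_le_exp {c : ℝ} (hc : 0 < c) (m : ℕ) :
    ∃ M : ℝ, 0 < M ∧ ∀ r : ℝ, 0 ≤ r → (1 + r) ^ m ≤ M * Real.exp (c * r ^ 2) := by
  refine ⟨m ! * Real.exp (1 + 1 / (4 * c)), by positivity, fun r hr => ?_⟩
  have h1 : (1 + r) ^ m ≤ m ! * Real.exp (1 + r) := by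
    have := Real.pow_div_factorial_le_exp (1 + r) (by positivity) m
    rwa [div_le_iff₀' (by positivity)] at this
  refine h1.trans ?_
  rw [mul_assoc, ← Real.exp_add]
  refine mul_le_mul_of_nonneg_left (Real.exp_le_exp.2 ?_) (by positivity)
  have : 1 / (4 * c) + c * r ^ 2 - r = c * (r - 1 / (2 * c)) ^ 2 := by field_simp; ring
  nlinarith [mul_nonneg hc.le (sq_nonneg (r - 1 / (2 * c)))]

/-- Translating the argument of `exp` only multiplies it by a constant, so derivatives at `z` reduce
to derivatives at `0`. -/
theorem norm_iteratedFDeriv_cexp (i : ℕ) (z : ℂ) :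
    ‖iteratedFDeriv ℝ i Complex.exp z‖ =
      ‖Complex.exp z‖ * ‖iteratedFDeriv ℝ i Complex.exp 0‖ := by
  have h : (fun w => Complex.exp (w + z)) = Complex.exp z • Complex.exp := by
    ext w; simp [Complex.exp_add, mul_comm]
  have h1 := iteratedFDeriv_comp_add_right (𝕜 := ℝ) (f := Complex.exp) i z 0
  rw [h, zero_add, iteratedFDeriv_const_smul_apply
    (Complex.contDiff_exp (𝕜 := ℝ)).contDiffAt] at h1
  rw [← h1, norm_smul]

/-- The exponential of a function of temperate growth whose real part tends quadratically
to `-∞`. -/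
def gaussian {D : Type*} [NormedAddCommGroup D] [NormedSpace ℝ D] (Q : D → ℂ)
    (hQ : Q.HasTemperateGrowth) (hd : ∃ c > 0, ∀ v, (Q v).re ≤ -(c * ‖v‖ ^ 2)) :
    SchwartzMap D ℂ where
  toFun v := Complex.exp (Q v)
  smooth' := (Complex.contDiff_exp (𝕜 := ℝ)).comp hQ.1
  decay' := by
    intro k n
    obtain ⟨c, hc, hd⟩ := hd
    obtain ⟨l, C, hC, hgrowth⟩ := hQ.norm_iteratedFDeriv_le_uniform n
    obtain ⟨M, hM, hM'⟩ := exists_one_add_pow_le_exp hc (k + l * n)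
    set A : ℝ := ∑ i ∈ Finset.range (n + 1), ‖iteratedFDeriv ℝ i Complex.exp 0‖
    have hA : 0 ≤ A := Finset.sum_nonneg fun _ _ => norm_nonneg _
    refine ⟨n ! * A * (C + 1) ^ n * M, fun x => ?_⟩
    -- The bound for derivatives of a composite asks for estimates of the form `D ^ N`. Using `C +
    -- 1` makes the base at least `1`, so that its `N`-th power dominates for `N ≥ 1`.
    have hgrowth' (N : ℕ) (hN₁ : 1 ≤ N) (hN₂ : N ≤ n) :
        ‖iteratedFDeriv ℝ N Q x‖ ≤ ((C + 1) * (1 + ‖x‖) ^ l) ^ N := by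
      refine (hgrowth N hN₂ x).trans ?_
      rw [mul_pow]
      have hN₁' := (lt_of_lt_of_le zero_lt_one hN₁).ne'
      gcongr
      · exact le_trans (by simp) (le_self_pow₀ (by simp [hC]) hN₁')
      · refine le_self_pow₀ (one_le_pow₀ ?_) hN₁'
        simp only [le_add_iff_nonneg_right, norm_nonneg]
    have hexp : ‖Complex.exp (Q x)‖ ≤ Real.exp (-(c * ‖x‖ ^ 2)) := by
      rw [Complex.norm_exp]; exact Real.exp_le_exp.2 (hd x)
    have hbound (i) (hi : i ≤ n) : ‖iteratedFDeriv ℝ i Complex.exp (Q x)‖ ≤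
        A * Real.exp (-(c * ‖x‖ ^ 2)) := by
      rw [norm_iteratedFDeriv_cexp, mul_comm]
      gcongr
      exact Finset.single_le_sum (f := fun i => ‖iteratedFDeriv ℝ i Complex.exp 0‖)
        (fun _ _ => norm_nonneg _) (Finset.mem_range_succ_iff.2 hi)
    have key := norm_iteratedFDeriv_comp_le (𝕜 := ℝ)
      (Complex.contDiff_exp (𝕜 := ℝ)) hQ.1 (mod_cast le_top) x hbound hgrowth'
    have hx := hM' ‖x‖ (norm_nonneg _)
    calc ‖x‖ ^ k * ‖iteratedFDeriv ℝ n (fun v => Complex.exp (Q v)) x‖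
        ≤ (1 + ‖x‖) ^ k * (n ! * (A * Real.exp (-(c * ‖x‖ ^ 2))) *
            ((C + 1) * (1 + ‖x‖) ^ l) ^ n) := by
          gcongr
          · linarith
          · exact key
      _ = n ! * A * (C + 1) ^ n * ((1 + ‖x‖) ^ (k + l * n) * Real.exp (-(c * ‖x‖ ^ 2))) := by
          rw [mul_pow, pow_add, ← pow_mul]; ring
      _ ≤ n ! * A * (C + 1) ^ n * (M * Real.exp (c * ‖x‖ ^ 2) * Real.exp (-(c * ‖x‖ ^ 2))) := by
          gcongr
      _ = n ! * A * (C + 1) ^ n * M := by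
          rw [mul_assoc M, ← Real.exp_add]; simp

theorem gaussian_apply {D : Type*} [NormedAddCommGroup D] [NormedSpace ℝ D] (Q : D → ℂ)
    (hQ : Q.HasTemperateGrowth) (hd : ∃ c > 0, ∀ v, (Q v).re ≤ -(c * ‖v‖ ^ 2)) (v : D) :
    gaussian Q hQ hd v = Complex.exp (Q v) := rfl

/-- A parametric Laplace integral is analytic in the interior of its domain of convergence. -/
theorem analyticAt_integral_mul_cexp {Ω E : Type*} [MeasurableSpace Ω] {μ : Measure Ω}
    [NormedAddCommGroup E] [NormedSpace ℂ E] {w : Ω → ℂ} {T : Ω → E →L[ℂ] ℂ} {z₀ : E} {r : ℝ}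
    (hw : AEStronglyMeasurable w μ) (hT : AEStronglyMeasurable T μ) (hr : 0 < r)
    (h : Integrable (fun v => ‖w v * Complex.exp (T v z₀)‖ * Real.exp (r * ‖T v‖)) μ) :
    AnalyticAt ℂ (fun z => ∫ v, w v * Complex.exp (T v z) ∂μ) z₀ := by
  set W : Ω → ℂ := fun v => w v * Complex.exp (T v z₀) with hWdef
  have hTz (z : E) : AEStronglyMeasurable (fun v => T v z) μ :=
    (ContinuousLinearMap.apply ℂ ℂ z).continuous.comp_aestronglyMeasurable hT
  have hW : AEStronglyMeasurable W μ :=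
    hw.mul (Complex.continuous_exp.comp_aestronglyMeasurable (hTz z₀))
  let M (n : ℕ) (v : Ω) : ContinuousMultilinearMap ℂ (fun _ : Fin n => E) ℂ :=
    (ContinuousMultilinearMap.mkPiAlgebraFin ℂ n ℂ).compContinuousLinearMap fun _ => T v
  have hMm (n : ℕ) : AEStronglyMeasurable (M n) μ := by
    have hc : Continuous fun T : E →L[ℂ] ℂ =>
        (ContinuousMultilinearMap.mkPiAlgebraFin ℂ n ℂ).compContinuousLinearMap fun _ => T := by
      have := (ContinuousMultilinearMap.compContinuousLinearMapContinuousMultilinear ℂ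
        (fun _ : Fin n => E) (fun _ : Fin n => ℂ) ℂ).cont.comp
          (continuous_pi fun _ : Fin n => continuous_id (X := E →L[ℂ] ℂ))
      exact this.clm_apply continuous_const
    exact hc.comp_aestronglyMeasurable hT
  have hMn (n : ℕ) (v : Ω) : ‖M n v‖ ≤ ‖T v‖ ^ n := by
    refine (ContinuousMultilinearMap.norm_compContinuousLinearMap_le _ _).trans ?_
    simp
  have hMa (n : ℕ) (v : Ω) (y : E) : M n v (fun _ => y) = T v y ^ n := by
    simp [M]
  set K : ℝ := ∫ v, ‖W v‖ * Real.exp (r * ‖T v‖) ∂μ with hK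
  -- `(r‖T v‖)^n / n!` is a single term of the series of `exp(r‖T v‖)`. One integrable majorant
  -- therefore serves all `n`, which gives a radius of convergence at least `r`.
  have hpw (n : ℕ) (v : Ω) : ‖(W v * (n ! : ℂ)⁻¹) • M n v‖ * r ^ n ≤
      ‖W v‖ * Real.exp (r * ‖T v‖) := by
    rw [norm_smul, norm_mul, mul_assoc, mul_assoc]
    gcongr
    rw [norm_inv, Complex.norm_natCast]
    calc (n ! : ℝ)⁻¹ * (‖M n v‖ * r ^ n) ≤ (n ! : ℝ)⁻¹ * (‖T v‖ ^ n * r ^ n) := by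
          gcongr; exact hMn n v
      _ = (r * ‖T v‖) ^ n / n ! := by rw [mul_pow]; ring
      _ ≤ _ := Real.pow_div_factorial_le_exp _ (by positivity) n
  have hpi (n : ℕ) : Integrable (fun v => (W v * (n ! : ℂ)⁻¹) • M n v) μ := by
    refine (h.mul_const (r ^ n)⁻¹).mono' ((hW.mul_const _).smul (hMm n)) (ae_of_all _ fun v => ?_)
    exact (le_mul_inv_iff₀ (by positivity)).2 (hpw n v)
  have hnorm (n : ℕ) : (∫ v, ‖(W v * (n ! : ℂ)⁻¹) • M n v‖ ∂μ) * r ^ n ≤ K := by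
    rw [← integral_mul_const]
    exact integral_mono ((hpi n).norm.mul_const _) h fun v => hpw n v
  let p : FormalMultilinearSeries ℂ E ℂ := fun n => ∫ v, (W v * (n ! : ℂ)⁻¹) • M n v ∂μ
  refine ⟨p, ENNReal.ofReal r, ?_, by simpa using hr, ?_⟩
  · refine p.le_radius_of_bound K fun n => ?_
    refine le_trans ?_ (hnorm n)
    rw [Real.coe_toNNReal _ hr.le]
    gcongr
    exact norm_integral_le_integral_norm _
  · intro y hy
    have hy' : ‖y‖ < r := by
      rw [Metric.eball_ofReal] at hy
      simpa using hy
    have hpa (n : ℕ) : p n (fun _ => y) = ∫ v, W v * (n ! : ℂ)⁻¹ * T v y ^ n ∂μ := by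
      have := (ContinuousMultilinearMap.apply ℂ (fun _ : Fin n => E) ℂ
        (fun _ => y)).integral_comp_comm (hpi n)
      simp only [ContinuousMultilinearMap.apply_apply] at this
      rw [← this]
      simp [hMa]
    simp only [hpa]
    have hK0 : 0 ≤ K := integral_nonneg fun v => by positivity
    have hint (n : ℕ) : Integrable (fun v => W v * (n ! : ℂ)⁻¹ * T v y ^ n) μ := by
      have := (ContinuousMultilinearMap.apply ℂ (fun _ : Fin n => E) ℂ
        (fun _ => y)).integrable_comp (hpi n)
      simpa [hMa] using this
    -- Sum and integral may be exchanged because the integrals of the norms are dominated by a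
    -- geometric series of ratio `‖y‖ / r < 1`.
    have hs : Summable fun n : ℕ => ∫ v, ‖W v * (n ! : ℂ)⁻¹ * T v y ^ n‖ ∂μ := by
      have hq : Summable fun n : ℕ => K * (‖y‖ / r) ^ n :=
        (summable_geometric_of_lt_one (by positivity) ((div_lt_one hr).2 hy')).mul_left K
      refine hq.of_nonneg_of_le (fun n => integral_nonneg fun v => norm_nonneg _) fun n => ?_
      calc ∫ v, ‖W v * (n ! : ℂ)⁻¹ * T v y ^ n‖ ∂μ
          ≤ ∫ v, ‖(W v * (n ! : ℂ)⁻¹) • M n v‖ * ‖y‖ ^ n ∂μ := by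
            refine integral_mono (hint n).norm ((hpi n).norm.mul_const _) fun v => ?_
            have := ((W v * (n ! : ℂ)⁻¹) • M n v).le_opNorm (fun _ => y)
            simpa [hMa] using this
        _ = (∫ v, ‖(W v * (n ! : ℂ)⁻¹) • M n v‖ ∂μ) * ‖y‖ ^ n := integral_mul_const _ _
        _ = ((∫ v, ‖(W v * (n ! : ℂ)⁻¹) • M n v‖ ∂μ) * r ^ n) * (‖y‖ / r) ^ n := by
            rw [div_pow]; field_simp
        _ ≤ K * (‖y‖ / r) ^ n := by gcongr; exact hnorm n
    have := hasSum_integral_of_summable_integral_norm hint hs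
    convert this using 1
    refine integral_congr_ae (ae_of_all _ fun v => ?_)
    have hexp : HasSum (fun n : ℕ => W v * ((n ! : ℂ)⁻¹ * T v y ^ n)) (W v * Complex.exp (T v y)) := by
      have := NormedSpace.expSeries_div_hasSum_exp (T v y)
      rw [← Complex.exp_eq_exp_ℂ] at this
      simpa only [div_eq_inv_mul] using this.mul_left (W v)
    simp only [mul_assoc]
    rw [hexp.tsum_eq]
    simp only [hWdef, map_add, Complex.exp_add]
    ring

end Analysis

/-! ### Test functions and Fourier transforms -/

section

open scoped SchwartzMap ContDiff FourierTransform

/-- The inclusion of the test functions into the Schwartz space. -/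
def testToSchwartz (E : Type*) [NormedAddCommGroup E] [NormedSpace ℝ E] :
    𝓓((⊤ : TopologicalSpace.Opens E), ℂ) →L[ℂ] 𝓢(E, ℂ) :=
  TestFunction.mkCLM ℂ (fun f => f.hasCompactSupport.toSchwartzMap f.contDiff)
    (fun f g => by ext; simp) (fun c f => by ext; simp) <| by
  intro K hK
  let Φ : 𝓓_{K}(E, ℂ) →ₗ[ℂ] 𝓢(E, ℂ) :=
    { toFun := fun f => f.hasCompactSupport.toSchwartzMap f.contDiff
      map_add' := fun f g => by ext; simp
      map_smul' := fun c f => by ext; simp }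
  have hΦ : Continuous Φ := by
    refine WithSeminorms.continuous_of_isBounded
      (ContDiffMapSupportedIn.withSeminorms ℂ E ℂ ⊤ K)
      (schwartz_withSeminorms ℂ E ℂ) Φ (.of_real fun i => ?_)
    obtain ⟨R, hR⟩ := K.isCompact.isBounded.exists_norm_le
    -- On the fixed compact set the polynomial weight is bounded by a power of its radius, and off
    -- it the derivatives vanish.
    refine ⟨{i.2}, (max R 0) ^ i.1, fun f => ?_⟩
    refine SchwartzMap.seminorm_le_bound ℂ _ _ _
      (mul_nonneg (by positivity) (apply_nonneg _ _)) fun x => ?_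
    rw [Finset.sup_singleton]
    by_cases hx : x ∈ K
    · gcongr
      · exact (hR x hx).trans (le_max_left _ _)
      · exact ContDiffMapSupportedIn.norm_iteratedFDeriv_apply_le_seminorm_top ℂ
    · have : iteratedFDeriv ℝ i.2 (Φ f) x = 0 :=
        ContDiffMapSupportedIn.iteratedFDeriv_zero_on_compl f hx
      rw [this, norm_zero, mul_zero]
      exact mul_nonneg (by positivity) (apply_nonneg _ _)
  exact hΦ

section Fourier

variable {ι D : Type*} [Fintype ι] [NormedAddCommGroup D]

/-- The factor `(4π)⁻¹` matches the two conventions: `-(i/2)⟨x, g⟩ = -2πi ⟨x, g / (4π)⟩`. The growth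
condition is what keeps a Schwartz function rapidly decreasing after composition with `g`. -/
theorem exists_norm_le_of_rescaled {g : D → ι → ℝ} (hg : ∃ C, 0 ≤ C ∧ ∀ v, ‖v‖ ≤ C * (1 + ‖g v‖)) :
    ∃ (k : ℕ) (C : ℝ), ∀ v,
      ‖v‖ ≤ C * (1 + ‖(EuclideanSpace.equiv ι ℝ).symm ((4 * Real.pi)⁻¹ • g v)‖) ^ k := by
  obtain ⟨C, hC, h⟩ := hg
  refine ⟨1, C * (1 + 4 * Real.pi), fun v => (h v).trans ?_⟩
  have h1 : ‖g v‖ ≤ 4 * Real.pi * ‖(EuclideanSpace.equiv ι ℝ).symm ((4 * Real.pi)⁻¹ • g v)‖ := by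
    set u := (EuclideanSpace.equiv ι ℝ).symm ((4 * Real.pi)⁻¹ • g v) with hu
    refine (pi_norm_le_iff_of_nonneg (by positivity)).2 fun j => ?_
    have h2 := PiLp.norm_apply_le u j
    have h3 : u j = (4 * Real.pi)⁻¹ * g v j := rfl
    rw [h3, norm_mul, Real.norm_of_nonneg (by positivity), inv_mul_le_iff₀ (by positivity)] at h2
    exact h2
  rw [pow_one, mul_assoc]
  gcongr
  have := norm_nonneg ((EuclideanSpace.equiv ι ℝ).symm ((4 * Real.pi)⁻¹ • g v))
  nlinarith [Real.pi_pos]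

variable [NormedSpace ℝ D]

/-- `F ↦ (v ↦ ∫ F(x) exp(-(i/2) ⟨x, g(v)⟩) dx)` as a map of Schwartz spaces. -/
def fourierComp (g : D → ι → ℝ) (hg : g.HasTemperateGrowth)
    (hg' : ∃ C, 0 ≤ C ∧ ∀ v, ‖v‖ ≤ C * (1 + ‖g v‖)) : 𝓢(ι → ℝ, ℂ) →L[ℂ] 𝓢(D, ℂ) :=
  SchwartzMap.compCLM ℂ
      (g := fun v => (EuclideanSpace.equiv ι ℝ).symm ((4 * Real.pi)⁻¹ • g v))
      (by fun_prop)
      (exists_norm_le_of_rescaled hg') ∘L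
    FourierTransform.fourierCLM ℂ 𝓢(EuclideanSpace ℝ ι, ℂ) ∘L
    SchwartzMap.compCLMOfContinuousLinearEquiv ℂ (EuclideanSpace.equiv ι ℝ)

theorem fourierComp_apply (g : D → ι → ℝ) (hg : g.HasTemperateGrowth)
    (hg' : ∃ C, 0 ≤ C ∧ ∀ v, ‖v‖ ≤ C * (1 + ‖g v‖)) (F : 𝓢(ι → ℝ, ℂ)) (v : D) :
    fourierComp g hg hg' F v =
      ∫ x : ι → ℝ, F x * Complex.exp (-(Complex.I / 2) * ∑ j, (x j : ℂ) * (g v j : ℂ)) := by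
  have h : fourierComp g hg hg' F v =
      𝓕 (fun x : EuclideanSpace ℝ ι => F (EuclideanSpace.equiv ι ℝ x))
        ((EuclideanSpace.equiv ι ℝ).symm ((4 * Real.pi)⁻¹ • g v)) := rfl
  rw [h, Real.fourier_eq,
    ← (PiLp.volume_preserving_toLp (ι := ι)).integral_comp
      (MeasurableEquiv.toLp 2 (ι → ℝ)).measurableEmbedding]
  refine integral_congr_ae (ae_of_all _ fun x => ?_)
  simp only [Circle.smul_def, Real.fourierChar_apply, smul_eq_mul]
  rw [mul_comm]
  congr 2
  have : (inner ℝ (WithLp.toLp 2 x) ((EuclideanSpace.equiv ι ℝ).symm ((4 * Real.pi)⁻¹ • g v))) =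
      (4 * Real.pi)⁻¹ * ∑ j, x j * g v j := by
    simp [PiLp.inner_apply, Finset.mul_sum]
    exact Finset.sum_congr rfl fun _ _ => by ring
  rw [this]
  push_cast
  have := Real.pi_ne_zero
  field_simp
  norm_num

end Fourier

end

/-! ### Calculus in Grassmann algebras -/

section GrassmannCalculus

variable {E F G : Type*} [AddCommGroup E] [Module ℝ E] [AddCommGroup F] [Module ℝ F]
  [AddCommGroup G] [Module ℝ G]

theorem contractLeft_map {R M M' : Type*} [CommRing R] [AddCommGroup M] [Module R M]
    [AddCommGroup M'] [Module R M'] (f : M →ₗ[R] M') (d : Module.Dual R M')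
    (x : ExteriorAlgebra R M) :
    CliffordAlgebra.contractLeft d (ExteriorAlgebra.map f x) =
      ExteriorAlgebra.map f (CliffordAlgebra.contractLeft (d ∘ₗ f) x) := by
  induction x using CliffordAlgebra.left_induction with
  | algebraMap r =>
    rw [AlgHom.commutes, CliffordAlgebra.contractLeft_algebraMap,
      CliffordAlgebra.contractLeft_algebraMap, map_zero]
  | add x y hx hy => simp only [map_add, hx, hy]
  | ι_mul x m hx =>
    have h (N : Type _) [AddCommGroup N] [Module R N] (u : N) :
      CliffordAlgebra.ι (0 : QuadraticForm R N) u = ExteriorAlgebra.ι R u := rfl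
    rw [CliffordAlgebra.contractLeft_ι_mul, map_mul, h, ExteriorAlgebra.map_apply_ι,
      ← h, CliffordAlgebra.contractLeft_ι_mul, hx, map_sub, map_smul, map_mul, h, h,
      ExteriorAlgebra.map_apply_ι]
    rfl

theorem evalAt_tmul (c : ℂ) (v : E) (φ : E →ₗ[ℝ] ℂ) : evalAt (c ⊗ₜ[ℝ] v) φ = c * φ v := by
  simp [evalAt]

theorem evalAt_smul (c : ℂ) (w : ℂ ⊗[ℝ] E) : evalAt (c • w) = c • evalAt w := by
  ext φ; simp [evalAt]

theorem evalAt_baseChange (g : E →ₗ[ℝ] F) (w : ℂ ⊗[ℝ] E) (φ : F →ₗ[ℝ] ℂ) :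
    evalAt (g.baseChange ℂ w) φ = evalAt w (φ ∘ₗ g) := by
  induction w with
  | zero => simp [evalAt]
  | tmul c v => simp [evalAt_tmul]
  | add x y hx hy => simp only [evalAt, map_add, LinearMap.coe_mk, AddHom.coe_mk] at *; rw [hx, hy]

theorem berezin_zero (f : Fin 0 → ℂ ⊗[ℝ] E) (x : Gr E) : berezin f x = x := by
  simp [berezin]

theorem berezin_succ {n : ℕ} (f : Fin (n + 1) → ℂ ⊗[ℝ] E) (x : Gr E) :
    berezin f x = oddDeriv (f 0) (berezin (fun a => f a.succ) x) := by
  simp [berezin, List.ofFn_succ]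

/-- Change of variables for odd coordinates: each of the `n` derivatives contributes one factor `s`,
in the numerator and not in the denominator as for an even variable. -/
theorem berezin_map {n : ℕ} (g : (F →ₗ[ℝ] ℂ) →ₗ[ℂ] (E →ₗ[ℝ] ℂ)) (s : ℂ)
    {f : Fin n → ℂ ⊗[ℝ] E} {f' : Fin n → ℂ ⊗[ℝ] F}
    (h : ∀ a φ, evalAt (f a) (g φ) = s * evalAt (f' a) φ) (x : Gr F) :
    berezin f (ExteriorAlgebra.map g x) = s ^ n • ExteriorAlgebra.map g (berezin f' x) := by
  induction n with
  | zero => simp [berezin_zero]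
  | succ n ih =>
    rw [berezin_succ, berezin_succ, ih (fun a => h a.succ), map_smul, oddDeriv, contractLeft_map]
    have : evalAt (f 0) ∘ₗ g = s • evalAt (f' 0) := by ext φ; simp [h]
    rw [this, map_smul, LinearMap.smul_apply, map_smul, smul_smul, pow_succ, oddDeriv]

theorem berezin_pull {n : ℕ} (g : E →ₗ[ℝ] F) (s : ℂ)
    {f : Fin n → ℂ ⊗[ℝ] E} {f' : Fin n → ℂ ⊗[ℝ] F} (h : ∀ a, g.baseChange ℂ (f a) = s • f' a)
    (x : Gr F) : berezin f (pull g x) = s ^ n • pull g (berezin f' x) := by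
  refine berezin_map _ s (fun a φ => ?_) x
  have := evalAt_baseChange g (f a) φ
  rw [h, evalAt_smul] at this
  exact this.symm

theorem berezin_oddDeriv {n : ℕ} (f : Fin n → ℂ ⊗[ℝ] E) (w : ℂ ⊗[ℝ] E) (x : Gr E) :
    berezin f (oddDeriv w x) = (-1 : ℂ) ^ n • oddDeriv w (berezin f x) := by
  induction n with
  | zero => simp [berezin_zero]
  | succ n ih =>
    rw [berezin_succ, berezin_succ, ih, map_smul]
    have : oddDeriv (f 0) (oddDeriv w (berezin (fun a => f a.succ) x)) =
      - oddDeriv w (oddDeriv (f 0) (berezin (fun a => f a.succ) x)) :=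
      CliffordAlgebra.contractLeft_comm _ _ _
    rw [this, pow_succ, mul_neg_one, neg_smul, smul_neg]

/-- Odd derivatives anticommute, and each of the `N` of them passes `n` others. -/
theorem berezin_comm {n N : ℕ} (f : Fin n → ℂ ⊗[ℝ] E) (c : Fin N → ℂ ⊗[ℝ] E) (x : Gr E) :
    berezin f (berezin c x) = ((-1 : ℂ) ^ n) ^ N • berezin c (berezin f x) := by
  induction N with
  | zero => simp [berezin_zero]
  | succ N ih =>
    rw [berezin_succ, berezin_oddDeriv, ih, map_smul, smul_smul, berezin_succ c, pow_succ']

theorem pull_ι (g : E →ₗ[ℝ] F) (φ : F →ₗ[ℝ] ℂ) :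
    pull g (ExteriorAlgebra.ι ℂ φ) = ExteriorAlgebra.ι ℂ (φ ∘ₗ g) :=
  ExteriorAlgebra.map_apply_ι _ _

theorem rescale_ι (c : ℂ) (φ : E →ₗ[ℝ] ℂ) :
    rescale c (ExteriorAlgebra.ι ℂ φ) = c • ExteriorAlgebra.ι ℂ φ := by
  rw [rescale, ExteriorAlgebra.map_apply_ι]; simp

theorem body_ι (φ : E →ₗ[ℝ] ℂ) : body (ExteriorAlgebra.ι ℂ φ) = 0 := by
  simp [body, ExteriorAlgebra.algebraMapInv]

theorem body_map (g : (F →ₗ[ℝ] ℂ) →ₗ[ℂ] (E →ₗ[ℝ] ℂ)) (x : Gr F) :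
    body (ExteriorAlgebra.map g x) = body x := by
  have : (body (E := E)).comp (ExteriorAlgebra.map g) = body := by
    refine ExteriorAlgebra.hom_ext (LinearMap.ext fun φ => ?_)
    simp [body_ι]
  exact DFunLike.congr_fun this x

theorem body_pull (g : E →ₗ[ℝ] F) (x : Gr F) : body (pull g x) = body x := body_map _ x

theorem pull_pull (g : E →ₗ[ℝ] F) (h : F →ₗ[ℝ] G) (x : Gr G) :
    pull g (pull h x) = pull (h ∘ₗ g) x := by
  have : (pull g).comp (pull h) = pull (h ∘ₗ g) := by
    refine ExteriorAlgebra.hom_ext (LinearMap.ext fun φ => ?_)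
    simp [pull_ι, LinearMap.comp_assoc]
  exact DFunLike.congr_fun this x

theorem pull_id (x : Gr E) : pull LinearMap.id x = x := by
  have : pull (LinearMap.id : E →ₗ[ℝ] E) = AlgHom.id ℂ _ := by
    refine ExteriorAlgebra.hom_ext (LinearMap.ext fun φ => ?_)
    simp [pull_ι]
  exact DFunLike.congr_fun this x

theorem rescale_neg (c : ℂ) (x : Gr E) : rescale (-1) (rescale c x) = rescale (-c) x := by
  have : (rescale (E := E) (-1)).comp (rescale c) = rescale (-c) := by
    refine ExteriorAlgebra.hom_ext (LinearMap.ext fun φ => ?_)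
    simp [rescale_ι]
  exact DFunLike.congr_fun this x

theorem rescale_one (x : Gr E) : rescale 1 x = x := by
  have : rescale 1 = AlgHom.id ℂ (Gr E) := by
    refine ExteriorAlgebra.hom_ext (LinearMap.ext fun φ => ?_)
    simp [rescale_ι]
  exact DFunLike.congr_fun this x

/-- The derivative kills every linear form coming from `E` and only picks up a sign in passing it;
these signs together are the parity operator `rescale (-1)`. -/
theorem oddDeriv_inr_pull_fst_mul (w : ℂ ⊗[ℝ] F) (y : Gr E) (x : Gr (E × F)) :
    oddDeriv ((LinearMap.inr ℝ E F).baseChange ℂ w) (pull (LinearMap.fst ℝ E F) y * x) =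
      pull (LinearMap.fst ℝ E F) (rescale (-1) y) *
        oddDeriv ((LinearMap.inr ℝ E F).baseChange ℂ w) x := by
  induction y using CliffordAlgebra.left_induction with
  | algebraMap r =>
    rw [AlgHom.commutes, AlgHom.commutes, AlgHom.commutes]
    exact CliffordAlgebra.contractLeft_algebraMap_mul (Q := 0) _ _ _
  | add a b ha hb => simp only [map_add, add_mul, ha, hb]
  | ι_mul a m ha =>
    have h0 : CliffordAlgebra.ι (0 : QuadraticForm ℂ (E →ₗ[ℝ] ℂ)) m = ExteriorAlgebra.ι ℂ m := rfl
    have h1 : evalAt ((LinearMap.inr ℝ E F).baseChange ℂ w) (m ∘ₗ LinearMap.fst ℝ E F) = 0 := by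
      rw [evalAt_baseChange, LinearMap.comp_assoc, LinearMap.fst_comp_inr, LinearMap.comp_zero,
        map_zero]
    rw [h0, map_mul (pull _), map_mul (rescale _), map_mul (pull _), rescale_ι, map_smul, pull_ι,
      mul_assoc]
    have := CliffordAlgebra.contractLeft_ι_mul (Q := 0)
      (evalAt ((LinearMap.inr ℝ E F).baseChange ℂ w)) (m ∘ₗ LinearMap.fst ℝ E F)
      (pull (LinearMap.fst ℝ E F) a * x)
    rw [h1, zero_smul, zero_sub] at this
    refine this.trans ?_
    rw [oddDeriv] at ha
    rw [ha, neg_one_smul, neg_mul, neg_mul, mul_assoc]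
    rfl

theorem berezin_inr_pull_fst_mul {n : ℕ} (f : Fin n → ℂ ⊗[ℝ] F) (y : Gr E) (x : Gr (E × F)) :
    berezin (fun a => (LinearMap.inr ℝ E F).baseChange ℂ (f a))
        (pull (LinearMap.fst ℝ E F) y * x) =
      pull (LinearMap.fst ℝ E F) (rescale ((-1) ^ n) y) *
        berezin (fun a => (LinearMap.inr ℝ E F).baseChange ℂ (f a)) x := by
  induction n with
  | zero => simp [berezin_zero, rescale_one]
  | succ n ih =>
    rw [berezin_succ, berezin_succ, ih, oddDeriv_inr_pull_fst_mul, rescale_neg, pow_succ,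
      mul_neg_one]

/-- The linear forms on `E × F`, multiplied by `c` on `E`. -/
def rescaleFstDual (E F : Type*) [AddCommGroup E] [Module ℝ E] [AddCommGroup F] [Module ℝ F]
    (c : ℂ) : (E × F →ₗ[ℝ] ℂ) →ₗ[ℂ] (E × F →ₗ[ℝ] ℂ) where
  toFun φ := c • (φ ∘ₗ LinearMap.inl ℝ E F ∘ₗ LinearMap.fst ℝ E F) +
    φ ∘ₗ LinearMap.inr ℝ E F ∘ₗ LinearMap.snd ℝ E F
  map_add' φ ψ := by simp only [LinearMap.add_comp, smul_add]; abel
  map_smul' a φ := by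
    simp only [LinearMap.smul_comp, smul_add, RingHom.id_apply, smul_comm c a]

/-- Multiplication of the odd coordinates of the first factor by `c`. -/
def rescaleFst (E F : Type*) [AddCommGroup E] [Module ℝ E] [AddCommGroup F] [Module ℝ F] (c : ℂ) :
    Gr (E × F) →ₐ[ℂ] Gr (E × F) :=
  ExteriorAlgebra.map (rescaleFstDual E F c)

theorem rescaleFst_pull_fst_ι (c : ℂ) (φ : E →ₗ[ℝ] ℂ) :
    rescaleFst E F c (pull (LinearMap.fst ℝ E F) (ExteriorAlgebra.ι ℂ φ)) =
      c • pull (LinearMap.fst ℝ E F) (ExteriorAlgebra.ι ℂ φ) := by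
  rw [pull_ι, rescaleFst, ExteriorAlgebra.map_apply_ι, ← map_smul]
  congr 1
  ext <;> simp [rescaleFstDual]

theorem rescaleFst_pull_snd_ι (c : ℂ) (φ : F →ₗ[ℝ] ℂ) :
    rescaleFst E F c (pull (LinearMap.snd ℝ E F) (ExteriorAlgebra.ι ℂ φ)) =
      pull (LinearMap.snd ℝ E F) (ExteriorAlgebra.ι ℂ φ) := by
  rw [pull_ι, rescaleFst, ExteriorAlgebra.map_apply_ι]
  congr 1
  ext <;> simp [rescaleFstDual]

theorem pull_inl_rescaleFst (c : ℂ) (x : Gr (E × F)) :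
    pull (LinearMap.inl ℝ E F) (rescaleFst E F c x) =
      rescale c (pull (LinearMap.inl ℝ E F) x) := by
  have : (pull (LinearMap.inl ℝ E F)).comp (rescaleFst E F c) =
      (rescale c).comp (pull (LinearMap.inl ℝ E F)) := by
    refine ExteriorAlgebra.hom_ext (LinearMap.ext fun φ => ?_)
    simp only [AlgHom.comp_toLinearMap, LinearMap.comp_apply, AlgHom.toLinearMap_apply, pull_ι,
      rescaleFst, ExteriorAlgebra.map_apply_ι, rescale_ι]
    rw [← map_smul]
    congr 1
    ext; simp [rescaleFstDual, Prod.mk_zero_zero]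
  exact DFunLike.congr_fun this x

theorem berezin_inr_rescaleFst {n : ℕ} (f : Fin n → ℂ ⊗[ℝ] F) (c : ℂ) (x : Gr (E × F)) :
    berezin (fun a => (LinearMap.inr ℝ E F).baseChange ℂ (f a)) (rescaleFst E F c x) =
      rescaleFst E F c (berezin (fun a => (LinearMap.inr ℝ E F).baseChange ℂ (f a)) x) := by
  have := berezin_map (n := n) (f := fun a => (LinearMap.inr ℝ E F).baseChange ℂ (f a))
    (f' := fun a => (LinearMap.inr ℝ E F).baseChange ℂ (f a)) (rescaleFstDual E F c) 1
    (fun a φ => ?_) x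
  · rw [one_pow, one_smul] at this
    exact this
  · rw [one_mul, evalAt_baseChange, evalAt_baseChange]
    congr 1
    ext; simp [rescaleFstDual, Prod.mk_zero_zero]

/-- The nilpotent part has a finite exponential series, preserved by any algebra morphism; only the
scalar exponential requires that the body be preserved. -/
theorem gexp_algHom {A : Gr E →ₐ[ℂ] Gr F} (hA : ∀ x, body (A x) = body x) {x : Gr E}
    (hx : IsNilpotent (x - algebraMap ℂ (Gr E) (body x))) : gexp (A x) = A (gexp x) := by
  rw [gexp, gexp, map_smul, hA, IsNilpotent.map_exp hx, map_sub, AlgHom.commutes]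

theorem pow_eq_zero_of_mem_sq [FiniteDimensional ℝ E] {x : Gr E}
    (hx : x ∈ LinearMap.range (ExteriorAlgebra.ι ℂ (M := E →ₗ[ℝ] ℂ)) ^ 2) {r : ℕ}
    (hr : Module.finrank ℂ (E →ₗ[ℝ] ℂ) < r) : x ^ r = 0 := by
  have h1 : x ^ r ∈ LinearMap.range (ExteriorAlgebra.ι ℂ (M := E →ₗ[ℝ] ℂ)) ^ (2 * r) := by
    rw [pow_mul]; exact Submodule.pow_mem_pow _ hx r
  have : Module.Finite ℂ (E →ₗ[ℝ] ℂ) := Module.Basis.finiteDimensional_of_finite (dualBasis (Module.finBasis ℝ E))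
  -- The power lies in degree `2r`, which exceeds the number of generators.
  have h2 : Module.finrank ℂ (⋀[ℂ]^(2 * r) (E →ₗ[ℝ] ℂ)) = 0 := by
    rw [exteriorPower.finrank_eq, Nat.choose_eq_zero_of_lt (by omega)]
  have h3 : Subsingleton (⋀[ℂ]^(2 * r) (E →ₗ[ℝ] ℂ)) := Module.finrank_zero_iff.1 h2
  exact congrArg Subtype.val (h3.elim (⟨x ^ r, h1⟩ : ⋀[ℂ]^(2 * r) (E →ₗ[ℝ] ℂ)) 0)

theorem smul_algebraMap_add_sub_body (a q : ℂ) {x : Gr E} (hb : body x = 0) :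
    a • (algebraMap ℂ (Gr E) q + x) -
      algebraMap ℂ (Gr E) (body (a • (algebraMap ℂ (Gr E) q + x))) = a • x := by
  have hbody : body (a • (algebraMap ℂ (Gr E) q + x)) = a * q := by
    rw [map_smul, map_add, hb, AlgHom.commutes]; simp
  rw [hbody, smul_add, map_mul, ← Algebra.smul_def, add_sub_cancel_left]

theorem isNilpotent_smul_algebraMap_add [FiniteDimensional ℝ E] (a q : ℂ) {x : Gr E}
    (hx : x ∈ LinearMap.range (ExteriorAlgebra.ι ℂ (M := E →ₗ[ℝ] ℂ)) ^ 2) (hb : body x = 0) :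
    IsNilpotent (a • (algebraMap ℂ (Gr E) q + x) -
      algebraMap ℂ (Gr E) (body (a • (algebraMap ℂ (Gr E) q + x)))) := by
  refine ⟨Module.finrank ℂ (E →ₗ[ℝ] ℂ) + 1, ?_⟩
  rw [smul_algebraMap_add_sub_body a q hb, smul_pow,
    pow_eq_zero_of_mem_sq hx (Nat.lt_succ_self _), smul_zero]

theorem gexp_algebraMap_add [FiniteDimensional ℝ E] (a q : ℂ) {x : Gr E}
    (hx : x ∈ LinearMap.range (ExteriorAlgebra.ι ℂ (M := E →ₗ[ℝ] ℂ)) ^ 2) (hb : body x = 0) :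
    gexp (a • (algebraMap ℂ (Gr E) q + x)) = Complex.exp (a * q) •
      ∑ r ∈ Finset.range (Module.finrank ℂ (E →ₗ[ℝ] ℂ) + 1),
        (a ^ r * (r.factorial : ℂ)⁻¹) • x ^ r := by
  have hbody : body (a • (algebraMap ℂ (Gr E) q + x)) = a * q := by
    rw [map_smul, map_add, hb, AlgHom.commutes]; simp
  rw [gexp, smul_algebraMap_add_sub_body a q hb, hbody, IsNilpotent.exp_eq_sum
    (k := Module.finrank ℂ (E →ₗ[ℝ] ℂ) + 1)
    (by rw [smul_pow, pow_eq_zero_of_mem_sq hx (Nat.lt_succ_self _), smul_zero])]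
  congr 1
  refine Finset.sum_congr rfl fun r _ => ?_
  rw [smul_pow, mul_comm, mul_smul, ← Rat.cast_smul_eq_qsmul ℂ]
  push_cast
  rfl

end GrassmannCalculus

/-! ### The exponential of the generic quadratic form -/

section

/-- Polynomial dependence of all coefficients is stable under products, since multiplication is
bilinear in the coefficients. It is used for the powers of the nilpotent part. -/
theorem exists_eval_mul {A σ : Type*} [Ring A] [Algebra ℂ A] [FiniteDimensional ℂ A]
    {g h : (σ → ℂ) → A}
    (hg : ∀ ℓ : Module.Dual ℂ A, ∃ p : MvPolynomial σ ℂ, ∀ u, ℓ (g u) = p.eval u)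
    (hh : ∀ ℓ : Module.Dual ℂ A, ∃ p : MvPolynomial σ ℂ, ∀ u, ℓ (h u) = p.eval u)
    (ℓ : Module.Dual ℂ A) : ∃ p : MvPolynomial σ ℂ, ∀ u, ℓ (g u * h u) = p.eval u := by
  set β := Module.finBasis ℂ A
  choose p hp using fun i => hg (β.coord i)
  choose q hq using fun i => hh (β.coord i)
  refine ⟨∑ i, ∑ j, MvPolynomial.C (ℓ (β i * β j)) * (p i * q j), fun u => ?_⟩
  simp only [map_sum, map_mul, MvPolynomial.eval_C, ← hp, ← hq]
  conv_lhs => rw [← β.sum_repr (g u), ← β.sum_repr (h u)]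
  simp only [Finset.sum_mul_sum, map_sum, smul_mul_smul_comm, map_smul, smul_eq_mul,
    Module.Basis.coord_apply]
  exact Finset.sum_congr rfl fun i _ => Finset.sum_congr rfl fun j _ => mul_comm _ _

theorem exists_eval_linear_pow {A σ : Type*} [Ring A] [Algebra ℂ A] [FiniteDimensional ℂ A]
    [Fintype σ] (w : σ → A) (r : ℕ) (ℓ : Module.Dual ℂ A) :
    ∃ p : MvPolynomial σ ℂ, ∀ u : σ → ℂ, ℓ ((∑ i, u i • w i) ^ r) = p.eval u := by
  induction r generalizing ℓ with
  | zero => exact ⟨MvPolynomial.C (ℓ 1), fun u => by simp⟩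
  | succ r ih =>
    simp only [pow_succ]
    refine exists_eval_mul ih (fun ℓ => ?_) ℓ
    refine ⟨∑ i, MvPolynomial.C (ℓ (w i)) * MvPolynomial.X i, fun u => ?_⟩
    simp [mul_comm]

instance finiteDimensional_gr {E : Type*} [AddCommGroup E] [Module ℝ E] [FiniteDimensional ℝ E] :
    FiniteDimensional ℂ (Gr E) :=
  Module.Basis.finiteDimensional_of_finite (monomials (Module.finBasis ℝ E))

theorem smul_combination {M : Type*} [AddCommGroup M] [Module ℂ M] (s : ℂ) (x y z : M) :
    s • x + Complex.I • (s • y) + s • z = s • (x + Complex.I • y + z) := by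
  module

theorem algebraMap_combination {A : Type*} [Ring A] [Algebra ℂ A] (p q : ℂ) (x y z : A) :
    algebraMap ℂ A p + x + Complex.I • (algebraMap ℂ A q + y) + z =
      algebraMap ℂ A (p + Complex.I * q) + (x + Complex.I • y + z) := by
  rw [smul_add, map_add, map_mul, ← Algebra.smul_def]
  abel

theorem algHom_combination {A : Type*} [Ring A] [Algebra ℂ A] (f : A →ₐ[ℂ] A) {x y z x' y' z' : A}
    (hx : f x = x') (hy : f y = y') (hz : f z = z') :
    f (x + Complex.I • y + z) = x' + Complex.I • y' + z' := by
  rw [map_add, map_add, map_smul, hx, hy, hz]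

/-- This is `i(X + iY + Ξ) = -Y + iX + iΞ` with the prefactor `-½`; `x`, `y`, `z` stand for the
terms of `X`, `Y` and `Ξ`. -/
theorem smul_rotation {M : Type*} [AddCommGroup M] [Module ℂ M] (x y z : M) :
    -(1 / 2 : ℂ) • (-y + Complex.I • x + Complex.I • z) =
      -(Complex.I / 2) • (x + Complex.I • y + z) := by
  have : -(Complex.I / 2) * Complex.I = 1 / 2 := by
    linear_combination (-1 / 2 : ℂ) * Complex.I_mul_I
  simp only [smul_add, smul_smul, this]
  module

set_option linter.unusedSectionVars false

namespace OrientedSymplectic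

variable {V₀ V₁ : Type*} [NormedAddCommGroup V₀] [NormedSpace ℝ V₀] [FiniteDimensional ℝ V₀]
  [NormedAddCommGroup V₁] [NormedSpace ℝ V₁] [FiniteDimensional ℝ V₁]
  (S : OrientedSymplectic V₀ V₁)

/-- The value of `B(v, (X + iY)v)` at a point `v` of `V₀`. -/
def evenForm (X Y : S.spo₀) (v : V₀) : ℂ :=
  (S.B₀ v (X.1.1 v) : ℂ) + Complex.I * (S.B₀ v (Y.1.1 v) : ℂ)

/-- The restriction of `B(v, Xv)` to `V₁`. -/
def oddForm (X : S.spo₀) : Gr (S.spo₁ × V₁) :=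
  ∑ a, ∑ b, (S.B₁ (Module.finBasis ℝ V₁ a) (X.1.2 (Module.finBasis ℝ V₁ b)) : ℂ) •
    (S.xi b * S.xi a)

/-- The nilpotent part of `B(v, (X + iY + Ξ)v)`. -/
def quadNil (X Y : S.spo₀) (v : V₀) : Gr (S.spo₁ × V₁) :=
  S.oddForm X + Complex.I • S.oddForm Y + S.quadOdd v

theorem quad_eq (X Y : S.spo₀) (v : V₀) :
    S.quad X Y v = algebraMap ℂ _ (S.evenForm X Y v) + S.quadNil X Y v := by
  have h (X : S.spo₀) : S.quadEven X v =
      algebraMap ℂ _ (S.B₀ v (X.1.1 v) : ℂ) + S.oddForm X := rfl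
  rw [quad, h X, h Y, evenForm, quadNil]
  exact algebraMap_combination _ _ _ _ _

theorem xi_mem (a) : S.xi a ∈ LinearMap.range (ExteriorAlgebra.ι ℂ (M := S.spo₁ × V₁ →ₗ[ℝ] ℂ)) := by
  rw [xi, pull_ι]; exact LinearMap.mem_range_self _ _

theorem zeta_mem (l) :
    S.zeta l ∈ LinearMap.range (ExteriorAlgebra.ι ℂ (M := S.spo₁ × V₁ →ₗ[ℝ] ℂ)) := by
  rw [zeta, pull_ι]; exact LinearMap.mem_range_self _ _

theorem quadNil_mem (X Y : S.spo₀) (v : V₀) :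
    S.quadNil X Y v ∈
      LinearMap.range (ExteriorAlgebra.ι ℂ (M := S.spo₁ × V₁ →ₗ[ℝ] ℂ)) ^ 2 := by
  rw [pow_two]
  have h (X : S.spo₀) : S.oddForm X ∈
      LinearMap.range (ExteriorAlgebra.ι ℂ (M := S.spo₁ × V₁ →ₗ[ℝ] ℂ)) *
        LinearMap.range (ExteriorAlgebra.ι ℂ (M := S.spo₁ × V₁ →ₗ[ℝ] ℂ)) :=
    Submodule.sum_mem _ fun a _ => Submodule.sum_mem _ fun b _ =>
      Submodule.smul_mem _ _ (Submodule.mul_mem_mul (S.xi_mem b) (S.xi_mem a))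
  refine Submodule.add_mem _ (Submodule.add_mem _ (h X) (Submodule.smul_mem _ _ (h Y))) ?_
  exact Submodule.sum_mem _ fun l _ => Submodule.sum_mem _ fun a _ => Submodule.add_mem _
    (Submodule.smul_mem _ _ (Submodule.mul_mem_mul (S.xi_mem a) (S.zeta_mem l)))
    (Submodule.smul_mem _ _ (Submodule.mul_mem_mul (S.zeta_mem l) (S.xi_mem a)))

theorem body_quadNil (X Y : S.spo₀) (v : V₀) : body (S.quadNil X Y v) = 0 := by
  have hx (a) : body (S.xi a) = 0 := by rw [xi, pull_ι, body_ι]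
  simp only [quadNil, oddForm, quadOdd, map_add, map_sum, map_smul, map_mul, hx, mul_zero, zero_mul,
    smul_zero, Finset.sum_const_zero, add_zero]

theorem gexp_quad (a : ℂ) (X Y : S.spo₀) (v : V₀) :
    gexp (a • S.quad X Y v) = Complex.exp (a * S.evenForm X Y v) •
      ∑ r ∈ Finset.range (Module.finrank ℂ (S.spo₁ × V₁ →ₗ[ℝ] ℂ) + 1),
        (a ^ r * (r.factorial : ℂ)⁻¹) • S.quadNil X Y v ^ r := by
  rw [quad_eq, gexp_algebraMap_add a _ (S.quadNil_mem X Y v) (S.body_quadNil X Y v)]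

theorem isNilpotent_quad (a : ℂ) (X Y : S.spo₀) (v : V₀) :
    IsNilpotent (a • S.quad X Y v - algebraMap ℂ _ (body (a • S.quad X Y v))) := by
  rw [quad_eq]
  exact isNilpotent_smul_algebraMap_add a _ (S.quadNil_mem X Y v) (S.body_quadNil X Y v)

/-- The substitution `ξ ↦ s ξ`. -/
def scaleOdd (s : ℝ) : Gr (S.spo₁ × V₁) →ₐ[ℂ] Gr (S.spo₁ × V₁) :=
  pull (LinearMap.prodMap LinearMap.id (s • LinearMap.id))

theorem scaleOdd_xi (s : ℝ) (a) : S.scaleOdd s (S.xi a) = (s : ℂ) • S.xi a := by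
  rw [scaleOdd, xi, pull_pull, pull_ι, pull_ι, ← map_smul]
  congr 1
  ext <;> simp

theorem scaleOdd_zeta (s : ℝ) (l) : S.scaleOdd s (S.zeta l) = S.zeta l := by
  rw [scaleOdd, zeta, pull_pull, pull_ι, pull_ι]
  congr 1

/-- Every term has total degree two in `v`: it is quadratic in the even coordinates, quadratic in
`ξ`, or one of each in the terms containing `ζ`, which is not scaled. -/
theorem scaleOdd_quad (s : ℝ) (X Y : S.spo₀) (v : V₀) :
    S.scaleOdd s (S.quad X Y (s • v)) = ((s : ℂ) ^ 2) • S.quad X Y v := by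
  have h (X : S.spo₀) : S.scaleOdd s (S.quadEven X (s • v)) = ((s : ℂ) ^ 2) • S.quadEven X v := by
    have h1 : (S.B₀ (s • v) (X.1.1 (s • v)) : ℂ) = (s : ℂ) ^ 2 * (S.B₀ v (X.1.1 v) : ℂ) := by
      simp; ring
    simp only [quadEven, map_add, AlgHom.commutes, map_sum, map_smul (S.scaleOdd s),
      map_mul (S.scaleOdd s), scaleOdd_xi, smul_add, Finset.smul_sum, h1]
    congr 1
    · rw [Algebra.smul_def, ← map_mul]
    · refine Finset.sum_congr rfl fun a _ => Finset.sum_congr rfl fun b _ => ?_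
      rw [smul_mul_smul_comm, smul_smul, smul_smul]
      congr 1
      ring
  have h' : S.scaleOdd s (S.quadOdd (s • v)) = ((s : ℂ) ^ 2) • S.quadOdd v := by
    simp only [quadOdd, map_add, map_sum, map_smul, map_mul, scaleOdd_xi, scaleOdd_zeta,
      smul_add, Finset.smul_sum, smul_mul_assoc, mul_smul_comm, smul_smul]
    refine Finset.sum_congr rfl fun a _ => Finset.sum_congr rfl fun b _ => ?_
    congr 2
    · simp; ring
    · simp; ring
  refine Eq.trans ?_ (smul_combination _ (S.quadEven X v) (S.quadEven Y v) (S.quadOdd v))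
  exact algHom_combination (S.scaleOdd s) (h X) (h Y) h'

theorem gexp_sq_smul_quad (a : ℂ) (s : ℝ) (X Y : S.spo₀) (v : V₀) :
    gexp ((a * (s : ℂ) ^ 2) • S.quad X Y v) = S.scaleOdd s (gexp (a • S.quad X Y (s • v))) := by
  rw [mul_smul, ← scaleOdd_quad, ← map_smul]
  exact gexp_algHom (fun x => body_pull _ x) (S.isNilpotent_quad _ _ _ _)

/-- Only `ζ` is multiplied by `i`, so the even terms are fixed and `quadOdd`, linear in `ζ`, gains
the factor `i`. -/
theorem rescaleFst_quad (X Y : S.spo₀) (v : V₀) :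
    rescaleFst S.spo₁ V₁ Complex.I (-(1 / 2 : ℂ) • S.quad (-Y) X v) =
      -(Complex.I / 2) • S.quad X Y v := by
  have hxi (a) : rescaleFst S.spo₁ V₁ Complex.I (S.xi a) = S.xi a := rescaleFst_pull_snd_ι _ _
  have hzeta (a) : rescaleFst S.spo₁ V₁ Complex.I (S.zeta a) = Complex.I • S.zeta a :=
    rescaleFst_pull_fst_ι _ _
  have h (X : S.spo₀) : rescaleFst S.spo₁ V₁ Complex.I (S.quadEven X v) = S.quadEven X v := by
    simp only [quadEven, map_add, AlgHom.commutes, map_sum, map_smul, map_mul, hxi]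
  have h' : rescaleFst S.spo₁ V₁ Complex.I (S.quadOdd v) = Complex.I • S.quadOdd v := by
    simp only [quadOdd, map_add, map_sum, map_smul, map_mul, hxi, hzeta,
      smul_add, Finset.smul_sum, smul_mul_assoc, mul_smul_comm, smul_comm Complex.I]
  have hneg : S.quadEven (-Y) v = - S.quadEven Y v := by
    simp only [quadEven, Submodule.coe_neg, Prod.fst_neg, Prod.snd_neg,
      neg_apply, map_neg, Complex.ofReal_neg, neg_smul, Finset.sum_neg_distrib]
    abel
  refine Eq.trans ?_ (smul_rotation (S.quadEven X v) (S.quadEven Y v) (S.quadOdd v))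
  rw [map_smul]
  exact congrArg _ (algHom_combination _ ((h (-Y)).trans hneg) (h X) h')

theorem gexp_rescaleFst (X Y : S.spo₀) (v : V₀) :
    rescaleFst S.spo₁ V₁ Complex.I (gexp (-(1 / 2 : ℂ) • S.quad (-Y) X v)) =
      gexp (-(Complex.I / 2) • S.quad X Y v) := by
  rw [← rescaleFst_quad]
  exact (gexp_algHom (fun x => body_map _ x) (S.isNilpotent_quad _ _ _ _)).symm

section Coordinates

variable {S} {κ ι : Type*} [Fintype κ] [Fintype ι] (e : Module.Basis κ ℝ V₀)
  (c₀ : Module.Basis ι ℝ S.spo₀)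

/-- The coordinates of `X + iY` and of `v`. -/
def coords (X Y : S.spo₀) (v : V₀) : ι ⊕ κ → ℂ :=
  Sum.elim (fun j => (c₀.repr X j : ℂ) + Complex.I * (c₀.repr Y j : ℂ))
    (fun i => (e.repr v i : ℂ))

theorem oddForm_eq_sum (X : S.spo₀) :
    S.oddForm X = ∑ j, (c₀.repr X j : ℂ) • S.oddForm (c₀ j) := by
  let L : S.spo₀ →ₗ[ℝ] Gr (S.spo₁ × V₁) :=
    { toFun := S.oddForm
      map_add' := fun X Y => by
        simp only [oddForm, Submodule.coe_add, Prod.snd_add, _root_.add_apply, map_add,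
          Complex.ofReal_add, add_smul, Finset.sum_add_distrib]
      map_smul' := fun c X => by
        simp only [oddForm, Submodule.coe_smul, Prod.smul_snd, _root_.smul_apply,
          map_smul, smul_eq_mul, Complex.ofReal_mul, mul_smul, ← Finset.smul_sum,
          RingHom.id_apply, Complex.coe_smul] }
  have := congrArg L (c₀.sum_repr X)
  rw [map_sum] at this
  refine this.symm.trans (Finset.sum_congr rfl fun j _ => ?_)
  rw [map_smul, Complex.coe_smul]; rfl

theorem quadOdd_eq_sum (v : V₀) : S.quadOdd v = ∑ i, (e.repr v i : ℂ) • S.quadOdd (e i) := by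
  let L : V₀ →ₗ[ℝ] Gr (S.spo₁ × V₁) :=
    { toFun := S.quadOdd
      map_add' := fun X Y => by
        simp only [quadOdd, map_add, LinearMap.add_apply,
          Complex.ofReal_add, add_smul, ← Finset.sum_add_distrib]
        exact Finset.sum_congr rfl fun _ _ => Finset.sum_congr rfl fun _ _ => by abel
      map_smul' := fun c X => by
        simp only [quadOdd, LinearMap.smul_apply,
          map_smul, smul_eq_mul, Complex.ofReal_mul, mul_smul, ← Finset.smul_sum, ← smul_add,
          RingHom.id_apply, Complex.coe_smul] }
  have := congrArg L (e.sum_repr v)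
  rw [map_sum] at this
  refine this.symm.trans (Finset.sum_congr rfl fun j _ => ?_)
  rw [map_smul, Complex.coe_smul]; rfl

theorem quadNil_eq_sum (X Y : S.spo₀) (v : V₀) :
    S.quadNil X Y v = ∑ i, coords e c₀ X Y v i •
      Sum.elim (fun j => S.oddForm (c₀ j)) (fun i => S.quadOdd (e i)) i := by
  rw [quadNil, oddForm_eq_sum c₀ X, oddForm_eq_sum c₀ Y, quadOdd_eq_sum e v, Fintype.sum_sum_type]
  simp only [coords, Sum.elim_inl, Sum.elim_inr, add_smul, Finset.sum_add_distrib, mul_smul,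
    Finset.smul_sum]

/-- The nilpotent part is linear in the coordinates of `X + iY` and of `v`, so its powers have
polynomial coefficients. The powers of `a` stay explicit because the rotation argument treats the
coefficient as a complex variable. -/
theorem exists_dual_gexp_quad (ℓ : Module.Dual ℂ (Gr (S.spo₁ × V₁))) :
    ∃ p : ℕ → MvPolynomial (ι ⊕ κ) ℂ, ∀ (a : ℂ) (X Y : S.spo₀) (v : V₀),
      ℓ (gexp (a • S.quad X Y v)) = Complex.exp (a * S.evenForm X Y v) *
        ∑ r ∈ Finset.range (Module.finrank ℂ (S.spo₁ × V₁ →ₗ[ℝ] ℂ) + 1),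
          a ^ r * (p r).eval (coords e c₀ X Y v) := by
  choose p hp using fun r => exists_eval_linear_pow
    (Sum.elim (fun j => S.oddForm (c₀ j)) (fun i => S.quadOdd (e i))) r ℓ
  refine ⟨fun r => MvPolynomial.C (r.factorial : ℂ)⁻¹ * p r, fun a X Y v => ?_⟩
  rw [gexp_quad, map_smul, map_sum, smul_eq_mul]
  congr 1
  refine Finset.sum_congr rfl fun r _ => ?_
  rw [map_smul, quadNil_eq_sum e c₀, hp, map_mul, MvPolynomial.eval_C, smul_eq_mul, mul_assoc]

theorem exists_dual_gexp_quad_of_coeff (a : ℂ) (ℓ : Module.Dual ℂ (Gr (S.spo₁ × V₁))) :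
    ∃ P : MvPolynomial (ι ⊕ κ) ℂ, ∀ (X Y : S.spo₀) (v : V₀),
      ℓ (gexp (a • S.quad X Y v)) =
        Complex.exp (a * S.evenForm X Y v) * P.eval (coords e c₀ X Y v) := by
  obtain ⟨p, hp⟩ := exists_dual_gexp_quad e c₀ ℓ
  refine ⟨∑ r ∈ Finset.range (Module.finrank ℂ (S.spo₁ × V₁ →ₗ[ℝ] ℂ) + 1),
    MvPolynomial.C (a ^ r) * p r, fun X Y v => ?_⟩
  simp only [hp, map_sum, map_mul, MvPolynomial.eval_C]

end Coordinates

end OrientedSymplectic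

end

/-! ### Homogeneous functions and Laplace integrals -/

section

section Homogeneous

variable {D : Type*} [NormedAddCommGroup D] [NormedSpace ℝ D] [FiniteDimensional ℝ D]

theorem exists_pos_mul_sq_le {q : D → ℝ} (hc : Continuous q) (hh : ∀ (s : ℝ) v, q (s • v) = s ^ 2 * q v)
    (hpos : ∀ v, v ≠ 0 → 0 < q v) : ∃ c > 0, ∀ v, c * ‖v‖ ^ 2 ≤ q v := by
  have h0 : q 0 = 0 := by simpa using hh 0 0
  rcases (Metric.sphere (0 : D) 1).eq_empty_or_nonempty with hE | hE
  -- An empty unit sphere means that the space is zero, where any constant works.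
  · refine ⟨1, one_pos, fun v => ?_⟩
    by_cases hv : v = 0
    · simp [hv, h0]
    · exfalso
      have : ‖v‖⁻¹ • v ∈ Metric.sphere (0 : D) 1 := by simp [norm_smul, hv]
      rw [hE] at this
      exact this
  · obtain ⟨u, hu, hmin⟩ := (isCompact_sphere (0 : D) 1).exists_isMinOn hE hc.continuousOn
    have hu0 : u ≠ 0 := by rintro rfl; simp at hu
    refine ⟨q u, hpos u hu0, fun v => ?_⟩
    by_cases hv : v = 0
    · simp [hv, h0]
    · have h1 : ‖v‖⁻¹ • v ∈ Metric.sphere (0 : D) 1 := by simp [norm_smul, hv]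
      have h2 : q u ≤ q (‖v‖⁻¹ • v) := hmin h1
      rw [hh, inv_pow, ← div_eq_inv_mul, le_div_iff₀ (by positivity)] at h2
      exact h2

theorem exists_norm_le_mul_sq {F : Type*} [NormedAddCommGroup F] [NormedSpace ℝ F] {f : D → F}
    (hc : Continuous f) (hh : ∀ (s : ℝ) v, f (s • v) = s ^ 2 • f v) :
    ∃ C, 0 ≤ C ∧ ∀ v, ‖f v‖ ≤ C * ‖v‖ ^ 2 := by
  have h0 : f 0 = 0 := by simpa using hh 0 0
  obtain ⟨C, hC⟩ := (isCompact_sphere (0 : D) 1).exists_bound_of_continuousOn hc.continuousOn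
  refine ⟨max C 0, le_max_right _ _, fun v => ?_⟩
  by_cases hv : v = 0
  · simp [hv, h0]
  · have h1 : ‖v‖⁻¹ • v ∈ Metric.sphere (0 : D) 1 := by simp [norm_smul, hv]
    have h2 := hC _ h1
    rw [hh, norm_smul, inv_pow, norm_inv, norm_pow, norm_norm, inv_mul_le_iff₀ (by positivity)] at h2
    calc ‖f v‖ ≤ ‖v‖ ^ 2 * C := h2
      _ ≤ max C 0 * ‖v‖ ^ 2 := by rw [mul_comm]; gcongr; exact le_max_left _ _

set_option linter.unusedSectionVars false

variable [MeasurableSpace D] [BorelSpace D] (μ : Measure D) [μ.IsAddHaarMeasure]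

theorem integrable_one_add_pow_mul_exp {c : ℝ} (hc : 0 < c) (m : ℕ) :
    Integrable (fun v : D => (1 + ‖v‖) ^ m * Real.exp (-(c * ‖v‖ ^ 2))) μ := by
  set d : ℕ := Module.finrank ℝ D + 1
  obtain ⟨M, hM, h⟩ := exists_one_add_pow_le_exp hc (m + d)
  have hi : Integrable (fun v : D => M * (1 + ‖v‖) ^ (-(d : ℝ))) μ :=
    (integrable_one_add_norm (by simp [d])).const_mul M
  refine hi.mono' (by fun_prop) (ae_of_all _ fun v => ?_)
  rw [Real.norm_of_nonneg (by positivity), Real.rpow_neg (by positivity), Real.rpow_natCast,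
    ← div_eq_mul_inv, le_div_iff₀ (by positivity), Real.exp_neg, mul_right_comm, ← pow_add,
    ← div_eq_mul_inv, div_le_iff₀ (by positivity)]
  exact h _ (norm_nonneg v)

variable {E : Type*} [NormedAddCommGroup E] [NormedSpace ℂ E] {T : D → E →L[ℂ] ℂ} {z₀ : E}

/-- Compactness of the unit sphere gives `Re T v z₀ ≤ -c‖v‖²` and `‖T v‖ ≤ C‖v‖²`. The radius is
chosen so that `r‖T v‖ ≤ (c/4)‖v‖²`. This error is spent twice, on moving `z` and on the factor
`exp(r‖T v‖)`, and the rate `c/2` remains. -/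
theorem exists_laplace_bounds (hT : Continuous T) (hh : ∀ (s : ℝ) v, T (s • v) = s ^ 2 • T v)
    (hneg : ∀ v, v ≠ 0 → (T v z₀).re < 0) :
    ∃ c > 0, ∃ r > 0, ∀ z ∈ Metric.ball z₀ r, ∀ v,
      ‖Complex.exp (T v z)‖ * Real.exp (r * ‖T v‖) ≤ Real.exp (-(c * ‖v‖ ^ 2)) := by
  obtain ⟨C, hC, hCT⟩ := exists_norm_le_mul_sq hT hh
  obtain ⟨c, hc, hq⟩ := exists_pos_mul_sq_le (q := fun v => -(T v z₀).re) (by fun_prop)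
    (fun s v => by
      rw [hh, _root_.smul_apply, Complex.smul_re, smul_eq_mul, mul_neg]) (fun v hv => by simpa using hneg v hv)
  refine ⟨c / 2, by positivity, c / (4 * (C + 1)), by positivity, fun z hz v => ?_⟩
  rw [Complex.norm_exp, ← Real.exp_add]
  refine Real.exp_le_exp.2 ?_
  have h1 : (T v z).re ≤ (T v z₀).re + ‖T v‖ * (c / (4 * (C + 1))) := by
    have : T v z = T v z₀ + T v (z - z₀) := by simp
    rw [this, Complex.add_re]
    gcongr
    refine (Complex.re_le_norm _).trans (((T v).le_opNorm _).trans ?_)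
    gcongr
    rw [mem_ball_iff_norm] at hz
    exact hz.le
  have h2 : ‖T v‖ * (c / (4 * (C + 1))) ≤ c / 4 * ‖v‖ ^ 2 := by
    calc ‖T v‖ * (c / (4 * (C + 1))) ≤ C * ‖v‖ ^ 2 * (c / (4 * (C + 1))) := by
          gcongr; exact hCT v
      _ ≤ (C + 1) * ‖v‖ ^ 2 * (c / (4 * (C + 1))) := by gcongr; linarith
      _ = c / 4 * ‖v‖ ^ 2 := by field_simp
  have := hq v
  linarith

theorem _root_.Function.HasTemperateGrowth.exists_norm_le {D F : Type*} [NormedAddCommGroup D]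
    [NormedSpace ℝ D] [NormedAddCommGroup F] [NormedSpace ℝ F] {w : D → F}
    (hw : w.HasTemperateGrowth) : ∃ (m : ℕ) (K : ℝ), 0 ≤ K ∧ ∀ v, ‖w v‖ ≤ K * (1 + ‖v‖) ^ m := by
  obtain ⟨m, K, hK, h⟩ := hw.norm_iteratedFDeriv_le_uniform 0
  exact ⟨m, K, hK, fun v => by simpa using h 0 le_rfl v⟩

theorem analyticAt_laplace (hT : Continuous T) (hh : ∀ (s : ℝ) v, T (s • v) = s ^ 2 • T v)
    (hneg : ∀ v, v ≠ 0 → (T v z₀).re < 0) {w : D → ℂ} (hw : w.HasTemperateGrowth) :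
    AnalyticAt ℂ (fun z => ∫ v, w v * Complex.exp (T v z) ∂μ) z₀ ∧
      ∀ᶠ z in 𝓝 z₀, Integrable (fun v => w v * Complex.exp (T v z)) μ := by
  obtain ⟨c, hc, r, hr, hb⟩ := exists_laplace_bounds hT hh hneg
  obtain ⟨m, K, hK, hwb⟩ := hw.exists_norm_le
  have hwc : Continuous w := hw.1.continuous
  have hi (z) (hz : z ∈ Metric.ball z₀ r) :
      Integrable (fun v => ‖w v * Complex.exp (T v z)‖ * Real.exp (r * ‖T v‖)) μ := by
    refine ((integrable_one_add_pow_mul_exp μ hc m).const_mul K).mono'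
      (by fun_prop) (ae_of_all _ fun v => ?_)
    rw [Real.norm_of_nonneg (by positivity), norm_mul, mul_assoc, ← mul_assoc K]
    exact mul_le_mul (hwb v) (hb z hz v) (by positivity) (by positivity)
  refine ⟨analyticAt_integral_mul_cexp hwc.aestronglyMeasurable hT.aestronglyMeasurable hr
    (hi z₀ (Metric.mem_ball_self hr)), ?_⟩
  filter_upwards [Metric.ball_mem_nhds z₀ hr] with z hz
  refine (hi z hz).mono' (by fun_prop) (ae_of_all _ fun v => ?_)
  exact le_mul_of_one_le_right (norm_nonneg _) (Real.one_le_exp (by positivity))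

theorem analyticAt_laplace_sum (hT : Continuous T) (hh : ∀ (s : ℝ) v, T (s • v) = s ^ 2 • T v)
    (hneg : ∀ v, v ≠ 0 → (T v z₀).re < 0) {β : Type*} (s : Finset β) {α : β → E → ℂ}
    {w : β → D → ℂ} (hα : ∀ i, AnalyticAt ℂ (α i) z₀) (hw : ∀ i, (w i).HasTemperateGrowth) :
    AnalyticAt ℂ (fun z => ∫ v, Complex.exp (T v z) * ∑ i ∈ s, α i z * w i v ∂μ) z₀ := by
  have h1 : AnalyticAt ℂ
      (fun z => ∑ i ∈ s, α i z * ∫ v, w i v * Complex.exp (T v z) ∂μ) z₀ :=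
    Finset.analyticAt_fun_sum s fun i _ => (hα i).mul (analyticAt_laplace μ hT hh hneg (hw i)).1
  refine h1.congr ?_
  -- Splitting the integral of the sum requires convergence at all nearby `z`, not only at `z₀`.
  have h2 : ∀ᶠ z in 𝓝 z₀, ∀ i ∈ s, Integrable (fun v => w i v * Complex.exp (T v z)) μ :=
    (s.eventually_all).2 fun i _ => (analyticAt_laplace μ hT hh hneg (hw i)).2
  filter_upwards [h2] with z hz
  simp only [← integral_const_mul]
  rw [← integral_finsetSum]
  · refine integral_congr_ae (ae_of_all _ fun v => ?_)
    simp only [Finset.mul_sum]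
    exact Finset.sum_congr rfl fun i _ => by ring
  · exact fun i hi => (hz i hi).const_mul _

end Homogeneous

theorem hasTemperateGrowth_eval {D σ : Type*} [NormedAddCommGroup D] [NormedSpace ℝ D]
    {u : D → σ → ℂ} (hu : ∀ i, Function.HasTemperateGrowth fun v => u v i)
    (p : MvPolynomial σ ℂ) : Function.HasTemperateGrowth fun v => p.eval (u v) := by
  induction p using MvPolynomial.induction_on with
  | C a => simp only [MvPolynomial.eval_C]; exact .const a
  | add p q hp hq => simp only [map_add]; exact hp.add hq
  | mul_X p i hp => simp only [map_mul, MvPolynomial.eval_X]; exact hp.mul (hu i)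

/-- `grIntegral` is written in one chosen basis; integrability of all coefficients makes it commute
with arbitrary linear forms. -/
theorem dual_grIntegral {E κ : Type*} [AddCommGroup E] [Module ℝ E] [FiniteDimensional ℝ E]
    [Fintype κ] {g : (κ → ℝ) → Gr E} (hg : ∀ ℓ : Module.Dual ℂ (Gr E), Integrable fun x => ℓ (g x))
    (ℓ : Module.Dual ℂ (Gr E)) : ℓ (grIntegral g) = ∫ x, ℓ (g x) := by
  set β := monomials (Module.finBasis ℝ E) with hβ
  have h (x) : ℓ (g x) = ∑ I, β.repr (g x) I * ℓ (β I) := by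
    conv_lhs => rw [← β.sum_repr (g x)]
    simp only [map_sum, map_smul, smul_eq_mul]
  simp only [h]
  have hi (I) : Integrable fun x => β.repr (g x) I * ℓ (β I) := (hg (β.coord I)).mul_const _
  rw [integral_finsetSum _ fun I _ => hi I]
  simp only [integral_mul_const, grIntegral, map_sum, map_smul, smul_eq_mul]
  rfl

end

/-! ### Decay and Berezin integration along the fibers -/

section

namespace OrientedSymplectic
set_option linter.unusedSectionVars false

variable {V₀ V₁ : Type*} [NormedAddCommGroup V₀] [NormedSpace ℝ V₀] [FiniteDimensional ℝ V₀]
  [NormedAddCommGroup V₁] [NormedSpace ℝ V₁] [FiniteDimensional ℝ V₁]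
  {S : OrientedSymplectic V₀ V₁}

theorem hasTemperateGrowth_form (X : S.spo₀) :
    Function.HasTemperateGrowth fun v : V₀ => S.B₀ v (X.1.1 v) := by
  let L : V₀ →L[ℝ] V₀ →L[ℝ] ℝ :=
    LinearMap.toContinuousLinearMap ((LinearMap.toContinuousLinearMap : (V₀ →ₗ[ℝ] ℝ) ≃ₗ[ℝ] _) ∘ₗ S.B₀)
  have h : (fun v : V₀ => S.B₀ v (X.1.1 v)) = fun v => L v (X.1.1 v) := rfl
  rw [h]
  exact L.bilinear_hasTemperateGrowth Function.HasTemperateGrowth.id'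
    X.1.1.hasTemperateGrowth

theorem form_smul (X : S.spo₀) (s : ℝ) (v : V₀) :
    S.B₀ (s • v) (X.1.1 (s • v)) = s ^ 2 * S.B₀ v (X.1.1 v) := by
  simp; ring

theorem hasTemperateGrowth_evenForm (X Y : S.spo₀) :
    Function.HasTemperateGrowth fun v : V₀ => S.evenForm X Y v := by
  have h (X : S.spo₀) : Function.HasTemperateGrowth fun v : V₀ => (S.B₀ v (X.1.1 v) : ℂ) :=
    Function.Complex.hasTemperateGrowth_ofReal.comp (hasTemperateGrowth_form X)
  exact (h X).add ((Function.HasTemperateGrowth.const Complex.I).mul (h Y))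

theorem evenForm_smul (X Y : S.spo₀) (s : ℝ) (v : V₀) :
    S.evenForm X Y (s • v) = (s : ℂ) ^ 2 * S.evenForm X Y v := by
  simp only [evenForm, form_smul]; push_cast; ring

theorem evenForm_re (X Y : S.spo₀) (v : V₀) : (S.evenForm X Y v).re = S.B₀ v (X.1.1 v) := by
  simp [evenForm]

theorem evenForm_im (X Y : S.spo₀) (v : V₀) : (S.evenForm X Y v).im = S.B₀ v (Y.1.1 v) := by
  simp [evenForm]

section Coordinates

variable {κ ι : Type*} [Fintype κ] [Fintype ι] (e : Module.Basis κ ℝ V₀)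
  (c₀ : Module.Basis ι ℝ S.spo₀)

theorem hasTemperateGrowth_coords (X Y : S.spo₀) (p : MvPolynomial (ι ⊕ κ) ℂ) :
    Function.HasTemperateGrowth fun v => p.eval (coords e c₀ X Y v) := by
  refine hasTemperateGrowth_eval (fun i => ?_) p
  rcases i with j | i
  · exact .const _
  · exact Function.Complex.hasTemperateGrowth_ofReal.comp
      (LinearMap.toContinuousLinearMap (e.coord i)).hasTemperateGrowth

theorem form_eq_sum (X : S.spo₀) (v : V₀) :
    S.B₀ v (X.1.1 v) = ∑ j, c₀.repr X j * S.B₀ v ((c₀ j).1.1 v) := by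
  let L : S.spo₀ →ₗ[ℝ] ℝ :=
    { toFun := fun X => S.B₀ v (X.1.1 v)
      map_add' := fun X Y => by simp
      map_smul' := fun c X => by simp }
  have := congrArg L (c₀.sum_repr X)
  rw [map_sum] at this
  refine this.symm.trans (Finset.sum_congr rfl fun j _ => ?_)
  rw [map_smul, smul_eq_mul]; rfl

theorem evenForm_eq_sum (X Y : S.spo₀) (v : V₀) :
    S.evenForm X Y v = ∑ j, ((c₀.repr X j : ℂ) + Complex.I * (c₀.repr Y j : ℂ)) *
      (S.B₀ v ((c₀ j).1.1 v) : ℂ) := by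
  rw [evenForm, form_eq_sum c₀ X, form_eq_sum c₀ Y]
  push_cast
  rw [Finset.mul_sum, ← Finset.sum_add_distrib]
  exact Finset.sum_congr rfl fun j _ => by ring

end Coordinates

instance finiteDimensional_spo₀ : FiniteDimensional ℝ S.spo₀ := by
  let L : ((V₀ →L[ℝ] V₀) × (V₁ →L[ℝ] V₁)) →ₗ[ℝ] ((V₀ →ₗ[ℝ] V₀) × (V₁ →ₗ[ℝ] V₁)) :=
    { toFun := fun X => (X.1, X.2)
      map_add' := fun _ _ => rfl
      map_smul' := fun _ _ => rfl }
  have hL : Function.Injective L := fun X Y h => by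
    have h1 := congrArg Prod.fst h
    have h2 := congrArg Prod.snd h
    exact Prod.ext (ContinuousLinearMap.coe_injective h1) (ContinuousLinearMap.coe_injective h2)
  have : FiniteDimensional ℝ ((V₀ →L[ℝ] V₀) × (V₁ →L[ℝ] V₁)) :=
    FiniteDimensional.of_injective L hL
  infer_instance

/-- Each coefficient is a Gaussian times a function of temperate growth. -/
theorem rapidlyDecreasing_gexp_quad {a : ℂ} {X Y : S.spo₀}
    (h : ∀ v : V₀, v ≠ 0 → (a * S.evenForm X Y v).re < 0) :
    RapidlyDecreasing fun v => gexp (a • S.quad X Y v) := by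
  intro ℓ
  obtain ⟨p, hp⟩ := exists_dual_gexp_quad (Module.finBasis ℝ V₀) (Module.finBasis ℝ S.spo₀) ℓ
  have hQ : Function.HasTemperateGrowth fun v => a * S.evenForm X Y v :=
    (Function.HasTemperateGrowth.const a).mul (hasTemperateGrowth_evenForm X Y)
  obtain ⟨c, hc, hcq⟩ := exists_pos_mul_sq_le (q := fun v => -(a * S.evenForm X Y v).re)
    (Complex.continuous_re.comp hQ.1.continuous).neg
    (fun s v => by
      have : a * S.evenForm X Y (s • v) = ((s ^ 2 : ℝ) : ℂ) * (a * S.evenForm X Y v) := by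
        rw [evenForm_smul]; push_cast; ring
      rw [this, Complex.re_ofReal_mul, mul_neg])
    (fun v hv => neg_pos.2 (h v hv))
  have hd : ∃ c > 0, ∀ v, (a * S.evenForm X Y v).re ≤ -(c * ‖v‖ ^ 2) :=
    ⟨c, hc, fun v => by have := hcq v; linarith⟩
  have hw : Function.HasTemperateGrowth fun v =>
      ∑ r ∈ Finset.range (Module.finrank ℂ (S.spo₁ × V₁ →ₗ[ℝ] ℂ) + 1), a ^ r *
        (p r).eval (coords (Module.finBasis ℝ V₀) (Module.finBasis ℝ S.spo₀) X Y v) :=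
    Function.HasTemperateGrowth.sum fun r _ =>
      (Function.HasTemperateGrowth.const _).mul (hasTemperateGrowth_coords _ _ X Y (p r))
  refine ⟨SchwartzMap.smulLeftCLM (𝕜 := ℂ) ℂ (fun v =>
      ∑ r ∈ Finset.range (Module.finrank ℂ (S.spo₁ × V₁ →ₗ[ℝ] ℂ) + 1), a ^ r *
        (p r).eval (coords (Module.finBasis ℝ V₀) (Module.finBasis ℝ S.spo₀) X Y v))
      (gaussian _ hQ hd), fun v => ?_⟩
  rw [SchwartzMap.smulLeftCLM_apply_apply hw, hp, gaussian_apply, smul_eq_mul, mul_comm]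

theorem integrable_dual {κ E : Type*} [Fintype κ] (e : Module.Basis κ ℝ V₀) [AddCommGroup E]
    [Module ℝ E] {φ : V₀ → Gr E} (hφ : RapidlyDecreasing φ) (ℓ : Module.Dual ℂ (Gr E)) :
    Integrable fun x : κ → ℝ => ℓ (φ (e.equivFun.symm x)) := by
  obtain ⟨s, hs⟩ := hφ ℓ
  have := (SchwartzMap.compCLMOfContinuousLinearEquiv ℂ
    e.equivFun.symm.toContinuousLinearEquiv s).integrable (μ := volume)
  refine this.congr (ae_of_all _ fun x => ?_)
  exact hs _

theorem neg_half_re_neg {X : S.spo₀} (hX : X ∈ S.Vplus) (Y : S.spo₀) (v : V₀) (hv : v ≠ 0) :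
    (-(1 / 2 : ℂ) * S.evenForm X Y v).re < 0 := by
  have : (-(1 / 2 : ℂ)) = ((-(1 / 2) : ℝ) : ℂ) := by push_cast; rfl
  rw [this, Complex.re_ofReal_mul, evenForm_re]
  have := hX v hv
  linarith

variable {k n : ℕ} (b : S.OrientedBasis k n)

/-- Berezin integration along `V₁`. -/
def OrientedBasis.fiber : Gr (S.spo₁ × V₁) →ₗ[ℂ] Gr S.spo₁ :=
  (pull (LinearMap.inl ℝ S.spo₁ V₁)).toLinearMap ∘ₗ
    berezin fun a => (LinearMap.inr ℝ S.spo₁ V₁).baseChange ℂ (b.f a)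

theorem OrientedBasis.fiber_apply (w : Gr (S.spo₁ × V₁)) :
    b.fiber w = pull (LinearMap.inl ℝ S.spo₁ V₁)
      (berezin (fun a => (LinearMap.inr ℝ S.spo₁ V₁).baseChange ℂ (b.f a)) w) := rfl

theorem baseChange_scaleOdd (s : ℝ) (w : ℂ ⊗[ℝ] V₁) :
    (LinearMap.prodMap (LinearMap.id : S.spo₁ →ₗ[ℝ] S.spo₁) (s • LinearMap.id)).baseChange ℂ
      ((LinearMap.inr ℝ S.spo₁ V₁).baseChange ℂ w) =
        (s : ℂ) • (LinearMap.inr ℝ S.spo₁ V₁).baseChange ℂ w := by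
  rw [← LinearMap.comp_apply, ← LinearMap.baseChange_comp]
  have : LinearMap.prodMap (LinearMap.id : S.spo₁ →ₗ[ℝ] S.spo₁) (s • LinearMap.id) ∘ₗ
      LinearMap.inr ℝ S.spo₁ V₁ = s • LinearMap.inr ℝ S.spo₁ V₁ := by
    ext <;> simp
  rw [this, LinearMap.baseChange_smul, LinearMap.smul_apply]
  exact (algebraMap_smul ℂ s _).symm

/-- The odd Jacobian: `n` derivatives give `s ^ n`, and the scaling becomes invisible after
restriction to `ξ = 0`. -/
theorem OrientedBasis.fiber_scaleOdd (s : ℝ) (w : Gr (S.spo₁ × V₁)) :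
    b.fiber (S.scaleOdd s w) = (s : ℂ) ^ n • b.fiber w := by
  rw [fiber_apply, scaleOdd, berezin_pull _ (s : ℂ) (fun a => baseChange_scaleOdd s (b.f a)),
    map_smul, pull_pull, fiber_apply]
  congr 3
  ext <;> simp

theorem OrientedBasis.rescale_fiber (c : ℂ) (w : Gr (S.spo₁ × V₁)) :
    rescale c (b.fiber w) = b.fiber (rescaleFst S.spo₁ V₁ c w) := by
  rw [fiber_apply, fiber_apply, berezin_inr_rescaleFst, pull_inl_rescaleFst]

theorem OrientedBasis.dual_spfAn {X : S.spo₀} (hX : X ∈ S.Vplus) (Y : S.spo₀)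
    (ℓ : Module.Dual ℂ (Gr S.spo₁)) :
    ℓ (b.spfAn X Y) = ((2 * Real.pi : ℂ) ^ k)⁻¹ * ∫ x : Fin k × Fin 2 → ℝ,
      ℓ (b.fiber (gexp (-(1 / 2 : ℂ) • S.quad X Y (b.e.equivFun.symm x)))) := by
  rw [spfAn, integralParam, map_smul, smul_eq_mul, dual_grIntegral]
  · rfl
  · intro ℓ'
    exact integrable_dual b.e (rapidlyDecreasing_gexp_quad (neg_half_re_neg hX Y)) (ℓ' ∘ₗ b.fiber)

theorem OrientedBasis.dual_spfAnRotated {Y : S.spo₀} (hY : Y ∈ S.Vminus) (X : S.spo₀)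
    (ℓ : Module.Dual ℂ (Gr S.spo₁)) :
    ℓ (b.spfAnRotated X Y) = phase V₀ V₁ * (((2 * Real.pi : ℂ) ^ k)⁻¹ *
      ∫ x : Fin k × Fin 2 → ℝ,
        ℓ (b.fiber (gexp (-(Complex.I / 2) • S.quad X Y (b.e.equivFun.symm x))))) := by
  have hY' : -Y ∈ S.Vplus := fun v hv => by
    have := hY v hv
    simpa using this
  have := b.dual_spfAn hY' X (ℓ ∘ₗ (rescale Complex.I).toLinearMap)
  rw [spfAnRotated, map_smul, smul_eq_mul]
  congr 1
  refine this.trans ?_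
  congr 1
  refine integral_congr_ae (ae_of_all _ fun x => ?_)
  simp only [LinearMap.comp_apply, AlgHom.toLinearMap_apply]
  rw [rescale_fiber, gexp_rescaleFst]

end OrientedSymplectic

end

/-! ### Holomorphy of the analytic superPfaffian -/

section

namespace OrientedSymplectic
set_option linter.unusedSectionVars false

variable {V₀ V₁ : Type*} [NormedAddCommGroup V₀] [NormedSpace ℝ V₀] [FiniteDimensional ℝ V₀]
  [NormedAddCommGroup V₁] [NormedSpace ℝ V₁] [FiniteDimensional ℝ V₁]
  {S : OrientedSymplectic V₀ V₁} {k n : ℕ} (b : S.OrientedBasis k n)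
  {ι : Type*} [Fintype ι] (c₀ : Module.Basis ι ℝ S.spo₀)

/-- The complex coordinates of `X + iY`. -/
def complexCoords : S.spo₀ × S.spo₀ →L[ℝ] (ι → ℂ) :=
  LinearMap.toContinuousLinearMap
    { toFun := fun p j => (c₀.repr p.1 j : ℂ) + Complex.I * (c₀.repr p.2 j : ℂ)
      map_add' := fun p q => by ext j; simp; ring
      map_smul' := fun c p => by ext j; simp; ring }

theorem complexCoords_apply (X Y : S.spo₀) (j : ι) :
    complexCoords c₀ (X, Y) j = (c₀.repr X j : ℂ) + Complex.I * (c₀.repr Y j : ℂ) := rfl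

theorem complexCoords_rotate (Z W : S.spo₀) :
    complexCoords c₀ (-W, Z) = Complex.I • complexCoords c₀ (Z, W) := by
  ext j
  simp only [complexCoords_apply, Pi.smul_apply, smul_eq_mul, map_neg, Finsupp.neg_apply,
    Complex.ofReal_neg]
  linear_combination -(c₀.repr W j : ℂ) * Complex.I_mul_I

theorem coords_equivFun_symm {κ : Type*} [Fintype κ] (e : Module.Basis κ ℝ V₀) (X Y : S.spo₀)
    (x : κ → ℝ) :
    coords e c₀ X Y (e.equivFun.symm x) =
      Sum.elim (complexCoords c₀ (X, Y)) fun i => (x i : ℂ) := by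
  ext i
  rcases i with j | i
  · rfl
  · have : e.repr (e.equivFun.symm x) i = x i := congrFun (e.equivFun.apply_symm_apply x) i
    exact congrArg ((↑) : ℝ → ℂ) this

theorem hasTemperateGrowth_monomial {κ : Type*} [Fintype κ] (d : κ → ℕ) :
    Function.HasTemperateGrowth fun x : κ → ℝ => ∏ i, (x i : ℂ) ^ d i := by
  have := hasTemperateGrowth_eval (D := κ → ℝ) (u := fun x i => (x i : ℂ))
    (fun i => Function.Complex.hasTemperateGrowth_ofReal.comp
      (ContinuousLinearMap.proj (R := ℝ) (φ := fun _ : κ => ℝ) i).hasTemperateGrowth)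
    (∏ i, MvPolynomial.X i ^ d i)
  simpa only [map_prod, map_pow, MvPolynomial.eval_X] using this

theorem eval_sumElim {κ : Type*} [Fintype κ] (P : MvPolynomial (ι ⊕ κ) ℂ) (z : ι → ℂ) (v : κ → ℂ) :
    P.eval (Sum.elim z v) = ∑ d ∈ P.support,
      (P.coeff d * ∏ j, z j ^ d (Sum.inl j)) * ∏ i, v i ^ d (Sum.inr i) := by
  rw [MvPolynomial.eval_eq']
  refine Finset.sum_congr rfl fun d _ => ?_
  rw [Fintype.prod_sum_type]
  simp [mul_assoc]

theorem continuous_form (X : S.spo₀) : Continuous fun v : V₀ => S.B₀ v (X.1.1 v) :=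
  (hasTemperateGrowth_form X).1.continuous

theorem continuous_equivFun_symm {κ : Type*} [Fintype κ] (e : Module.Basis κ ℝ V₀) :
    Continuous e.equivFun.symm :=
  LinearMap.continuous_of_finiteDimensional (e.equivFun.symm : (κ → ℝ) →ₗ[ℝ] V₀)

/-- `z ↦ -½ B(v, zv)` in coordinates. -/
def laplaceForm {κ : Type*} [Fintype κ] (e : Module.Basis κ ℝ V₀) (x : κ → ℝ) :
    (ι → ℂ) →L[ℂ] ℂ :=
  ∑ j, ((-(1 / 2) * S.B₀ (e.equivFun.symm x) ((c₀ j).1.1 (e.equivFun.symm x)) : ℝ) : ℂ) •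
    ContinuousLinearMap.proj j

theorem laplaceForm_complexCoords {κ : Type*} [Fintype κ] (e : Module.Basis κ ℝ V₀) (x : κ → ℝ)
    (X Y : S.spo₀) : laplaceForm c₀ e x (complexCoords c₀ (X, Y)) =
      -(1 / 2 : ℂ) * S.evenForm X Y (e.equivFun.symm x) := by
  rw [evenForm_eq_sum c₀, Finset.mul_sum, laplaceForm, _root_.sum_apply]
  refine Finset.sum_congr rfl fun j _ => ?_
  rw [_root_.smul_apply, ContinuousLinearMap.proj_apply, complexCoords_apply, smul_eq_mul]
  push_cast
  ring

/-- The integrand depends on `(X, Y)` only through the complex coordinates of `X + iY`. The identity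
with `F` holds for all `X`, without convergence, because the integrands agree pointwise; positivity
enters only for analyticity. -/
theorem OrientedBasis.analyticAt_dual_fiber (ℓ : Module.Dual ℂ (Gr (S.spo₁ × V₁))) :
    ∃ F : (ι → ℂ) → ℂ,
      (∀ X Y, ∫ x : Fin k × Fin 2 → ℝ,
        ℓ (gexp (-(1 / 2 : ℂ) • S.quad X Y (b.e.equivFun.symm x))) = F (complexCoords c₀ (X, Y))) ∧
      ∀ X ∈ S.Vplus, ∀ Y, AnalyticAt ℂ F (complexCoords c₀ (X, Y)) := by
  obtain ⟨P, hP⟩ := exists_dual_gexp_quad_of_coeff b.e c₀ (-(1 / 2 : ℂ)) ℓ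
  refine ⟨fun z => ∫ x : Fin k × Fin 2 → ℝ, Complex.exp (laplaceForm c₀ b.e x z) *
    ∑ d ∈ P.support, (P.coeff d * ∏ j, z j ^ d (Sum.inl j)) * ∏ i, (x i : ℂ) ^ d (Sum.inr i),
    fun X Y => ?_, fun X hX Y => ?_⟩
  · refine integral_congr_ae (ae_of_all _ fun x => ?_)
    simp only
    rw [hP, laplaceForm_complexCoords, ← eval_sumElim, coords_equivFun_symm]
  · refine analyticAt_laplace_sum volume (T := laplaceForm c₀ b.e) ?_ ?_ ?_ P.support
      (α := fun d z => P.coeff d * ∏ j, z j ^ d (Sum.inl j))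
      (w := fun d x => ∏ i, (x i : ℂ) ^ d (Sum.inr i)) (fun d => ?_)
      (fun d => hasTemperateGrowth_monomial _)
    · refine continuous_finsetSum _ fun j _ => ?_
      exact (Complex.continuous_ofReal.comp (continuous_const.mul
        ((continuous_form (c₀ j)).comp (continuous_equivFun_symm b.e)))).smul continuous_const
    · intro s x
      rw [laplaceForm, laplaceForm, Finset.smul_sum]
      refine Finset.sum_congr rfl fun j _ => ?_
      rw [map_smul, form_smul, ← Complex.coe_smul, smul_smul]
      congr 1
      push_cast
      ring
    · intro x hx
      rw [laplaceForm_complexCoords]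
      exact neg_half_re_neg hX Y _ (b.e.equivFun.symm.map_ne_zero_iff.2 hx)
    · refine analyticAt_const.mul (Finset.analyticAt_fun_prod _ fun j _ => AnalyticAt.pow ?_ _)
      exact (ContinuousLinearMap.proj (R := ℂ) (φ := fun _ : ι => ℂ) j).analyticAt _

theorem OrientedBasis.analyticAt_spfAn (ℓ : Module.Dual ℂ (Gr S.spo₁)) :
    ∃ F : (ι → ℂ) → ℂ, (∀ X Y, ℓ (b.spfAn X Y) = F (complexCoords c₀ (X, Y))) ∧
      ∀ X ∈ S.Vplus, ∀ Y, AnalyticAt ℂ F (complexCoords c₀ (X, Y)) := by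
  choose F hF hFa using fun I => b.analyticAt_dual_fiber c₀
    ((monomials (Module.finBasis ℝ S.spo₁)).coord I ∘ₗ b.fiber)
  refine ⟨fun z => ((2 * Real.pi : ℂ) ^ k)⁻¹ *
    ∑ I, F I z * ℓ (monomials (Module.finBasis ℝ S.spo₁) I), fun X Y => ?_, fun X hX Y => ?_⟩
  · rw [spfAn, integralParam, map_smul, smul_eq_mul, grIntegral, map_sum]
    congr 1
    refine Finset.sum_congr rfl fun I _ => ?_
    rw [map_smul, smul_eq_mul, ← hF]
    rfl
  · exact analyticAt_const.mul (Finset.analyticAt_fun_sum _ fun I _ =>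
      (hFa I X hX Y).mul analyticAt_const)

/-- The relation on `L` is the Cauchy–Riemann equation: `(Z, W) ↦ (-W, Z)` is multiplication by `i`
on `Z + iW`, and the derivative of `F` is complex linear. -/
theorem OrientedBasis.holomorphic_spfAn (ℓ : Module.Dual ℂ (Gr S.spo₁)) {X : S.spo₀}
    (hX : X ∈ S.Vplus) (Y : S.spo₀) : ∃ L : S.spo₀ × S.spo₀ →L[ℝ] ℂ,
      HasFDerivAt (fun p : S.spo₀ × S.spo₀ => ℓ (b.spfAn p.1 p.2)) L (X, Y) ∧
        ∀ Z W : S.spo₀, L (-W, Z) = Complex.I * L (Z, W) := by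
  obtain ⟨F, hF, hFa⟩ := b.analyticAt_spfAn (Module.finBasis ℝ S.spo₀) ℓ
  have h1 := (hFa X hX Y).differentiableAt.hasFDerivAt.restrictScalars ℝ
  refine ⟨((fderiv ℂ F (complexCoords (Module.finBasis ℝ S.spo₀) (X, Y))).restrictScalars ℝ).comp
    (complexCoords (Module.finBasis ℝ S.spo₀)), ?_, ?_⟩
  · have := h1.comp (X, Y) (complexCoords (Module.finBasis ℝ S.spo₀)).hasFDerivAt
    refine this.congr_of_eventuallyEq (Eventually.of_forall fun p => ?_)
    exact hF p.1 p.2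
  · intro Z W
    rw [ContinuousLinearMap.comp_apply, ContinuousLinearMap.comp_apply, complexCoords_rotate,
      ContinuousLinearMap.coe_restrictScalars', map_smul, smul_eq_mul]

theorem OrientedBasis.analyticOnNhd_spfAn (ℓ : Module.Dual ℂ (Gr S.spo₁)) :
    AnalyticOnNhd ℝ (fun X => ℓ (b.spfAn X 0)) S.Vplus := by
  obtain ⟨F, hF, hFa⟩ := b.analyticAt_spfAn (Module.finBasis ℝ S.spo₀) ℓ
  intro X hX
  simp only [hF]
  let L : S.spo₀ →L[ℝ] _ := (complexCoords (Module.finBasis ℝ S.spo₀)).comp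
    (ContinuousLinearMap.inl ℝ S.spo₀ S.spo₀)
  have h1 : AnalyticAt ℝ L X :=
    ContinuousLinearMap.analyticAt (𝕜 := ℝ) (E := S.spo₀) (F := Fin _ → ℂ) L X
  exact ((hFa X hX 0).restrictScalars (𝕜 := ℝ)).comp_of_eq h1 rfl

/-! ### Rotation of the analytic superPfaffian -/

theorem OrientedBasis.finrank_even (b : S.OrientedBasis k n) : Module.finrank ℝ V₀ = k * 2 := by
  rw [Module.finrank_eq_card_basis b.e]; simp

theorem OrientedBasis.finrank_odd (b : S.OrientedBasis k n) : Module.finrank ℝ V₁ = n := by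
  rw [← Module.finrank_baseChange (R := ℂ) (M' := V₁), Module.finrank_eq_card_basis b.f]; simp

/-- Substituting `sv` for `v` absorbs the factor `s²`. The Jacobian is `s ^ n` from the odd
variables and `s ^ (-2k)` from the even ones. -/
theorem OrientedBasis.integral_sq_smul_quad (X Y : S.spo₀) (ℓ : Module.Dual ℂ (Gr S.spo₁)) (a : ℂ)
    {s : ℝ} (hs : 0 < s) :
    ∫ x : Fin k × Fin 2 → ℝ,
        ℓ (b.fiber (gexp ((a * (s : ℂ) ^ 2) • S.quad X Y (b.e.equivFun.symm x)))) =
      ((s : ℂ) ^ n / (s : ℂ) ^ (k * 2)) *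
        ∫ x : Fin k × Fin 2 → ℝ, ℓ (b.fiber (gexp (a • S.quad X Y (b.e.equivFun.symm x)))) := by
  have h (x : Fin k × Fin 2 → ℝ) :
      ℓ (b.fiber (gexp ((a * (s : ℂ) ^ 2) • S.quad X Y (b.e.equivFun.symm x)))) =
        (s : ℂ) ^ n * ℓ (b.fiber (gexp (a • S.quad X Y (b.e.equivFun.symm (s • x))))) := by
    rw [gexp_sq_smul_quad, LinearEquiv.map_smul b.e.equivFun.symm]
    exact (congrArg ℓ (b.fiber_scaleOdd s _)).trans (ℓ.map_smul _ _)
  simp only [h]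
  rw [integral_const_mul, Measure.integral_comp_smul volume
    (fun x => ℓ (b.fiber (gexp (a • S.quad X Y (b.e.equivFun.symm x))))) s]
  have hd : Module.finrank ℝ (Fin k × Fin 2 → ℝ) = k * 2 := by simp
  rw [hd, abs_of_pos (by positivity), ← Complex.coe_smul, smul_eq_mul]
  push_cast
  ring

theorem cpow_half_sub {s : ℝ} (hs : 0 < s) (n m : ℕ) :
    ((s : ℂ) ^ 2) ^ (((n : ℂ) - (m : ℂ)) / 2) = (s : ℂ) ^ n / (s : ℂ) ^ m := by
  have h1 : (((n : ℂ) - (m : ℂ)) / 2) = ((((n : ℝ) - (m : ℝ)) / 2 : ℝ) : ℂ) := by push_cast; rfl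
  rw [h1, ← Complex.ofReal_pow, ← Complex.ofReal_cpow (by positivity), ← Real.rpow_natCast s 2,
    ← Real.rpow_mul hs.le]
  rw [show ((2 : ℕ) : ℝ) * (((n : ℝ) - (m : ℝ)) / 2) = (n : ℝ) - (m : ℝ) by push_cast; ring,
    Real.rpow_sub hs, Real.rpow_natCast, Real.rpow_natCast]
  push_cast
  rfl

/-- The closed first quadrant without the origin. -/
def quadrant : Set ℂ := {c | 0 ≤ c.re ∧ 0 ≤ c.im ∧ 0 < c.re + c.im}

theorem isPreconnected_quadrant : IsPreconnected quadrant := by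
  refine Convex.isPreconnected ?_
  rintro x ⟨hx1, hx2, hx3⟩ y ⟨hy1, hy2, hy3⟩ s t hs ht hst
  refine ⟨by simp; positivity, by simp; positivity, ?_⟩
  have : (s • x + t • y).re + (s • x + t • y).im = s * (x.re + x.im) + t * (y.re + y.im) := by
    simp; ring
  rw [this]
  rcases hs.eq_or_lt with rfl | hs
  · have : t = 1 := by linarith
    subst this; linarith
  · have := mul_pos hs hx3
    have := mul_nonneg ht hy3.le
    linarith

/-- The real part of the exponent is `-½ (Re c · B(v, Xv) - Im c · B(v, Yv))`. On the quadrant both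
terms have the good sign and at least one is strict. -/
theorem OrientedBasis.analyticAt_scale {X Y : S.spo₀} (hX : X ∈ S.Vplus) (hY : Y ∈ S.Vminus)
    (ℓ : Module.Dual ℂ (Gr (S.spo₁ × V₁))) {c : ℂ} (hc : c ∈ quadrant) :
    AnalyticAt ℂ (fun c : ℂ => ∫ x : Fin k × Fin 2 → ℝ,
      ℓ (gexp ((-(1 / 2 : ℂ) * c) • S.quad X Y (b.e.equivFun.symm x)))) c := by
  obtain ⟨p, hp⟩ := exists_dual_gexp_quad b.e (Module.finBasis ℝ S.spo₀) ℓ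
  let T (x : Fin k × Fin 2 → ℝ) : ℂ →L[ℂ] ℂ :=
    (-(1 / 2 : ℂ) * S.evenForm X Y (b.e.equivFun.symm x)) • ContinuousLinearMap.id ℂ ℂ
  have hT (x) (c : ℂ) : T x c = -(1 / 2 : ℂ) * c * S.evenForm X Y (b.e.equivFun.symm x) := by
    simp only [T, _root_.smul_apply, ContinuousLinearMap.id_apply, smul_eq_mul]; ring
  have key := analyticAt_laplace_sum (D := Fin k × Fin 2 → ℝ) volume (T := T) (z₀ := c) ?_ ?_ ?_
    (Finset.range (Module.finrank ℂ (S.spo₁ × V₁ →ₗ[ℝ] ℂ) + 1))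
    (α := fun r c => (-(1 / 2 : ℂ) * c) ^ r)
    (w := fun r x => (p r).eval
      (coords b.e (Module.finBasis ℝ S.spo₀) X Y (b.e.equivFun.symm x)))
    (fun r => by fun_prop) (fun r => ?_)
  · refine key.congr (Eventually.of_forall fun c => ?_)
    simp only [hp, hT]
  · exact (continuous_const.mul ((hasTemperateGrowth_evenForm X Y).1.continuous.comp
      (continuous_equivFun_symm b.e))).smul continuous_const
  · intro s x
    simp only [T]
    rw [map_smul, evenForm_smul, ← Complex.coe_smul, smul_smul]
    congr 1
    push_cast
    ring
  · intro x hx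
    rw [hT]
    have hv : b.e.equivFun.symm x ≠ 0 := b.e.equivFun.symm.map_ne_zero_iff.2 hx
    have h1 := hX _ hv
    have h2 := hY _ hv
    rw [← evenForm_re X Y] at h1
    rw [← evenForm_im X Y] at h2
    obtain ⟨h3, h4, h5⟩ := hc
    have : (-(1 / 2 : ℂ) * c * S.evenForm X Y (b.e.equivFun.symm x)).re =
        -(1 / 2) * (c.re * (S.evenForm X Y (b.e.equivFun.symm x)).re -
          c.im * (S.evenForm X Y (b.e.equivFun.symm x)).im) := by
      rw [show (-(1 / 2 : ℂ)) = ((-(1 / 2) : ℝ) : ℂ) by push_cast; rfl, mul_assoc,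
        Complex.re_ofReal_mul, Complex.mul_re]
    rw [this]
    rcases h3.eq_or_lt with h3 | h3
    · have h6 : 0 < c.im := by linarith
      nlinarith [mul_pos h6 (neg_pos.2 h2)]
    · nlinarith [mul_pos h3 h1, mul_nonneg h4 (neg_pos.2 h2).le]
  · exact (hasTemperateGrowth_coords b.e _ X Y (p r)).comp
      (b.e.equivFun.symm.toContinuousLinearEquiv.hasTemperateGrowth)

/-- Analytic continuation of the scaling law from `c > 0` to `c = i`. The quadrant is connected and
avoids the cut of the principal power, so the branch at `i` is the principal one. -/
theorem OrientedBasis.spfAnRotated_eq {X Y : S.spo₀} (hX : X ∈ S.Vplus) (hY : Y ∈ S.Vminus) :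
    b.spfAnRotated X Y = b.spfAn X Y := by
  rw [← sub_eq_zero]
  refine (Module.forall_dual_apply_eq_zero_iff ℂ _).1 fun ℓ => ?_
  rw [map_sub, sub_eq_zero]
  rw [b.dual_spfAnRotated hY, b.dual_spfAn hX]
  set H : ℂ → ℂ := fun c => ∫ x : Fin k × Fin 2 → ℝ,
    ℓ (b.fiber (gexp ((-(1 / 2 : ℂ) * c) • S.quad X Y (b.e.equivFun.symm x)))) with hH
  have hHa : AnalyticOnNhd ℂ H quadrant := fun c hc => b.analyticAt_scale hX hY (ℓ ∘ₗ b.fiber) hc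
  set α : ℂ := ((n : ℂ) - ((k * 2 : ℕ) : ℂ)) / 2 with hα
  have hG : AnalyticOnNhd ℂ (fun c : ℂ => c ^ α * H 1) quadrant := by
    rintro c ⟨h1, h2, h3⟩
    refine AnalyticAt.mul (AnalyticAt.cpow analyticAt_id analyticAt_const ?_) analyticAt_const
    rw [Complex.mem_slitPlane_iff]
    by_contra! hcon
    rw [hcon.2] at h3
    linarith [hcon.1]
  have h1 : (1 : ℂ) ∈ quadrant := by simp [quadrant]
  have hI : Complex.I ∈ quadrant := by simp [quadrant]
  have hreal (s : ℝ) (hs : 0 < s) : H ((s : ℂ) ^ 2) = ((s : ℂ) ^ 2) ^ α * H 1 := by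
    rw [hα, cpow_half_sub hs]
    simp only [hH, mul_one]
    exact b.integral_sq_smul_quad X Y ℓ _ hs
  have hfreq : ∃ᶠ c in 𝓝[≠] (1 : ℂ), H c = c ^ α * H 1 := by
    -- The identity theorem needs points of agreement accumulating at `1` but different from it;
    -- squares of reals larger than `1` suffice.
    have ht : Tendsto (fun m : ℕ => (((1 + 1 / ((m : ℝ) + 1) : ℝ) : ℂ)) ^ 2) atTop (𝓝[≠] 1) := by
      refine tendsto_nhdsWithin_iff.2 ⟨?_, Eventually.of_forall fun m => ?_⟩
      · have := (tendsto_one_div_add_atTop_nhds_zero_nat (𝕜 := ℝ)).const_add 1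
        have := ((Complex.continuous_ofReal.tendsto _).comp this).pow 2
        simpa using this
      · have : (0 : ℝ) < 1 / ((m : ℝ) + 1) := by positivity
        rw [Set.mem_compl_singleton_iff, ← Complex.ofReal_pow, ← Complex.ofReal_one, ne_eq,
          Complex.ofReal_inj]
        nlinarith
    exact ht.frequently (Frequently.of_forall fun m => hreal _ (by positivity))
  have hEq := hHa.eqOn_of_preconnected_of_frequently_eq hG isPreconnected_quadrant h1 hfreq hI
  have hHI : H Complex.I = ∫ x : Fin k × Fin 2 → ℝ,
      ℓ (b.fiber (gexp (-(Complex.I / 2) • S.quad X Y (b.e.equivFun.symm x)))) := by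
    simp only [hH]
    rw [show (-(1 / 2 : ℂ) * Complex.I) = -(Complex.I / 2) by ring]
  have hH1 : H 1 = ∫ x : Fin k × Fin 2 → ℝ,
      ℓ (b.fiber (gexp (-(1 / 2 : ℂ) • S.quad X Y (b.e.equivFun.symm x)))) := by
    simp only [hH, mul_one]
  rw [← hHI, ← hH1, hEq]
  have hph : phase V₀ V₁ * Complex.I ^ α = 1 := by
    rw [phase, b.finrank_even, b.finrank_odd, hα, ← Complex.cpow_add _ _ Complex.I_ne_zero]
    rw [show (((k * 2 : ℕ) : ℂ) - (n : ℂ)) / 2 + ((n : ℂ) - ((k * 2 : ℕ) : ℂ)) / 2 = 0 by ring,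
      Complex.cpow_zero]
  linear_combination ((2 * Real.pi : ℂ) ^ k)⁻¹ * H 1 * hph

end OrientedSymplectic

end

/-! ### Exchange of Berezin integrals -/

section

namespace OrientedSymplectic
set_option linter.unusedSectionVars false

variable {V₀ V₁ : Type*} [NormedAddCommGroup V₀] [NormedSpace ℝ V₀] [FiniteDimensional ℝ V₀]
  [NormedAddCommGroup V₁] [NormedSpace ℝ V₁] [FiniteDimensional ℝ V₁]
  {S : OrientedSymplectic V₀ V₁} {k n N : ℕ} (b : S.OrientedBasis k n)
  (c₁ : Module.Basis (Fin N) ℝ S.spo₁)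

/-- Berezin integration along `spo(V)₁` of the product with `y`. -/
def parameterIntegral (y : Gr S.spo₁) : Gr (S.spo₁ × V₁) →ₗ[ℂ] Gr V₁ :=
  (pull (LinearMap.inr ℝ S.spo₁ V₁)).toLinearMap ∘ₗ
    berezin (fun l => (LinearMap.inl ℝ S.spo₁ V₁).baseChange ℂ ((1 : ℂ) ⊗ₜ[ℝ] c₁ l)) ∘ₗ
    LinearMap.mulLeft ℂ (pull (LinearMap.fst ℝ S.spo₁ V₁) y)

theorem parameterIntegral_apply (y : Gr S.spo₁) (w : Gr (S.spo₁ × V₁)) :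
    parameterIntegral c₁ y w = pull (LinearMap.inr ℝ S.spo₁ V₁)
      (berezin (fun l => (LinearMap.inl ℝ S.spo₁ V₁).baseChange ℂ ((1 : ℂ) ⊗ₜ[ℝ] c₁ l))
        (pull (LinearMap.fst ℝ S.spo₁ V₁) y * w)) := rfl

/-- The Berezin integral over `V₁` of the Berezin integral over `spo(V)₁`. -/
def OrientedBasis.innerFirst (y : Gr S.spo₁) : Module.Dual ℂ (Gr (S.spo₁ × V₁)) :=
  body.toLinearMap ∘ₗ berezin b.f ∘ₗ parameterIntegral c₁ y

/-- The Berezin integral over `spo(V)₁` of the Berezin integral over `V₁`. -/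
def OrientedBasis.fiberFirst (y : Gr S.spo₁) : Module.Dual ℂ (Gr (S.spo₁ × V₁)) :=
  body.toLinearMap ∘ₗ berezin (fun l => (1 : ℂ) ⊗ₜ[ℝ] c₁ l) ∘ₗ LinearMap.mulLeft ℂ y ∘ₗ b.fiber

theorem berezin_pull_self {E F : Type*} [AddCommGroup E] [Module ℝ E] [AddCommGroup F] [Module ℝ F]
    {n : ℕ} (g : E →ₗ[ℝ] F) (f : Fin n → ℂ ⊗[ℝ] E) (x : Gr F) :
    berezin f (pull g x) = pull g (berezin (fun a => g.baseChange ℂ (f a)) x) := by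
  rw [berezin_pull g 1 (f' := fun a => g.baseChange ℂ (f a)) fun a => (one_smul ℂ _).symm]
  rw [one_pow, one_smul]

theorem OrientedBasis.innerFirst_apply (y : Gr S.spo₁) (w : Gr (S.spo₁ × V₁)) :
    b.innerFirst c₁ y w = body (berezin (fun a => (LinearMap.inr ℝ S.spo₁ V₁).baseChange ℂ (b.f a))
      (berezin (fun l => (LinearMap.inl ℝ S.spo₁ V₁).baseChange ℂ ((1 : ℂ) ⊗ₜ[ℝ] c₁ l))
        (pull (LinearMap.fst ℝ S.spo₁ V₁) y * w))) := by
  change body (berezin b.f (parameterIntegral c₁ y w)) = _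
  rw [parameterIntegral_apply, berezin_pull_self, body_pull]

theorem OrientedBasis.fiberFirst_apply (y : Gr S.spo₁) (w : Gr (S.spo₁ × V₁)) :
    b.fiberFirst c₁ y w = body
      (berezin (fun l => (LinearMap.inl ℝ S.spo₁ V₁).baseChange ℂ ((1 : ℂ) ⊗ₜ[ℝ] c₁ l))
        (pull (LinearMap.fst ℝ S.spo₁ V₁) y *
          berezin (fun a => (LinearMap.inr ℝ S.spo₁ V₁).baseChange ℂ (b.f a)) w)) := by
  change body (berezin _ (y * b.fiber w)) = _
  have hy : y = pull (LinearMap.inl ℝ S.spo₁ V₁) (pull (LinearMap.fst ℝ S.spo₁ V₁) y) := by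
    rw [pull_pull, LinearMap.fst_comp_inl, pull_id]
  rw [fiber_apply]
  conv_lhs => rw [hy, ← map_mul, berezin_pull_self, body_pull]

/-- With `n` even, the operator `∂/∂ξ^1 ⋯ ∂/∂ξ^n` is even: it commutes with the other derivatives
and passes functions on `E` without sign. -/
theorem body_berezin_comm_of_even {E F : Type*} [AddCommGroup E] [Module ℝ E] [AddCommGroup F]
    [Module ℝ F] {n N : ℕ} (hn : Even n) (f : Fin n → ℂ ⊗[ℝ] F) (c : Fin N → ℂ ⊗[ℝ] (E × F))
    (y : Gr E) (w : Gr (E × F)) :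
    body (berezin (fun a => (LinearMap.inr ℝ E F).baseChange ℂ (f a))
      (berezin c (pull (LinearMap.fst ℝ E F) y * w))) =
    body (berezin c (pull (LinearMap.fst ℝ E F) y *
      berezin (fun a => (LinearMap.inr ℝ E F).baseChange ℂ (f a)) w)) := by
  rw [berezin_comm, berezin_inr_pull_fst_mul, hn.neg_one_pow, one_pow, one_smul, rescale_one]

theorem OrientedBasis.innerFirst_eq_of_even (hn : Even n) (y : Gr S.spo₁) :
    b.innerFirst c₁ y = b.fiberFirst c₁ y := by
  refine LinearMap.ext fun w => ?_
  exact (b.innerFirst_apply c₁ y w).trans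
    ((body_berezin_comm_of_even hn _ _ y w).trans (b.fiberFirst_apply c₁ y w).symm)

theorem baseChange_scaleOdd_inl (s : ℝ) (w : ℂ ⊗[ℝ] S.spo₁) :
    (LinearMap.prodMap (LinearMap.id : S.spo₁ →ₗ[ℝ] S.spo₁) (s • LinearMap.id)).baseChange ℂ
      ((LinearMap.inl ℝ S.spo₁ V₁).baseChange ℂ w) =
        (LinearMap.inl ℝ S.spo₁ V₁).baseChange ℂ w := by
  rw [← LinearMap.comp_apply, ← LinearMap.baseChange_comp]
  congr 2
  ext <;> simp

theorem body_berezin_berezin_pull {E : Type*} [AddCommGroup E] [Module ℝ E] {n N : ℕ}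
    (g : E →ₗ[ℝ] E) (s : ℂ) {f : Fin n → ℂ ⊗[ℝ] E} {c : Fin N → ℂ ⊗[ℝ] E}
    (hf : ∀ a, g.baseChange ℂ (f a) = s • f a) (hc : ∀ l, g.baseChange ℂ (c l) = c l) (x : Gr E) :
    body (berezin f (berezin c (pull g x))) = s ^ n * body (berezin f (berezin c x)) := by
  have h := berezin_pull_self g c x
  simp only [hc] at h
  rw [h, berezin_pull g s hf, map_smul, body_pull, smul_eq_mul]

theorem OrientedBasis.innerFirst_scaleOdd (s : ℝ) (y : Gr S.spo₁) (w : Gr (S.spo₁ × V₁)) :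
    b.innerFirst c₁ y (S.scaleOdd s w) = (s : ℂ) ^ n * b.innerFirst c₁ y w := by
  have hy : pull (LinearMap.fst ℝ S.spo₁ V₁) y * S.scaleOdd s w =
      pull (LinearMap.prodMap LinearMap.id (s • LinearMap.id))
        (pull (LinearMap.fst ℝ S.spo₁ V₁) y * w) := by
    rw [map_mul, pull_pull]
    rfl
  rw [innerFirst_apply, innerFirst_apply, hy]
  exact body_berezin_berezin_pull _ (s : ℂ) (fun a => baseChange_scaleOdd s (b.f a))
    (fun l => baseChange_scaleOdd_inl s _) _

theorem OrientedBasis.fiberFirst_scaleOdd (s : ℝ) (y : Gr S.spo₁) (w : Gr (S.spo₁ × V₁)) :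
    b.fiberFirst c₁ y (S.scaleOdd s w) = (s : ℂ) ^ n * b.fiberFirst c₁ y w := by
  change body (berezin _ (y * b.fiber _)) = _ * body (berezin _ (y * b.fiber _))
  rw [fiber_scaleOdd, mul_smul_comm, map_smul, map_smul, smul_eq_mul]

theorem dual_gexp_quad_neg {ℓ : Module.Dual ℂ (Gr (S.spo₁ × V₁))}
    (hℓ : ∀ w, ℓ (S.scaleOdd (-1) w) = -ℓ w) (a : ℂ) (X Y : S.spo₀) (v : V₀) :
    ℓ (gexp (a • S.quad X Y (-v))) = -ℓ (gexp (a • S.quad X Y v)) := by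
  have h := gexp_sq_smul_quad (S := S) a (-1) X Y v
  have h1 : a * ((-1 : ℝ) : ℂ) ^ 2 = a := by push_cast; ring
  rw [h1, neg_one_smul ℝ v] at h
  rw [h, hℓ, neg_neg]

end OrientedSymplectic

end

/-! ### Oscillatory kernels -/

section OscillatoryKernel

set_option linter.unusedSectionVars false

open scoped SchwartzMap

variable {ι κ : Type*} [Fintype ι] [Fintype κ]

/-- Expanding `P(x + iy, v)` into monomials separates the variables: `x` is integrated against the
test function, `y` tends to `0`, and `v` is integrated last. -/
theorem exists_eval_add_I_mul (P : MvPolynomial (ι ⊕ κ) ℂ) :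
    ∃ (s : Finset ((ι ⊕ ι) ⊕ κ →₀ ℕ)) (A G : ((ι ⊕ ι) ⊕ κ →₀ ℕ) → (ι → ℝ) → ℂ)
      (W : ((ι ⊕ ι) ⊕ κ →₀ ℕ) → (κ → ℝ) → ℂ),
      (∀ d, (A d).HasTemperateGrowth) ∧ (∀ d, Continuous (G d)) ∧ (∀ d, (W d).HasTemperateGrowth) ∧
      ∀ x y v, P.eval (Sum.elim (fun j => (x j : ℂ) + Complex.I * (y j : ℂ)) fun i => (v i : ℂ)) =
        ∑ d ∈ s, A d x * G d y * W d v := by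
  let Q : MvPolynomial ((ι ⊕ ι) ⊕ κ) ℂ := MvPolynomial.bind₁ (Sum.elim
    (fun j => MvPolynomial.X (Sum.inl (Sum.inl j)) +
      MvPolynomial.C Complex.I * MvPolynomial.X (Sum.inl (Sum.inr j)))
    fun i => MvPolynomial.X (Sum.inr i)) P
  refine ⟨Q.support, fun d x => Q.coeff d * ∏ j, (x j : ℂ) ^ d (Sum.inl (Sum.inl j)),
    fun d y => ∏ j, (y j : ℂ) ^ d (Sum.inl (Sum.inr j)), fun d v => ∏ i, (v i : ℂ) ^ d (Sum.inr i),
    fun d => (Function.HasTemperateGrowth.const _).mul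
      (OrientedSymplectic.hasTemperateGrowth_monomial _),
    fun d => (OrientedSymplectic.hasTemperateGrowth_monomial _).1.continuous,
    fun d => OrientedSymplectic.hasTemperateGrowth_monomial _, fun x y v => ?_⟩
  have hQ : P.eval (Sum.elim (fun j => (x j : ℂ) + Complex.I * (y j : ℂ)) fun i => (v i : ℂ)) =
      Q.eval (Sum.elim (Sum.elim (fun j => (x j : ℂ)) fun j => (y j : ℂ)) fun i => (v i : ℂ)) := by
    rw [← MvPolynomial.coe_aeval_eq_eval, ← MvPolynomial.coe_aeval_eq_eval]
    simp only [Q, RingHom.coe_coe, MvPolynomial.aeval_bind₁]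
    congr 2
    ext i
    rcases i with j | i <;> simp
  rw [hQ, MvPolynomial.eval_eq']
  refine Finset.sum_congr rfl fun d _ => ?_
  rw [Fintype.prod_sum_type, Fintype.prod_sum_type]
  simp [mul_assoc]

variable {g : (κ → ℝ) → ι → ℝ}

/-- `f ↦ (v ↦ w(v) ∫ a(x) f(x) exp(-(i/2) ⟨x, g(v)⟩) dx)`. -/
def oscillatory (hg : g.HasTemperateGrowth)
    (hg' : ∃ C, 0 ≤ C ∧ ∀ v, ‖v‖ ≤ C * (1 + ‖g v‖)) (a : (ι → ℝ) → ℂ) (w : (κ → ℝ) → ℂ) : 𝓢(ι → ℝ, ℂ) →L[ℂ] 𝓢(κ → ℝ, ℂ) :=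
  SchwartzMap.smulLeftCLM (𝕜 := ℂ) ℂ w ∘L fourierComp g hg hg' ∘L
    SchwartzMap.smulLeftCLM (𝕜 := ℂ) ℂ a

theorem oscillatory_apply (hg : g.HasTemperateGrowth)
    (hg' : ∃ C, 0 ≤ C ∧ ∀ v, ‖v‖ ≤ C * (1 + ‖g v‖)) {a : (ι → ℝ) → ℂ} {w : (κ → ℝ) → ℂ} (ha : a.HasTemperateGrowth)
    (hw : w.HasTemperateGrowth) (f : 𝓢(ι → ℝ, ℂ)) (v : κ → ℝ) :
    oscillatory hg hg' a w f v = w v * ∫ x : ι → ℝ,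
      a x * f x * Complex.exp (-(Complex.I / 2) * ∑ j, (x j : ℂ) * (g v j : ℂ)) := by
  simp only [oscillatory, ContinuousLinearMap.comp_apply]
  rw [SchwartzMap.smulLeftCLM_apply_apply hw, fourierComp_apply, smul_eq_mul]
  simp only [SchwartzMap.smulLeftCLM_apply_apply ha, smul_eq_mul]

theorem norm_exp_oscillation (x : ι → ℝ) (u : ι → ℝ) :
    ‖Complex.exp (-(Complex.I / 2) * ∑ j, (x j : ℂ) * (u j : ℂ))‖ = 1 := by
  have : -(Complex.I / 2) * ∑ j, (x j : ℂ) * (u j : ℂ) =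
      ((-(1 / 2) * ∑ j, x j * u j : ℝ) : ℂ) * Complex.I := by push_cast; ring
  rw [this, Complex.norm_exp_ofReal_mul_I]

/-- The imaginary shift `iy` turns into the real factor `exp(½⟨y, u⟩)`, a damping factor when the
pairing is negative. -/
theorem exp_oscillation_add (x y : ι → ℝ) (u : ι → ℝ) :
    Complex.exp (-(Complex.I / 2) * ∑ j, ((x j : ℂ) + Complex.I * (y j : ℂ)) * (u j : ℂ)) =
      ((Real.exp ((∑ j, y j * u j) / 2) : ℝ) : ℂ) *
        Complex.exp (-(Complex.I / 2) * ∑ j, (x j : ℂ) * (u j : ℂ)) := by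
  have : ∑ j, ((x j : ℂ) + Complex.I * (y j : ℂ)) * (u j : ℂ) =
      ∑ j, (x j : ℂ) * (u j : ℂ) + Complex.I * ∑ j, (y j : ℂ) * (u j : ℂ) := by
    rw [Finset.mul_sum, ← Finset.sum_add_distrib]
    exact Finset.sum_congr rfl fun j _ => by ring
  rw [this, Complex.ofReal_exp, ← Complex.exp_add]
  congr 1
  push_cast
  linear_combination (-(∑ j, (y j : ℂ) * (u j : ℂ)) / 2) * Complex.I_mul_I

/-- `Ψ(x, y, v)` is the product of `exp(-(i/2) ⟨x + iy, g(v)⟩)` and of a finite sum of products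
of functions of `x`, of `y` and of `v`. -/
def IsOscillatory {σ : Type*} (g : (κ → ℝ) → ι → ℝ) (s : Finset σ) (A G : σ → (ι → ℝ) → ℂ)
    (W : σ → (κ → ℝ) → ℂ) (Ψ : (ι → ℝ) → (ι → ℝ) → (κ → ℝ) → ℂ) : Prop :=
  ∀ x y v, Ψ x y v =
    Complex.exp (-(Complex.I / 2) * ∑ j, ((x j : ℂ) + Complex.I * (y j : ℂ)) * (g v j : ℂ)) *
      ∑ d ∈ s, A d x * G d y * W d v

variable {σ : Type*} {s : Finset σ} {A G : σ → (ι → ℝ) → ℂ} {W : σ → (κ → ℝ) → ℂ}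
  {Ψ : (ι → ℝ) → (ι → ℝ) → (κ → ℝ) → ℂ}

theorem kernel_eq_sum (hΨ : IsOscillatory g s A G W Ψ)
    (f : 𝓢(ι → ℝ, ℂ)) (x y : ι → ℝ) (v : κ → ℝ) :
    f x * Ψ x y v = ∑ d ∈ s, ((Real.exp ((∑ j, y j * g v j) / 2) : ℝ) : ℂ) * (G d y * W d v) *
      (A d x * f x * Complex.exp (-(Complex.I / 2) * ∑ j, (x j : ℂ) * (g v j : ℂ))) := by
  rw [hΨ, exp_oscillation_add, Finset.mul_sum, Finset.mul_sum]
  exact Finset.sum_congr rfl fun d _ => by ring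

theorem integrable_temperate_mul {a : (ι → ℝ) → ℂ} (ha : a.HasTemperateGrowth) (f : 𝓢(ι → ℝ, ℂ)) :
    Integrable fun x => a x * f x := by
  refine ((SchwartzMap.smulLeftCLM (𝕜 := ℂ) ℂ a f).integrable (μ := volume)).congr
    (ae_of_all _ fun x => ?_)
  rw [SchwartzMap.smulLeftCLM_apply_apply ha, smul_eq_mul]

theorem integrable_oscillation {a : (ι → ℝ) → ℂ} (ha : a.HasTemperateGrowth) (f : 𝓢(ι → ℝ, ℂ))
    (u : ι → ℝ) : Integrable fun x : ι → ℝ =>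
      a x * f x * Complex.exp (-(Complex.I / 2) * ∑ j, (x j : ℂ) * (u j : ℂ)) := by
  have hc : Continuous fun x : ι → ℝ =>
      Complex.exp (-(Complex.I / 2) * ∑ j, (x j : ℂ) * (u j : ℂ)) := by fun_prop
  exact (integrable_temperate_mul ha f).mul_bdd (c := 1) hc.aestronglyMeasurable
    (ae_of_all _ fun x => (norm_exp_oscillation x u).le)

theorem integrable_kernel (hA : ∀ d, (A d).HasTemperateGrowth) (hΨ : IsOscillatory g s A G W Ψ)
    (f : 𝓢(ι → ℝ, ℂ)) (y : ι → ℝ) (v : κ → ℝ) :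
    Integrable fun x => f x * Ψ x y v := by
  simp only [kernel_eq_sum hΨ]
  exact integrable_finsetSum _ fun d _ => (integrable_oscillation (hA d) f (g v)).const_mul _

theorem integral_kernel (hg : g.HasTemperateGrowth)
    (hg' : ∃ C, 0 ≤ C ∧ ∀ v, ‖v‖ ≤ C * (1 + ‖g v‖)) (hA : ∀ d, (A d).HasTemperateGrowth)
    (hW : ∀ d, (W d).HasTemperateGrowth) (hΨ : IsOscillatory g s A G W Ψ)
    (f : 𝓢(ι → ℝ, ℂ)) (y : ι → ℝ) (v : κ → ℝ) :
    ∫ x, f x * Ψ x y v = ((Real.exp ((∑ j, y j * g v j) / 2) : ℝ) : ℂ) *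
      ∑ d ∈ s, G d y * oscillatory hg hg' (A d) (W d) f v := by
  simp only [kernel_eq_sum hΨ]
  rw [integral_finsetSum _ fun d _ => (integrable_oscillation (hA d) f (g v)).const_mul _,
    Finset.mul_sum]
  refine Finset.sum_congr rfl fun d _ => ?_
  rw [integral_const_mul, oscillatory_apply hg hg' (hA d) (hW d)]
  ring

theorem exists_schwartz_kernel (hg : g.HasTemperateGrowth)
    (hg' : ∃ C, 0 ≤ C ∧ ∀ v, ‖v‖ ≤ C * (1 + ‖g v‖)) (hA : ∀ d, (A d).HasTemperateGrowth)
    (hW : ∀ d, (W d).HasTemperateGrowth) (hΨ : IsOscillatory g s A G W Ψ) :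
    ∃ T : 𝓢(ι → ℝ, ℂ) →L[ℂ] 𝓢(κ → ℝ, ℂ),
    ∀ f v, T f v = ∫ x, f x * Ψ x 0 v := by
  refine ⟨∑ d ∈ s, G d 0 • oscillatory hg hg' (A d) (W d), fun f v => ?_⟩
  rw [integral_kernel hg hg' hA hW hΨ]
  simp [_root_.sum_apply]

/-- After the integration over `x` the functions of `v` are Schwartz and independent of `y`, apart
from the damping factor, at most `1`, and scalars continuous in `y`. Dominated convergence applies.
-/
theorem tendsto_integral_kernel (hg : g.HasTemperateGrowth)
    (hg' : ∃ C, 0 ≤ C ∧ ∀ v, ‖v‖ ≤ C * (1 + ‖g v‖)) (hA : ∀ d, (A d).HasTemperateGrowth)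
    (hG : ∀ d, Continuous (G d)) (hW : ∀ d, (W d).HasTemperateGrowth)
    (hΨ : IsOscillatory g s A G W Ψ)
    (f : 𝓢(ι → ℝ, ℂ)) :
    Tendsto (fun y => ∫ v, ∫ x, f x * Ψ x y v) (𝓝[{y | ∀ v, ∑ j, y j * g v j ≤ 0}] 0)
      (𝓝 (∫ v, ∫ x, f x * Ψ x 0 v)) := by
  have hgc : Continuous g := hg.1.continuous
  have hgj (j : ι) : Continuous fun v => g v j := (continuous_apply j).comp hgc
  have hint (d : σ) {y : ι → ℝ} (hy : ∀ v, ∑ j, y j * g v j ≤ 0) :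
      Integrable fun v => ((Real.exp ((∑ j, y j * g v j) / 2) : ℝ) : ℂ) *
        oscillatory hg hg' (A d) (W d) f v := by
    refine ((oscillatory hg hg' (A d) (W d) f).integrable (μ := volume)).bdd_mul (c := 1) ?_ (ae_of_all _ fun v => ?_)
    · exact (by fun_prop : Continuous _).aestronglyMeasurable
    · rw [Complex.norm_real, Real.norm_of_nonneg (Real.exp_pos _).le, Real.exp_le_one_iff]
      linarith [hy v]
  have hsum {y : ι → ℝ} (hy : ∀ v, ∑ j, y j * g v j ≤ 0) :
      ∫ v, ∫ x, f x * Ψ x y v = ∑ d ∈ s, G d y *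
        ∫ v, ((Real.exp ((∑ j, y j * g v j) / 2) : ℝ) : ℂ) *
          oscillatory hg hg' (A d) (W d) f v := by
    simp only [integral_kernel hg hg' hA hW hΨ, Finset.mul_sum]
    rw [integral_finsetSum]
    · refine Finset.sum_congr rfl fun d _ => ?_
      rw [← integral_const_mul]
      exact integral_congr_ae (ae_of_all _ fun v => by ring)
    · intro d _
      refine ((hint d hy).const_mul (G d y)).congr (ae_of_all _ fun v => by simp only; ring)
  rw [hsum (y := 0) (by simp)]
  refine Tendsto.congr' (f₁ := fun y => ∑ d ∈ s, G d y *
    ∫ v, ((Real.exp ((∑ j, y j * g v j) / 2) : ℝ) : ℂ) * oscillatory hg hg' (A d) (W d) f v) ?_ ?_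
  · filter_upwards [self_mem_nhdsWithin] with y hy using (hsum hy).symm
  refine tendsto_finsetSum _ fun d _ => Tendsto.mul
    (((hG d).tendsto 0).mono_left nhdsWithin_le_nhds) ?_
  refine tendsto_integral_filter_of_dominated_convergence
    (fun v => ‖oscillatory hg hg' (A d) (W d) f v‖) ?_ ?_
    (SchwartzMap.integrable _ (μ := volume)).norm ?_
  · filter_upwards [self_mem_nhdsWithin] with y hy using (hint d hy).aestronglyMeasurable
  · filter_upwards [self_mem_nhdsWithin] with y hy
    refine ae_of_all _ fun v => ?_
    rw [norm_mul, Complex.norm_real, Real.norm_of_nonneg (Real.exp_pos _).le]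
    refine mul_le_of_le_one_left (norm_nonneg _) (Real.exp_le_one_iff.2 ?_)
    linarith [hy v]
  · refine ae_of_all _ fun v => ?_
    have : Continuous fun y : ι → ℝ => ((Real.exp ((∑ j, y j * g v j) / 2) : ℝ) : ℂ) *
      oscillatory hg hg' (A d) (W d) f v := by fun_prop
    exact (this.tendsto 0).mono_left nhdsWithin_le_nhds

/-- Strict negativity is needed here: the oscillation has modulus `1`, so absolute convergence in
`v` comes only from the Gaussian factor. -/
theorem integral_integral_kernel_swap (hg : g.HasTemperateGrowth)
    (hA : ∀ d, (A d).HasTemperateGrowth) (hW : ∀ d, (W d).HasTemperateGrowth)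
    (hΨ : IsOscillatory g s A G W Ψ)
    (f : 𝓢(ι → ℝ, ℂ)) {y : ι → ℝ}
    (hy : ∃ c > 0, ∀ v, ∑ j, y j * g v j ≤ -(c * ‖v‖ ^ 2)) :
    Integrable (fun x => f x * ∫ v, Ψ x y v) ∧
      ∫ x, f x * ∫ v, Ψ x y v = ∫ v, ∫ x, f x * Ψ x y v := by
  have hgc : Continuous g := hg.1.continuous
  have hgj (j : ι) : Continuous fun v => g v j := (continuous_apply j).comp hgc
  obtain ⟨c, hc, hcy⟩ := hy
  have hgauss (d : σ) : Integrable fun v =>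
      ((Real.exp ((∑ j, y j * g v j) / 2) : ℝ) : ℂ) * (G d y * W d v) := by
    obtain ⟨m, K, hK, hb⟩ := (hW d).exists_norm_le
    have hWc : Continuous (W d) := (hW d).1.continuous
    refine ((integrable_one_add_pow_mul_exp (D := κ → ℝ) volume (half_pos hc) m).const_mul
      (‖G d y‖ * K)).mono' (by fun_prop : Continuous _).aestronglyMeasurable
      (ae_of_all _ fun v => ?_)
    rw [norm_mul, norm_mul, Complex.norm_real, Real.norm_of_nonneg (Real.exp_pos _).le]
    have h1 : Real.exp ((∑ j, y j * g v j) / 2) ≤ Real.exp (-(c / 2 * ‖v‖ ^ 2)) :=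
      Real.exp_le_exp.2 (by linarith [hcy v])
    calc _ ≤ Real.exp (-(c / 2 * ‖v‖ ^ 2)) * (‖G d y‖ * (K * (1 + ‖v‖) ^ m)) := by
          gcongr; exact hb v
      _ = _ := by ring
  have hI : Integrable (Function.uncurry fun x v => f x * Ψ x y v)
      ((volume : Measure (ι → ℝ)).prod (volume : Measure (κ → ℝ))) := by
    simp only [Function.uncurry_def, kernel_eq_sum hΨ]
    refine integrable_finsetSum _ fun d _ => ?_
    have hgp (j : ι) : Continuous fun p : (ι → ℝ) × (κ → ℝ) => g p.2 j :=
      (hgj j).comp continuous_snd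
    have he : Continuous fun p : (ι → ℝ) × (κ → ℝ) =>
      Complex.exp (-(Complex.I / 2) * ∑ j, (p.1 j : ℂ) * (g p.2 j : ℂ)) := by fun_prop
    have h2 := ((integrable_temperate_mul (hA d) f).mul_prod (hgauss d)).mul_bdd (c := 1)
      he.aestronglyMeasurable (ae_of_all _ fun p => (norm_exp_oscillation p.1 (g p.2)).le)
    refine h2.congr (ae_of_all _ fun p => ?_)
    simp only
    ring
  simp only [← integral_const_mul]
  exact ⟨hI.integral_prod_left, integral_integral_swap hI⟩

end OscillatoryKernel

/-! ### The oscillatory kernel of the symplectic form -/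

section

namespace OrientedSymplectic
open scoped SchwartzMap
set_option linter.unusedSectionVars false

variable {V₀ V₁ : Type*} [NormedAddCommGroup V₀] [NormedSpace ℝ V₀] [FiniteDimensional ℝ V₀]
  [NormedAddCommGroup V₁] [NormedSpace ℝ V₁] [FiniteDimensional ℝ V₁]
  {S : OrientedSymplectic V₀ V₁} {k n N : ℕ} (b : S.OrientedBasis k n)
  {ι : Type*} [Fintype ι] (c₀ : Module.Basis ι ℝ S.spo₀) (c₁ : Module.Basis (Fin N) ℝ S.spo₁)

/-- The element `w ↦ B(u, w) u` of `sp(V₀)`. -/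
def rankOne (u : V₀) : S.spo₀ :=
  ⟨(LinearMap.toContinuousLinearMap ((S.B₀ u).smulRight u), 0), by
    refine ⟨fun v w => ?_, fun v w => by simp⟩
    have h := LinearMap.IsAlt.neg S.alt v u
    simp only [LinearMap.coe_toContinuousLinearMap', LinearMap.smulRight_apply, map_smul,
      LinearMap.smul_apply, smul_eq_mul]
    rw [← h]; ring⟩

theorem form_rankOne (u v : V₀) :
    S.B₀ v ((rankOne (S := S) u).1.1 v) = -(S.B₀ u v) ^ 2 := by
  have h := LinearMap.IsAlt.neg S.alt u v
  change S.B₀ v (S.B₀ u v • u) = _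
  rw [map_smul, smul_eq_mul, ← h]; ring

/-- The quadratic map `v ↦ (B(v, X_j v))_j`, for a basis `(X_j)` of `spo(V)₀`. -/
def moment (v : Fin k × Fin 2 → ℝ) (j : ι) : ℝ :=
  S.B₀ (b.e.equivFun.symm v) ((c₀ j).1.1 (b.e.equivFun.symm v))

theorem hasTemperateGrowth_moment : (moment b c₀).HasTemperateGrowth := by
  classical
  have h : moment b c₀ = fun v => ∑ j, ContinuousLinearMap.single ℝ (fun _ : ι => ℝ) j
      (moment b c₀ v j) := by
    funext v
    exact (Finset.univ_sum_single (moment b c₀ v)).symm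
  rw [h]
  refine Function.HasTemperateGrowth.sum fun j _ => ?_
  exact (ContinuousLinearMap.hasTemperateGrowth _).comp ((hasTemperateGrowth_form (c₀ j)).comp
    b.e.equivFun.symm.toContinuousLinearEquiv.hasTemperateGrowth)

theorem sum_mul_moment (Y : S.spo₀) (v : Fin k × Fin 2 → ℝ) :
    ∑ j, c₀.equivFun Y j * moment b c₀ v j =
      S.B₀ (b.e.equivFun.symm v) (Y.1.1 (b.e.equivFun.symm v)) :=
  (form_eq_sum c₀ Y _).symm

/-- If all moments of `v` vanish, the pairing with `rankOne u` gives `B(u, v)² = 0` for all `u`, so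
`v = 0` by nondegeneracy. Homogeneity and compactness then give quadratic growth. -/
theorem exists_norm_le_moment : ∃ C, 0 ≤ C ∧ ∀ v, ‖v‖ ≤ C * (1 + ‖moment b c₀ v‖) := by
  obtain ⟨c, hc, h⟩ := exists_pos_mul_sq_le (q := fun v => ‖moment b c₀ v‖)
    (hasTemperateGrowth_moment b c₀).1.continuous.norm
    (fun s v => by
      have : moment b c₀ (s • v) = s ^ 2 • moment b c₀ v := by
        funext j
        simp only [moment, Pi.smul_apply, smul_eq_mul]
        rw [LinearEquiv.map_smul b.e.equivFun.symm, form_smul]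
      rw [this, norm_smul, Real.norm_of_nonneg (sq_nonneg s)])
    (fun v hv => by
      rw [norm_pos_iff]
      intro h0
      have hv' : b.e.equivFun.symm v ≠ 0 := b.e.equivFun.symm.map_ne_zero_iff.2 hv
      refine hv' (S.nondegenerate₀.2 _ fun u => ?_)
      have h1 := sum_mul_moment b c₀ (rankOne u) v
      rw [form_rankOne, h0] at h1
      simpa using h1)
  -- From `‖v‖² ≤ c⁻¹ ‖moment‖` and `2‖v‖ ≤ 1 + ‖v‖²`.
  refine ⟨1 + c⁻¹, by positivity, fun v => ?_⟩
  have h1 : ‖v‖ ^ 2 ≤ c⁻¹ * ‖moment b c₀ v‖ := by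
    rw [le_inv_mul_iff₀ hc]; exact h v
  have h2 := norm_nonneg v
  have h3 := norm_nonneg (moment b c₀ v)
  have h4 : 0 < c⁻¹ := by positivity
  nlinarith [sq_nonneg (‖v‖ - 1)]

theorem exists_neg_moment {Y : S.spo₀} (hY : Y ∈ S.Vminus) :
    ∃ c > 0, ∀ v, ∑ j, c₀.equivFun Y j * moment b c₀ v j ≤ -(c * ‖v‖ ^ 2) := by
  simp only [sum_mul_moment]
  obtain ⟨c, hc, h⟩ := exists_pos_mul_sq_le
    (q := fun v => -S.B₀ (b.e.equivFun.symm v) (Y.1.1 (b.e.equivFun.symm v)))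
    ((continuous_form Y).comp (continuous_equivFun_symm b.e)).neg
    (fun s v => by rw [LinearEquiv.map_smul b.e.equivFun.symm, form_smul]; ring)
    (fun v hv => neg_pos.2 (hY _ (b.e.equivFun.symm.map_ne_zero_iff.2 hv)))
  exact ⟨c, hc, fun v => by have := h v; linarith⟩

/-- The values of a linear form on `exp(-(i/2) B(v, (X + iY)v))` in coordinates. -/
def kernel (ℓ : Module.Dual ℂ (Gr (S.spo₁ × V₁))) (x y : ι → ℝ) (v : Fin k × Fin 2 → ℝ) : ℂ :=
  ℓ (gexp (-(Complex.I / 2) •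
    S.quad (c₀.equivFun.symm x) (c₀.equivFun.symm y) (b.e.equivFun.symm v)))

theorem kernel_def (ℓ : Module.Dual ℂ (Gr (S.spo₁ × V₁))) (x y : ι → ℝ) (v : Fin k × Fin 2 → ℝ) :
    kernel b c₀ ℓ x y v = ℓ (gexp (-(Complex.I / 2) •
      S.quad (c₀.equivFun.symm x) (c₀.equivFun.symm y) (b.e.equivFun.symm v))) := rfl

theorem exists_kernel_eq (ℓ : Module.Dual ℂ (Gr (S.spo₁ × V₁))) :
    ∃ (s : Finset ((ι ⊕ ι) ⊕ (Fin k × Fin 2) →₀ ℕ))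
      (A G : ((ι ⊕ ι) ⊕ (Fin k × Fin 2) →₀ ℕ) → (ι → ℝ) → ℂ)
      (W : ((ι ⊕ ι) ⊕ (Fin k × Fin 2) →₀ ℕ) → (Fin k × Fin 2 → ℝ) → ℂ),
      (∀ d, (A d).HasTemperateGrowth) ∧ (∀ d, Continuous (G d)) ∧ (∀ d, (W d).HasTemperateGrowth) ∧
      ∀ x y v, kernel b c₀ ℓ x y v = Complex.exp (-(Complex.I / 2) *
          ∑ j, ((x j : ℂ) + Complex.I * (y j : ℂ)) * (moment b c₀ v j : ℂ)) *
        ∑ d ∈ s, A d x * G d y * W d v := by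
  obtain ⟨P, hP⟩ := exists_dual_gexp_quad_of_coeff b.e c₀ (-(Complex.I / 2)) ℓ
  obtain ⟨s, A, G, W, hA, hG, hW, h⟩ := exists_eval_add_I_mul P
  refine ⟨s, A, G, W, hA, hG, hW, fun x y v => ?_⟩
  have hx (x : ι → ℝ) (j : ι) : c₀.repr (c₀.equivFun.symm x) j = x j :=
    congrFun (c₀.equivFun.apply_symm_apply x) j
  rw [kernel_def, hP, coords_equivFun_symm, evenForm_eq_sum c₀, ← h]
  congr 1
  · simp only [hx]; rfl
  · congr 2
    funext i
    rcases i with j | i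
    · rw [Sum.elim_inl, Sum.elim_inl, complexCoords_apply, hx, hx]
    · rfl

theorem integrable_mul_kernel (ℓ : Module.Dual ℂ (Gr (S.spo₁ × V₁))) (f : 𝓢(ι → ℝ, ℂ))
    (y : ι → ℝ) (v : Fin k × Fin 2 → ℝ) : Integrable fun x => f x * kernel b c₀ ℓ x y v := by
  obtain ⟨s, A, G, W, hA, hG, hW, h⟩ := exists_kernel_eq b c₀ ℓ
  exact integrable_kernel hA h f y v

theorem exists_schwartz_integral_kernel (ℓ : Module.Dual ℂ (Gr (S.spo₁ × V₁))) :
    ∃ T : 𝓢(ι → ℝ, ℂ) →L[ℂ] 𝓢(Fin k × Fin 2 → ℝ, ℂ),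
      ∀ f v, T f v = ∫ x, f x * kernel b c₀ ℓ x 0 v := by
  obtain ⟨s, A, G, W, hA, hG, hW, h⟩ := exists_kernel_eq b c₀ ℓ
  exact exists_schwartz_kernel (hasTemperateGrowth_moment b c₀) (exists_norm_le_moment b c₀) hA hW h

theorem tendsto_integral_integral_kernel (ℓ : Module.Dual ℂ (Gr (S.spo₁ × V₁)))
    (f : 𝓢(ι → ℝ, ℂ)) :
    Tendsto (fun Y : S.spo₀ => ∫ v, ∫ x, f x * kernel b c₀ ℓ x (c₀.equivFun Y) v) (𝓝[S.Vminus] 0)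
      (𝓝 (∫ v, ∫ x, f x * kernel b c₀ ℓ x 0 v)) := by
  obtain ⟨s, A, G, W, hA, hG, hW, h⟩ := exists_kernel_eq b c₀ ℓ
  refine (tendsto_integral_kernel (hasTemperateGrowth_moment b c₀) (exists_norm_le_moment b c₀)
    hA hG hW h f).comp (tendsto_nhdsWithin_iff.2 ⟨?_, ?_⟩)
  · have : Continuous c₀.equivFun :=
      LinearMap.continuous_of_finiteDimensional (c₀.equivFun : S.spo₀ →ₗ[ℝ] ι → ℝ)
    have := this.tendsto 0
    rw [map_zero] at this
    exact this.mono_left nhdsWithin_le_nhds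
  · filter_upwards [self_mem_nhdsWithin] with Y hY v
    obtain ⟨c, hc, h⟩ := exists_neg_moment b c₀ hY
    exact (h v).trans (neg_nonpos.2 (by positivity))

theorem integral_mul_integral_kernel (ℓ : Module.Dual ℂ (Gr (S.spo₁ × V₁))) (f : 𝓢(ι → ℝ, ℂ))
    {Y : S.spo₀} (hY : Y ∈ S.Vminus) :
    Integrable (fun x => f x * ∫ v, kernel b c₀ ℓ x (c₀.equivFun Y) v) ∧
      ∫ x, f x * ∫ v, kernel b c₀ ℓ x (c₀.equivFun Y) v =
        ∫ v, ∫ x, f x * kernel b c₀ ℓ x (c₀.equivFun Y) v := by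
  obtain ⟨s, A, G, W, hA, hG, hW, h⟩ := exists_kernel_eq b c₀ ℓ
  exact integral_integral_kernel_swap (hasTemperateGrowth_moment b c₀) hA hW h f
    (exists_neg_moment b c₀ hY)

/-- The form is invariant under `(v₀, ξ) ↦ (-v₀, -ξ)`, so a functional odd in `ξ` gives an integrand
odd in `v₀`. -/
theorem integral_kernel_eq_zero_of_odd {ℓ : Module.Dual ℂ (Gr (S.spo₁ × V₁))}
    (hℓ : ∀ w, ℓ (S.scaleOdd (-1) w) = -ℓ w) (f : (ι → ℝ) → ℂ) :
    ∫ v, ∫ x, f x * kernel b c₀ ℓ x 0 v = 0 := by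
  have h (v : Fin k × Fin 2 → ℝ) : ∫ x, f x * kernel b c₀ ℓ x 0 (-v) =
      -∫ x, f x * kernel b c₀ ℓ x 0 v := by
    rw [← integral_neg]
    refine integral_congr_ae (ae_of_all _ fun x => ?_)
    simp only [kernel_def]
    rw [map_neg b.e.equivFun.symm, dual_gexp_quad_neg hℓ, mul_neg]
  have h1 := integral_neg_eq_self (fun v : Fin k × Fin 2 → ℝ =>
    ∫ x, f x * kernel b c₀ ℓ x 0 v) volume
  simp only [h] at h1
  rw [integral_neg] at h1
  exact self_eq_neg.1 h1.symm

/-- The two orders of Berezin integration can differ by signs when `n` is odd, but then both sides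
are zero. -/
theorem integral_kernel_innerFirst (y : Gr S.spo₁) (f : (ι → ℝ) → ℂ) :
    ∫ v, ∫ x, f x * kernel b c₀ (b.innerFirst c₁ y) x 0 v =
      ∫ v, ∫ x, f x * kernel b c₀ (b.fiberFirst c₁ y) x 0 v := by
  rcases n.even_or_odd with hn | hn
  · rw [b.innerFirst_eq_of_even c₁ hn]
  · rw [integral_kernel_eq_zero_of_odd, integral_kernel_eq_zero_of_odd]
    · intro w
      rw [b.fiberFirst_scaleOdd]; push_cast; rw [hn.neg_one_pow, neg_one_mul]
    · intro w
      rw [b.innerFirst_scaleOdd]; push_cast; rw [hn.neg_one_pow, neg_one_mul]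

end OrientedSymplectic

end

/-! ### The superPfaffian as a generalized function -/

section

namespace OrientedSymplectic
open scoped SchwartzMap
set_option linter.unusedSectionVars false

variable {V₀ V₁ : Type*} [NormedAddCommGroup V₀] [NormedSpace ℝ V₀] [FiniteDimensional ℝ V₀]
  [NormedAddCommGroup V₁] [NormedSpace ℝ V₁] [FiniteDimensional ℝ V₁]
  {S : OrientedSymplectic V₀ V₁} {k n N : ℕ} (b : S.OrientedBasis k n)
  {ι : Type*} [Fintype ι] (c₀ : Module.Basis ι ℝ S.spo₀) (c₁ : Module.Basis (Fin N) ℝ S.spo₁)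

/-- The coefficient `ψ_I` of a test function in the coordinates `c₀`, as a Schwartz function. -/
def testCoords {E : Type*} [NormedAddCommGroup E] [NormedSpace ℝ E] [FiniteDimensional ℝ E]
    (c₀ : Module.Basis ι ℝ E) (I : Finset (Fin N)) : SuperTest E N →L[ℂ] 𝓢(ι → ℝ, ℂ) :=
  SchwartzMap.compCLMOfContinuousLinearEquiv ℂ c₀.equivFun.symm.toContinuousLinearEquiv ∘L
    testToSchwartz E ∘L ContinuousLinearMap.proj (R := ℂ) I

theorem testCoords_apply {E : Type*} [NormedAddCommGroup E] [NormedSpace ℝ E]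
    [FiniteDimensional ℝ E] (c₀ : Module.Basis ι ℝ E) (I : Finset (Fin N)) (t : SuperTest E N)
    (x : ι → ℝ) : testCoords c₀ I t x = t I (c₀.equivFun.symm x) := rfl

theorem smul_sum_comp_apply {E F : Type*} [AddCommMonoid E] [Module ℂ E] [TopologicalSpace E]
    [AddCommMonoid F] [Module ℂ F] [TopologicalSpace F] {σ : Type*} (s : Finset σ) (c : ℂ)
    (L : F →L[ℂ] ℂ) (T : σ → E →L[ℂ] F) (t : E) :
    (c • ∑ I ∈ s, L ∘L T I) t = c * ∑ I ∈ s, L (T I t) := by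
  simp

theorem parameterIntegral_testValue (t : SuperTest S.spo₀ N) (x : ι → ℝ) (w : Gr (S.spo₁ × V₁)) :
    parameterIntegral c₁ (testValue c₁ t (c₀.equivFun.symm x)) w =
      ∑ I, testCoords c₀ I t x • parameterIntegral c₁ (monomials c₁ I) w := by
  simp only [parameterIntegral_apply, testValue, testCoords_apply, map_sum, map_smul,
    Finset.sum_mul, smul_mul_assoc]

theorem dual_parameterIntegral_testValue (t : SuperTest S.spo₀ N) (ℓ : Module.Dual ℂ (Gr V₁))
    (x : ι → ℝ) (w : Gr (S.spo₁ × V₁)) :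
    ℓ (parameterIntegral c₁ (testValue c₁ t (c₀.equivFun.symm x)) w) =
    ∑ I, testCoords c₀ I t x * (ℓ ∘ₗ parameterIntegral c₁ (monomials c₁ I)) w := by
  rw [parameterIntegral_testValue, map_sum]
  exact Finset.sum_congr rfl fun I _ => ℓ.map_smul _ _

theorem kernel_equivFun (ℓ : Module.Dual ℂ (Gr (S.spo₁ × V₁))) (x : ι → ℝ) (v : V₀) :
    kernel b c₀ ℓ x 0 (b.e.equivFun v) =
      ℓ (gexp (-(Complex.I / 2) • S.quad (c₀.equivFun.symm x) 0 v)) := by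
  rw [kernel_def, LinearEquiv.symm_apply_apply, map_zero]

theorem dual_parameterIntegral_gexp (t : SuperTest S.spo₀ N) (v : V₀) (ℓ : Module.Dual ℂ (Gr V₁))
    (x : ι → ℝ) :
    ℓ (parameterIntegral c₁ (testValue c₁ t (c₀.equivFun.symm x))
      (gexp (-(Complex.I / 2) • S.quad (c₀.equivFun.symm x) 0 v))) =
    ∑ I, testCoords c₀ I t x * kernel b c₀ (ℓ ∘ₗ parameterIntegral c₁ (monomials c₁ I)) x 0
      (b.e.equivFun v) := by
  simp only [kernel_equivFun]
  exact dual_parameterIntegral_testValue c₀ c₁ t ℓ x _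

theorem dual_partialPairing (t : SuperTest S.spo₀ N) (v : V₀) (ℓ : Module.Dual ℂ (Gr V₁)) :
    ℓ (partialPairing c₀ c₁ t v) = ∑ I, ∫ x, testCoords c₀ I t x *
      kernel b c₀ (ℓ ∘ₗ parameterIntegral c₁ (monomials c₁ I)) x 0 (b.e.equivFun v) := by
  have hint (ℓ : Module.Dual ℂ (Gr V₁)) (I : Finset (Fin N)) :=
    integrable_mul_kernel b c₀ (ℓ ∘ₗ parameterIntegral c₁ (monomials c₁ I))
      (testCoords c₀ I t) 0 (b.e.equivFun v)
  rw [partialPairing, pairingParam, dual_grIntegral]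
  · rw [← integral_finsetSum _ fun I _ => hint ℓ I]
    exact integral_congr_ae (ae_of_all _ fun x => dual_parameterIntegral_gexp b c₀ c₁ t v ℓ x)
  · intro ℓ
    refine (integrable_finsetSum Finset.univ fun I _ => hint ℓ I).congr (ae_of_all _ fun x => ?_)
    exact (dual_parameterIntegral_gexp b c₀ c₁ t v ℓ x).symm

theorem OrientedBasis.rapidlyDecreasing_partialPairing (b : S.OrientedBasis k n)
    (t : SuperTest S.spo₀ N) :
    RapidlyDecreasing (partialPairing c₀ c₁ t) := by
  intro ℓ
  choose T hT using fun I : Finset (Fin N) =>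
    exists_schwartz_integral_kernel b c₀ (ℓ ∘ₗ parameterIntegral c₁ (monomials c₁ I))
  refine ⟨SchwartzMap.compCLMOfContinuousLinearEquiv ℂ b.e.equivFun.toContinuousLinearEquiv
    (∑ I, T I (testCoords c₀ I t)), fun v => ?_⟩
  rw [dual_partialPairing b]
  have : (SchwartzMap.compCLMOfContinuousLinearEquiv ℂ b.e.equivFun.toContinuousLinearEquiv
    (∑ I, T I (testCoords c₀ I t))) v = (∑ I, T I (testCoords c₀ I t)) (b.e.equivFun v) := rfl
  rw [this, _root_.sum_apply]
  exact Finset.sum_congr rfl fun I _ => hT I _ _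

/-- Berezin integration over `V₁`. -/
def OrientedBasis.oddIntegral : Module.Dual ℂ (Gr V₁) := body.toLinearMap ∘ₗ berezin b.f

theorem OrientedBasis.oddIntegral_apply (y : Gr V₁) : b.oddIntegral y = body (berezin b.f y) := rfl

theorem OrientedBasis.oddIntegral_comp (y : Gr S.spo₁) :
    b.oddIntegral ∘ₗ parameterIntegral c₁ y = b.innerFirst c₁ y := rfl

theorem body_berezin_partialPairing (t : SuperTest S.spo₀ N) (v : Fin k × Fin 2 → ℝ) :
    body (berezin b.f (partialPairing c₀ c₁ t (b.e.equivFun.symm v))) =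
      ∑ I, ∫ x, testCoords c₀ I t x * kernel b c₀ (b.innerFirst c₁ (monomials c₁ I)) x 0 v := by
  rw [← b.oddIntegral_apply, dual_partialPairing b]
  simp only [b.oddIntegral_comp, LinearEquiv.apply_symm_apply]

/-- Continuity is that of a composite of maps of Schwartz spaces. The second formula integrates over
`V₁` first, the order in which `Spf_an` appears, and is the one reached as a boundary value. -/
theorem exists_generalizedFunction : ∃ Spf : GeneralizedFunction S.spo₀ N,
    ∀ t, Spf t = phase V₀ V₁ * b.integral (partialPairing c₀ c₁ t) ∧
      Spf t = phase V₀ V₁ * (((2 * Real.pi : ℂ) ^ k)⁻¹ * ∑ I, ∫ v, ∫ x, testCoords c₀ I t x *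
        kernel b c₀ (b.fiberFirst c₁ (monomials c₁ I)) x 0 v) := by
  choose T hT using fun I : Finset (Fin N) =>
    exists_schwartz_integral_kernel b c₀ (b.innerFirst c₁ (monomials c₁ I))
  let Spf : GeneralizedFunction S.spo₀ N := (phase V₀ V₁ * ((2 * Real.pi : ℂ) ^ k)⁻¹) •
    ∑ I, SchwartzMap.integralCLM ℂ volume ∘L (T I ∘L testCoords c₀ I)
  have hSpf (t : SuperTest S.spo₀ N) : Spf t = phase V₀ V₁ * (((2 * Real.pi : ℂ) ^ k)⁻¹ *
      ∑ I, ∫ v, T I (testCoords c₀ I t) v) :=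
    (smul_sum_comp_apply _ _ _ _ _).trans (mul_assoc _ _ _)
  refine ⟨Spf, fun t => ⟨?_, ?_⟩⟩
  · rw [hSpf, OrientedBasis.integral, ← integral_finsetSum _
      fun I _ => (T I (testCoords c₀ I t)).integrable (μ := volume)]
    congr 2
    refine integral_congr_ae (ae_of_all _ fun v => ?_)
    exact (Finset.sum_congr rfl fun I _ => hT I _ v).trans
      (body_berezin_partialPairing b c₀ c₁ t v).symm
  · refine (hSpf t).trans (congrArg _ (congrArg _ (Finset.sum_congr rfl fun I _ => ?_)))
    exact (integral_congr_ae (ae_of_all _ fun v => hT I _ v)).trans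
      (integral_kernel_innerFirst b c₀ c₁ _ _)

/-- `h ↦ ∫ ζ^I h`, the Berezin integral in the coordinates `c₁`. -/
def coefficientIntegral (I : Finset (Fin N)) : Module.Dual ℂ (Gr S.spo₁) :=
  body.toLinearMap ∘ₗ berezin (fun l => (1 : ℂ) ⊗ₜ[ℝ] c₁ l) ∘ₗ
    LinearMap.mulLeft ℂ (monomials c₁ I)

theorem pairing_eq (t : SuperTest S.spo₀ N) (h : S.spo₀ → Gr S.spo₁) :
    pairing c₀ c₁ t h = ∫ x : ι → ℝ, ∑ I,
      testCoords c₀ I t x * coefficientIntegral c₁ I (h (c₀.equivFun.symm x)) := by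
  refine integral_congr_ae (ae_of_all _ fun x => ?_)
  simp only [testValue, Finset.sum_mul, map_sum, smul_mul_assoc, map_smul, smul_eq_mul]
  rfl

theorem fiberFirst_monomials (I : Finset (Fin N)) (w : Gr (S.spo₁ × V₁)) :
    b.fiberFirst c₁ (monomials c₁ I) w = coefficientIntegral c₁ I (b.fiber w) := rfl

theorem pairing_spfAnRotated (t : SuperTest S.spo₀ N) {Y : S.spo₀} (hY : Y ∈ S.Vminus) :
    (pairing c₀ c₁ t fun X => b.spfAnRotated X Y) =
      phase V₀ V₁ * (((2 * Real.pi : ℂ) ^ k)⁻¹ * ∑ I, ∫ v, ∫ x, testCoords c₀ I t x *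
        kernel b c₀ (b.fiberFirst c₁ (monomials c₁ I)) x (c₀.equivFun Y) v) := by
  have h (x : ι → ℝ) (I : Finset (Fin N)) : testCoords c₀ I t x *
      coefficientIntegral c₁ I (b.spfAnRotated (c₀.equivFun.symm x) Y) =
      (phase V₀ V₁ * ((2 * Real.pi : ℂ) ^ k)⁻¹) * (testCoords c₀ I t x *
        ∫ v, kernel b c₀ (b.fiberFirst c₁ (monomials c₁ I)) x (c₀.equivFun Y) v) := by
    have hk (v : Fin k × Fin 2 → ℝ) :
        kernel b c₀ (b.fiberFirst c₁ (monomials c₁ I)) x (c₀.equivFun Y) v =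
          coefficientIntegral c₁ I (b.fiber (gexp (-(Complex.I / 2) •
            S.quad (c₀.equivFun.symm x) Y (b.e.equivFun.symm v)))) := by
      rw [kernel_def, LinearEquiv.symm_apply_apply]
      exact fiberFirst_monomials b c₁ I _
    simp only [hk]
    rw [b.dual_spfAnRotated hY]
    ring
  have hint (I : Finset (Fin N)) := integral_mul_integral_kernel b c₀
    (b.fiberFirst c₁ (monomials c₁ I)) (testCoords c₀ I t) hY
  refine (pairing_eq c₀ c₁ t _).trans ?_
  refine (integral_congr_ae (ae_of_all _ fun x => Finset.sum_congr rfl fun I _ => h x I)).trans ?_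
  refine (integral_finsetSum _ fun I _ => (hint I).1.const_mul _).trans ?_
  refine Eq.trans ?_ (mul_assoc _ _ _)
  refine Eq.trans ?_ (Finset.mul_sum _ _ _).symm
  refine Finset.sum_congr rfl fun I _ => ?_
  exact (integral_const_mul _ _).trans (congrArg _ (hint I).2)

theorem tendsto_pairing_spfAnRotated (t : SuperTest S.spo₀ N) :
    Tendsto (fun Y : S.spo₀ => pairing c₀ c₁ t fun X => b.spfAnRotated X Y) (𝓝[S.Vminus] 0)
      (𝓝 (phase V₀ V₁ * (((2 * Real.pi : ℂ) ^ k)⁻¹ * ∑ I, ∫ v, ∫ x, testCoords c₀ I t x *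
        kernel b c₀ (b.fiberFirst c₁ (monomials c₁ I)) x 0 v))) := by
  refine Tendsto.congr' (f₁ := fun Y : S.spo₀ => phase V₀ V₁ * (((2 * Real.pi : ℂ) ^ k)⁻¹ *
    ∑ I, ∫ v, ∫ x, testCoords c₀ I t x *
      kernel b c₀ (b.fiberFirst c₁ (monomials c₁ I)) x (c₀.equivFun Y) v)) ?_ ?_
  · filter_upwards [self_mem_nhdsWithin] with Y hY
    exact (pairing_spfAnRotated b c₀ c₁ t hY).symm
  · exact ((tendsto_finsetSum _ fun I _ =>
      tendsto_integral_integral_kernel b c₀ _ _).const_mul _).const_mul _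

/-! ### Restriction to `𝒱⁺` -/

/-- Summing `rankOne` over a basis gives the form `-∑ B(e_i, v)²`, negative definite by
nondegeneracy; its small positive multiples approach `0` in the cone. Without this the limit along
`𝒱⁻` would not determine `Spf`. -/
theorem neBot_nhdsWithin_Vminus : (𝓝[S.Vminus] (0 : S.spo₀)).NeBot := by
  let e := Module.finBasis ℝ V₀
  let X : S.spo₀ := ∑ i, rankOne (e i)
  have hform (v : V₀) : S.B₀ v (X.1.1 v) = -∑ i, S.B₀ (e i) v ^ 2 := by
    let L : S.spo₀ →ₗ[ℝ] ℝ :=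
      { toFun := fun X => S.B₀ v (X.1.1 v)
        map_add' := fun X Y => by simp
        map_smul' := fun c X => by simp }
    have h := map_sum L (fun i => rankOne (e i)) Finset.univ
    refine h.trans ?_
    rw [← Finset.sum_neg_distrib]
    exact Finset.sum_congr rfl fun i _ => form_rankOne _ _
  have hX : X ∈ S.Vminus := by
    intro v hv
    rw [hform, neg_lt_zero]
    refine (Finset.sum_nonneg fun i _ => sq_nonneg _).lt_of_ne fun h0 => hv ?_
    have h1 := (Finset.sum_eq_zero_iff_of_nonneg fun i _ => sq_nonneg _).1 h0.symm
    refine S.nondegenerate₀.2 v fun u => ?_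
    have h2 : S.B₀.flip v = 0 := e.ext fun i => by simpa using h1 i (Finset.mem_univ i)
    exact LinearMap.congr_fun h2 u
  have ht : Tendsto (fun s : ℝ => s • X) (𝓝[>] 0) (𝓝[S.Vminus] 0) := by
    refine tendsto_nhdsWithin_iff.2 ⟨?_, ?_⟩
    · have : Continuous fun s : ℝ => s • X := by fun_prop
      have := this.tendsto 0
      rw [zero_smul] at this
      exact this.mono_left nhdsWithin_le_nhds
    · filter_upwards [self_mem_nhdsWithin] with s hs v hv
      have : S.B₀ v ((s • X).1.1 v) = s * S.B₀ v (X.1.1 v) := by simp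
      rw [this]
      exact mul_neg_of_pos_of_neg hs (hX v hv)
  exact ht.neBot

theorem continuous_mul_dual_spfAn {f : S.spo₀ → ℂ} (hf : Continuous f)
    (hsupp : tsupport f ⊆ S.Vplus) (ℓ : Module.Dual ℂ (Gr S.spo₁)) :
    Continuous fun p : S.spo₀ × S.spo₀ => f p.1 * ℓ (b.spfAn p.1 p.2) := by
  obtain ⟨F, hF, hFa⟩ := b.analyticAt_spfAn (Module.finBasis ℝ S.spo₀) ℓ
  rw [continuous_iff_continuousAt]
  rintro ⟨X, Y⟩
  -- `spfAn` is controlled only over `𝒱⁺`. Near a point off the closed support the product vanishes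
  -- identically, and on the support the point lies in `𝒱⁺`.
  by_cases hX : X ∈ tsupport f
  · simp only [hF]
    refine (hf.comp continuous_fst).continuousAt.mul ?_
    exact ContinuousAt.comp (f := fun p : S.spo₀ × S.spo₀ =>
      complexCoords (Module.finBasis ℝ S.spo₀) (p.1, p.2)) (hFa X (hsupp hX) Y).continuousAt
      (complexCoords (Module.finBasis ℝ S.spo₀)).continuous.continuousAt
  · refine (continuousAt_const (y := (0 : ℂ))).congr ?_
    have h := (isClosed_tsupport f).isOpen_compl.preimage
      (continuous_fst : Continuous (Prod.fst : S.spo₀ × S.spo₀ → S.spo₀))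
    filter_upwards [h.mem_nhds (x := (X, Y)) hX] with p hp
    rw [image_eq_zero_of_notMem_tsupport hp, zero_mul]

theorem tendsto_pairing_spfAn (t : SuperTest S.spo₀ N) (ht : ∀ I, tsupport (t I) ⊆ S.Vplus) :
    Tendsto (fun Y : S.spo₀ => pairing c₀ c₁ t fun X => b.spfAn X Y) (𝓝 0)
      (𝓝 (pairing c₀ c₁ t fun X => b.spfAn X 0)) := by
  have hc : Continuous c₀.equivFun.symm :=
    LinearMap.continuous_of_finiteDimensional (c₀.equivFun.symm : (ι → ℝ) →ₗ[ℝ] S.spo₀)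
  have hc' : Continuous c₀.equivFun :=
    LinearMap.continuous_of_finiteDimensional (c₀.equivFun : S.spo₀ →ₗ[ℝ] ι → ℝ)
  have hK : IsCompact (⋃ I, c₀.equivFun '' tsupport (t I)) :=
    isCompact_iUnion fun I => (t I).hasCompactSupport.isCompact.image hc'
  simp only [pairing_eq]
  have := continuousOn_integral_of_compact_support (μ := (volume : Measure (ι → ℝ)))
    (f := fun (Y : S.spo₀) (x : ι → ℝ) => ∑ I, testCoords c₀ I t x *
      coefficientIntegral c₁ I (b.spfAn (c₀.equivFun.symm x) Y)) (s := Set.univ) hK ?_ ?_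
  · exact (continuousOn_univ.1 this).tendsto 0
  · refine Continuous.continuousOn (continuous_finsetSum _ fun I _ => ?_)
    exact (continuous_mul_dual_spfAn b (t I).continuous (ht I) (coefficientIntegral c₁ I)).comp
      ((hc.comp continuous_snd).prodMk continuous_fst)
  · intro Y x _ hx
    refine Finset.sum_eq_zero fun I _ => ?_
    have h0 : t I (c₀.equivFun.symm x) = 0 := image_eq_zero_of_notMem_tsupport fun h =>
      hx (Set.mem_iUnion.2 ⟨I, _, h, c₀.equivFun.apply_symm_apply x⟩)
    rw [testCoords_apply, h0, zero_mul]

theorem pairing_spfAnRotated_eq_spfAn (t : SuperTest S.spo₀ N)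
    (ht : ∀ I, tsupport (t I) ⊆ S.Vplus) {Y : S.spo₀} (hY : Y ∈ S.Vminus) :
    (pairing c₀ c₁ t fun X => b.spfAnRotated X Y) = pairing c₀ c₁ t fun X => b.spfAn X Y := by
  rw [pairing_eq, pairing_eq]
  refine integral_congr_ae (ae_of_all _ fun x => Finset.sum_congr rfl fun I _ => ?_)
  by_cases hx : c₀.equivFun.symm x ∈ tsupport (t I)
  · rw [b.spfAnRotated_eq (ht I hx) hY]
  · rw [testCoords_apply, image_eq_zero_of_notMem_tsupport hx, zero_mul, zero_mul]

end OrientedSymplectic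

end

end SuperPf

end

theorem mainTheorem2
    {V₀ V₁ : Type*} [NormedAddCommGroup V₀] [NormedSpace ℝ V₀] [FiniteDimensional ℝ V₀]
    [NormedAddCommGroup V₁] [NormedSpace ℝ V₁] [FiniteDimensional ℝ V₁]
    (S : SuperPf.OrientedSymplectic V₀ V₁) {k n : ℕ} (b : S.OrientedBasis k n)
    {ι : Type*} [Fintype ι] (c₀ : Module.Basis ι ℝ S.spo₀)
    {N : ℕ} (c₁ : Module.Basis (Fin N) ℝ S.spo₁) :
    -- the analytic superPfaffian is well defined and holomorphic on `𝒱⁺ + i spo(V)₀`,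
    -- and real analytic on `𝒱⁺`
    (∀ X ∈ S.Vplus, ∀ Y : S.spo₀,
      SuperPf.RapidlyDecreasing fun v => SuperPf.gexp (-(1 / 2 : ℂ) • S.quad X Y v)) ∧
    (∀ ℓ : Module.Dual ℂ (SuperPf.Gr S.spo₁), ∀ X ∈ S.Vplus, ∀ Y : S.spo₀,
      ∃ L : S.spo₀ × S.spo₀ →L[ℝ] ℂ,
        HasFDerivAt (fun p : S.spo₀ × S.spo₀ => ℓ (b.spfAn p.1 p.2)) L (X, Y) ∧
        ∀ Z W : S.spo₀, L (-W, Z) = Complex.I * L (Z, W)) ∧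
    (∀ ℓ : Module.Dual ℂ (SuperPf.Gr S.spo₁),
      AnalyticOnNhd ℝ (fun X => ℓ (b.spfAn X 0)) S.Vplus) ∧
    ∃ Spf : SuperPf.GeneralizedFunction S.spo₀ N,
      -- definition of the generalized function by the iterated integral
      (∀ t : SuperPf.SuperTest S.spo₀ N,
        SuperPf.RapidlyDecreasing
          (SuperPf.OrientedSymplectic.partialPairing c₀ c₁ t) ∧
        Spf t = SuperPf.OrientedSymplectic.phase V₀ V₁ * b.integral (SuperPf.OrientedSymplectic.partialPairing c₀ c₁ t)) ∧
      -- boundary value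
      (∀ t : SuperPf.SuperTest S.spo₀ N,
        Tendsto (fun Y : S.spo₀ =>
            SuperPf.OrientedSymplectic.pairing c₀ c₁ t fun X => b.spfAnRotated X Y)
          (𝓝[S.Vminus] 0) (𝓝 (Spf t))) ∧
      -- restriction to `𝒱⁺`
      (∀ t : SuperPf.SuperTest S.spo₀ N, (∀ I, tsupport (t I) ⊆ S.Vplus) →
        Spf t = SuperPf.OrientedSymplectic.pairing c₀ c₁ t fun X => b.spfAn X 0) := by
  obtain ⟨Spf, hSpf⟩ := SuperPf.OrientedSymplectic.exists_generalizedFunction b c₀ c₁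
  have hlim (t : SuperPf.SuperTest S.spo₀ N) : Tendsto (fun Y : S.spo₀ =>
      SuperPf.OrientedSymplectic.pairing c₀ c₁ t fun X => b.spfAnRotated X Y)
      (𝓝[S.Vminus] 0) (𝓝 (Spf t)) := by
    rw [(hSpf t).2]
    exact SuperPf.OrientedSymplectic.tendsto_pairing_spfAnRotated b c₀ c₁ t
  refine ⟨fun X hX Y => SuperPf.OrientedSymplectic.rapidlyDecreasing_gexp_quad
      (SuperPf.OrientedSymplectic.neg_half_re_neg hX Y),
    fun ℓ X hX Y => b.holomorphic_spfAn ℓ hX Y, fun ℓ => b.analyticOnNhd_spfAn ℓ, Spf,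
    fun t => ⟨b.rapidlyDecreasing_partialPairing c₀ c₁ t, (hSpf t).1⟩,
    hlim, fun t ht => ?_⟩
  have := SuperPf.OrientedSymplectic.neBot_nhdsWithin_Vminus (S := S)
  -- On the support of `t` the rotated function coincides with `Spf_an(X + iY)`, so the same pairing
  -- has two limits as `Y` tends to `0` in `𝒱⁻`.
  refine tendsto_nhds_unique (hlim t) (Tendsto.congr' ?_
    ((SuperPf.OrientedSymplectic.tendsto_pairing_spfAn b c₀ c₁ t ht).mono_left
      nhdsWithin_le_nhds))
  filter_upwards [self_mem_nhdsWithin] with Y hY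
  exact (SuperPf.OrientedSymplectic.pairing_spfAnRotated_eq_spfAn b c₀ c₁ t ht hY).symm
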